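/- In the submodular matroid secretary problem (SMSP) an instance consists of a finite ground set $E$, a matroid $\mathcal M=(E,\mathcal I)$ and a non-negative submodular function $f\colon 2^E\to\mathbb R_{\ge 0}$ (that is, $f(A\cup\{e\})-f(A)\ge f(B\cup\{e\})-f(B)$ for all $A\subseteq B\subseteq E$ and $e\in E\setminus B$). A (possibly randomized) online algorithm knows $n=|E|$ in advance. The elements of $E$ arrive in a uniformly random order, and upon the arrival of each element the algorithm must irrevocably accept or reject it, using only its internal randomness, the values $f(S)$, and the answers to "is $S\in\mathcal I$?", for sets $S$ of elements that have already arrived (including the current one). The set $\mathrm{ALG}$ of accepted elements must always be independent in $\mathcal M$. There exist an absolute constant $C>0$ and a single online algorithm, which is not told the rank of the matroid, such that for every SMSP instance $(E,\mathcal M,f)$, with $r$ denoting the rank of $\mathcal M$, \[ \max_{S\in\mathcal I} f(S)\;\le\; C\cdot\max\{1,\log\log r\}\cdot \mathbb E\bigl[f(\mathrm{ALG})\bigr], \] where the expectation is over the arrival order and the internal randomness of the algorithm, and $\max\{1,\log\log r\}$ is read as $1$ for $r\le 1$. That is, there is an $O(\log\log(\mathrm{rank}))$-competitive algorithm for SMSP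 on general matroids. -/

import Mathlib

noncomputable section

/-- Submodularity of a set function in its diminishing-returns form:
`f(A ∪ {e}) - f(A) ≥ f(B ∪ {e}) - f(B)` whenever `A ⊆ B` and `e ∉ B`. -/
def IsSubmodular {E : Type*} [DecidableEq E] (f : Finset E → ℝ) : Prop :=
  ∀ (A B : Finset E) (e : E), A ⊆ B → e ∉ B →
    f (insert e B) - f B ≤ f (insert e A) - f A

/-- Elements are named by their arrival position in `Fin n`. `ArrivedSet n i` is the type of the
sets that may be queried at step `i`: all their elements have arrived by step `i`
(the element at position `i`, about which a decision is due, included). -/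
abbrev ArrivedSet (n : ℕ) (i : Fin n) : Type := {S : Finset (Fin n) // S ⊆ Finset.Iic i}

/-- A randomized online algorithm for ground sets with `n` elements. It draws an internal random
seed; then, when the element at position `i` arrives, it decides irrevocably whether to accept
this element. The decision may depend only on the seed and on the answers of the value oracle and
of the independence oracle for sets of arrived elements. (Earlier decisions of the algorithm are
functions of the seed and of earlier oracle answers, so they are known to it as well.) -/
structure OnlineAlgorithm (n : ℕ) where
  /-- The finite set of outcomes of the internal randomness. -/
  Seed : Type
  [seedFintype : Fintype Seed]
  /-- The distribution of the internal randomness. -/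
  law : PMF Seed
  /-- The accept (`true`) or reject (`false`) decision at step `i`; the last two arguments are
  the value oracle and the independence oracle. -/
  accept : Seed → (i : Fin n) → (ArrivedSet n i → ℝ) → (ArrivedSet n i → Prop) → Bool

attribute [instance] OnlineAlgorithm.seedFintype

namespace OnlineAlgorithm

variable {E : Type*} [DecidableEq E] {n : ℕ}

/-- Whether the element at position `i` is accepted when the elements of `E` arrive in the order
`σ 0, σ 1, …` and the seed is `s`. -/
def accepts (A : OnlineAlgorithm n) (M : Matroid E) (f : Finset E → ℝ) (σ : Fin n ≃ E)
    (s : A.Seed) (i : Fin n) : Bool :=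
  A.accept s i
    (fun S => f (S.1.map σ.toEmbedding))
    (fun S => M.Indep (S.1.map σ.toEmbedding : Finset E))

/-- The set of all accepted elements, for arrival order `σ` and seed `s`. -/
def output (A : OnlineAlgorithm n) (M : Matroid E) (f : Finset E → ℝ) (σ : Fin n ≃ E)
    (s : A.Seed) : Finset E :=
  (Finset.univ.filter (fun i => A.accepts M f σ s i = true)).map σ.toEmbedding

/-- The expected value of the output, over a uniformly random arrival order and an independent
random seed. -/
def expectedValue [Fintype E] (A : OnlineAlgorithm n) (M : Matroid E) (f : Finset E → ℝ) : ℝ :=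
  (∑ σ : Fin n ≃ E, ∑ s : A.Seed, (A.law s).toReal * f (A.output M f σ s)) /
    (Fintype.card (Fin n ≃ E) : ℝ)

/-- On the instance `(M, f)` the algorithm always accepts an independent set, and the expected
value of its output is at least a `1 / ρ` fraction of `f(OPT)`, the maximum of `f` over all
independent sets. -/
def IsCompetitiveOn [Fintype E] (A : OnlineAlgorithm n) (M : Matroid E) (f : Finset E → ℝ)
    (ρ : ℝ) : Prop :=
  (∀ (σ : Fin n ≃ E) (s : A.Seed), M.Indep (A.output M f σ s : Set E)) ∧
    ∀ S : Finset E, M.Indep (S : Set E) → f S ≤ ρ * A.expectedValue M f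

end OnlineAlgorithm

end

/-! Positions are renamed, depending on the seed, so that a set `R` of candidate names arrives last.
For a uniform arrival order the resulting naming is uniform too, and the analysis then works for
every fixed naming. The seed consists of a uniform sample `S`, labels putting each unsampled element
into `X = extra S b` with probability 1/80, uniform sets `C`, `D`, a thinning set `Th`, and a rule
type. With `Y = X ∩ C`, only elements of `R = Y \ D` can be accepted; those of `Y ∩ D` serve as
references.

Weights. A greedy process (`proc`) repeatedly processes the feasible element of largest marginal
value but keeps only sampled elements; the weight of a processed element is its marginal value over
the kept elements before it. Whether `u` is sampled has no influence on the process up to `u`, so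
kept elements and elements of `X` can be exchanged at the cost of a factor 80 (`sum_lst_extra_eq`).
The optimum is bounded by `f ∅` and the expected kept weight (`card_mul_opt_le`), and `X` carries
1/80 of that weight. Damage done by `X` to kept elements is proportional to the size of `X`; after
exchange it becomes damage done by `X` to itself, smaller by a second factor 1/80. Hence a constant
fraction of the weight of `X` lies on `good` elements (`sum_good_ge`): they keep half of their
marginal value in the presence of `X`, are not spanned by other elements of `Y` of their own and
higher classes, are not too light compared with the sample, and have no competitor in `X` if they
precede the whole sample.

Acceptance. Weights are rounded to powers of 2, and the classes are grouped into blocks of `2 ^ t`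
consecutive classes, for scales `t ≤ T` with `2 ^ (2 ^ T) ≥ 16 (rank S + 1)`. A rule of scale `t <
T` uses blocks of one parity. It accepts `u` if `u` is not spanned by its rivals (references in
higher blocks, candidates in its own block), but is spanned by references in its own or higher
blocks of scale `t + 1`. The latter makes `u` harmless for lower blocks of the same parity, whence
independence (`sel_indep`). A good element is unspanned at scale `0`; either it becomes spanned
between two consecutive scales or it is still unspanned at scale `T`, where a separate rule applies.
A correlation inequality between a monotone event and its flip (`sum_mul_flip_le`, `sum_scales_ge`)
shows that the acceptance probabilities of all types sum to at least 1/4 (`sum_accept_ge`). Guessing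
one of the `2 (T + 2)` types therefore costs a factor of order log log rank. As `f` need not be
monotone, the selected set is thinned by `Th` (`sum_inter_ge`). -/

namespace SubmodularSecretary

noncomputable section

set_option linter.unusedSectionVars false

open scoped Classical

/-! ### Submodular functions -/

section Submodular

variable {α : Type*} [DecidableEq α]

/-- The marginal value of `e` with respect to `A`. -/
def marg (f : Finset α → ℝ) (e : α) (A : Finset α) : ℝ := f (insert e A) - f A

variable {f : Finset α → ℝ}

theorem marg_of_mem {e : α} {A : Finset α} (h : e ∈ A) : marg f e A = 0 := by
  simp [marg, Finset.insert_eq_of_mem h]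

theorem notMem_of_marg_pos {e : α} {A : Finset α} (h : 0 < marg f e A) : e ∉ A := fun h' => by
  rw [marg_of_mem h'] at h; exact lt_irrefl _ h

theorem marg_anti (hf : IsSubmodular f) {A B : Finset α} {e : α} (h : A ⊆ B) (he : e ∉ B) :
    marg f e B ≤ marg f e A := hf A B e h he

theorem union_sub_le (hf : IsSubmodular f) {A B : Finset α} (h : A ⊆ B) (C : Finset α)
    (hC : Disjoint C B) : f (B ∪ C) - f B ≤ f (A ∪ C) - f A := by
  induction C using Finset.induction_on with
  | empty => simp
  | insert e C he ih =>
    rw [Finset.disjoint_insert_left] at hC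
    have h1 := ih hC.2
    have h2 := hf (A ∪ C) (B ∪ C) e (Finset.union_subset_union_left h) (by simp [hC.1, he])
    rw [Finset.union_insert, Finset.union_insert]
    linarith

theorem union_add_inter_le (hf : IsSubmodular f) (A B : Finset α) :
    f (A ∪ B) + f (A ∩ B) ≤ f A + f B := by
  have h := union_sub_le hf (Finset.inter_subset_left : A ∩ B ⊆ A) (B \ A)
    Finset.sdiff_disjoint
  have e1 : A ∪ B \ A = A ∪ B := by simp
  have e2 : A ∩ B ∪ B \ A = B := by
    ext x; simp only [Finset.mem_union, Finset.mem_inter, Finset.mem_sdiff]; tauto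
  rw [e1, e2] at h
  linarith

theorem union_le_add_sum (hf : IsSubmodular f) (A B : Finset α) :
    f (A ∪ B) ≤ f A + ∑ e ∈ B \ A, marg f e A := by
  have key : ∀ C : Finset α, Disjoint C A → f (A ∪ C) ≤ f A + ∑ e ∈ C, marg f e A := by
    intro C
    induction C using Finset.induction_on with
    | empty => simp
    | insert e C he ih =>
      intro hC
      rw [Finset.disjoint_insert_left] at hC
      have h1 := ih hC.2
      have h2 := hf A (A ∪ C) e Finset.subset_union_left (by simp [hC.1, he])
      rw [Finset.sum_insert he, Finset.union_insert]
      simp only [marg] at *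
      linarith
  have := key (B \ A) Finset.sdiff_disjoint
  simpa using this

/-- Values on pairwise disjoint extensions of `A` are on average almost as large as `f A`. -/
theorem sum_union_disjoint_ge (hf : IsSubmodular f) (h0 : ∀ A, 0 ≤ f A) {ι : Type*}
    (s : Finset ι) (A : Finset α) (B : ι → Finset α)
    (hB : ∀ i ∈ s, ∀ j ∈ s, i ≠ j → Disjoint (B i) (B j)) :
    ((s.card : ℝ) - 1) * f A ≤ ∑ i ∈ s, f (A ∪ B i) := by
  classical
  -- The strengthened claim retains the value of the whole union, so that submodularity can absorb
  -- one more block at each step; nonnegativity discards that term at the end.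
  suffices h : (s.card : ℝ) * f A + f (A ∪ s.biUnion B) ≤ ∑ i ∈ s, f (A ∪ B i) + f A by
    have := h0 (A ∪ s.biUnion B); linarith
  induction s using Finset.induction_on with
  | empty => simp
  | insert i s hi ih =>
    have h1 := ih fun a ha b hb => hB a (Finset.mem_insert_of_mem ha) b (Finset.mem_insert_of_mem hb)
    have h2 := union_add_inter_le hf (A ∪ B i) (A ∪ s.biUnion B)
    have e1 : (A ∪ B i) ∪ (A ∪ s.biUnion B) = A ∪ (insert i s).biUnion B := by
      rw [Finset.biUnion_insert]; ext x; simp only [Finset.mem_union]; tauto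
    have hd : Disjoint (B i) (s.biUnion B) := by
      rw [Finset.disjoint_biUnion_right]
      intro j hj
      exact hB i (Finset.mem_insert_self _ _) j (Finset.mem_insert_of_mem hj)
        (fun h => hi (h ▸ hj))
    have e2 : (A ∪ B i) ∩ (A ∪ s.biUnion B) = A := by
      rw [← Finset.union_inter_distrib_left, Finset.disjoint_iff_inter_eq_empty.mp hd]; simp
    rw [e1, e2] at h2
    rw [Finset.sum_insert hi, Finset.card_insert_of_notMem hi]
    push_cast
    linarith

/-- A uniformly random subset of `Q` has expected value at least a quarter of the value of any
fixed subset of `Q`. -/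
theorem sum_inter_ge [Fintype α] (hf : IsSubmodular f) (h0 : ∀ A, 0 ≤ f A) {Q B : Finset α}
    (hB : B ⊆ Q) :
    (Fintype.card (Finset α) : ℝ) * f B ≤ 4 * ∑ t : Finset α, f (Q ∩ t) := by
  have flip : ∀ (F : Finset α) (g : Finset α → ℝ),
      ∑ t : Finset α, g (symmDiff t F) = ∑ t : Finset α, g t := fun F g =>
    Fintype.sum_bijective (fun t => symmDiff t F)
      (Function.Involutive.bijective fun t => by simp) _ _ (fun _ => rfl)
  -- Four equidistributed copies of `t`, obtained by flipping it on `B` and on `Q \ B`. Two copies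
  -- complementary on `Q \ B` intersect in `B ∩ t`, and two copies complementary on `B` then unite
  -- to `B`; this is why no monotonicity is needed and where 4 comes from.
  have hsum : 4 * ∑ t : Finset α, f (Q ∩ t) = ∑ t : Finset α,
      (f (Q ∩ t) + f (Q ∩ symmDiff t (Q \ B)) +
        (f (Q ∩ symmDiff t B) + f (Q ∩ symmDiff (symmDiff t B) (Q \ B)))) := by
    rw [Finset.sum_add_distrib, Finset.sum_add_distrib, Finset.sum_add_distrib,
      flip (Q \ B) fun t => f (Q ∩ t), flip B fun t => f (Q ∩ t),
      flip B fun t => f (Q ∩ symmDiff t (Q \ B)), flip (Q \ B) fun t => f (Q ∩ t)]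
    ring
  have hpair : ∀ t : Finset α, f (B ∩ t) ≤ f (Q ∩ t) + f (Q ∩ symmDiff t (Q \ B)) := by
    intro t
    have h := union_add_inter_le hf (Q ∩ t) (Q ∩ symmDiff t (Q \ B))
    have e : (Q ∩ t) ∩ (Q ∩ symmDiff t (Q \ B)) = B ∩ t := by
      ext x
      simp only [Finset.mem_inter, Finset.mem_symmDiff, Finset.mem_sdiff]
      have := @hB x
      tauto
    rw [e] at h
    have := h0 (Q ∩ t ∪ Q ∩ symmDiff t (Q \ B))
    linarith
  rw [hsum, ← nsmul_eq_mul, ← Finset.card_univ, ← Finset.sum_const]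
  refine Finset.sum_le_sum fun t _ => ?_
  have h1 := hpair t
  have h2 := hpair (symmDiff t B)
  have h := union_add_inter_le hf (B ∩ t) (B ∩ symmDiff t B)
  have e : B ∩ t ∪ B ∩ symmDiff t B = B := by
    ext x
    simp only [Finset.mem_inter, Finset.mem_union, Finset.mem_symmDiff]
    tauto
  rw [e] at h
  have := h0 (B ∩ t ∩ (B ∩ symmDiff t B))
  linarith

end Submodular

/-! ### Spans in terms of an independence oracle -/

section Span

variable {α : Type*} [DecidableEq α]

/-- `u` is spanned by `A`, expressed by independence of subsets of `A ∪ {u}`. -/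
def Spans (I : Finset α → Prop) (A : Finset α) (u : α) : Prop :=
  u ∈ A ∨ ∃ J ⊆ A, I J ∧ ¬ I (insert u J)

variable {N : Matroid α} {I : Finset α → Prop}

/-- `Spans` queries only subsets of `A ∪ {u}`, so an online algorithm can evaluate it. A basis of
`A` is the witness for the direction from the closure. -/
theorem spans_iff (hE : N.E = Set.univ) (hI : ∀ A, I A ↔ N.Indep (A : Set α)) {A : Finset α}
    {u : α} : Spans I A u ↔ u ∈ N.closure (A : Set α) := by
  have hg : ∀ X : Set α, X ⊆ N.E := fun X => by rw [hE]; exact Set.subset_univ _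
  constructor
  · rintro (h | ⟨J, hJA, hJ, hJu⟩)
    · exact N.mem_closure_of_mem (by exact_mod_cast h) (hg _)
    · rw [hI] at hJ hJu
      have hu : u ∉ J := fun h => hJu (by simpa [Finset.insert_eq_of_mem h] using hJ)
      rw [Finset.coe_insert, hJ.insert_indep_iff_of_notMem (by simpa using hu)] at hJu
      have : u ∈ N.closure (J : Set α) := by
        by_contra hc; exact hJu ⟨by rw [hE]; trivial, hc⟩
      exact N.closure_subset_closure (by exact_mod_cast hJA) this
  · intro hu
    by_cases huA : u ∈ A
    · exact Or.inl huA
    right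
    obtain ⟨J, hJ⟩ := N.exists_isBasis (A : Set α) (hg _)
    have hfin : J.Finite := A.finite_toSet.subset hJ.subset
    refine ⟨hfin.toFinset, ?_, ?_, ?_⟩
    · intro x hx
      have := hJ.subset (by simpa using hx)
      exact_mod_cast this
    · rw [hI]; simpa using hJ.indep
    · rw [hI]
      simp only [Finset.coe_insert, Set.Finite.coe_toFinset]
      have huJ : u ∉ J := fun h => huA (by exact_mod_cast hJ.subset h)
      rw [hJ.indep.insert_indep_iff_of_notMem huJ]
      rw [← hJ.closure_eq_closure] at hu
      exact fun h => h.2 hu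

theorem Spans.mono {A B : Finset α} {u : α} (h : Spans I A u) (hAB : A ⊆ B) : Spans I B u := by
  rcases h with h | ⟨J, hJ, h⟩
  · exact Or.inl (hAB h)
  · exact Or.inr ⟨J, hJ.trans hAB, h⟩

/-- The largest cardinality of an independent subset of `A`. -/
def rankOf (I : Finset α → Prop) (A : Finset α) : ℕ :=
  (A.powerset.filter fun J => I J).sup Finset.card

theorem card_le_rankOf {A J : Finset α} (hJ : I J) (hJA : J ⊆ A) : J.card ≤ rankOf I A :=
  Finset.le_sup (f := Finset.card) (by simp [hJ, hJA])

theorem rankOf_le {A : Finset α} {r : ℕ} (h : ∀ J ⊆ A, I J → J.card ≤ r) : rankOf I A ≤ r :=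
  Finset.sup_le fun J hJ => by
    simp only [Finset.mem_filter, Finset.mem_powerset] at hJ
    exact h J hJ.1 hJ.2

/-- Insert the elements in increasing order of `κ`: none falls into the span of its predecessors. It
is applied to the order by descending block and then time, and to the order by time alone. -/
theorem indep_of_notMem_closure_lt {β : Type*} [LinearOrder β] (hE : N.E = Set.univ) (κ : α → β)
    (Q : Finset α) (hinj : Set.InjOn κ Q)
    (h : ∀ u ∈ Q, u ∉ N.closure {v | v ∈ Q ∧ κ v < κ u}) : N.Indep (Q : Set α) := by
  induction Q using Finset.induction_on_max_value κ with
  | empty => simp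
  | insert a s ha hmax ih =>
    rw [Finset.coe_insert]
    have hs : N.Indep (s : Set α) := by
      refine ih (hinj.mono (by simp)) fun u hu hc => h u (Finset.mem_insert_of_mem hu) ?_
      have hsub : {v | v ∈ s ∧ κ v < κ u} ⊆ {v | v ∈ insert a s ∧ κ v < κ u} :=
        fun v hv => ⟨Finset.mem_insert_of_mem hv.1, hv.2⟩
      exact N.closure_subset_closure hsub hc
    rw [hs.insert_indep_iff_of_notMem (by simpa using ha)]
    refine ⟨by rw [hE]; trivial, fun hc => h a (Finset.mem_insert_self _ _) ?_⟩
    refine N.closure_subset_closure (fun v hv => ?_) hc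
    have hv' : v ∈ s := by exact_mod_cast hv
    refine ⟨Finset.mem_insert_of_mem hv', lt_of_le_of_ne (hmax v hv') fun he => ha ?_⟩
    rw [← hinj (by simp [hv']) (by simp) he]; exact hv'

end Span

/-! ### Prefixes of lists -/

section Lists

variable {α : Type*} [DecidableEq α]

/-- The set of the elements that precede (the first occurrence of) `u` in a list. -/
def pre : List α → α → Finset α
  | [], _ => ∅
  | e :: l, u => if u = e then ∅ else insert e (pre l u)

@[simp] theorem pre_nil (u : α) : pre [] u = ∅ := rfl

@[simp] theorem pre_cons_self (e : α) (l : List α) : pre (e :: l) e = ∅ := by simp [pre]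

theorem pre_cons_of_ne {e u : α} (h : u ≠ e) (l : List α) :
    pre (e :: l) u = insert e (pre l u) := by simp [pre, h]

theorem pre_subset (l : List α) (u : α) : pre l u ⊆ l.toFinset := by
  induction l with
  | nil => simp
  | cons e l ih =>
    by_cases h : u = e
    · subst h; simp
    · rw [pre_cons_of_ne h, List.toFinset_cons]; exact Finset.insert_subset_insert _ ih

theorem notMem_pre_self (l : List α) (u : α) : u ∉ pre l u := by
  induction l with
  | nil => simp
  | cons e l ih =>
    by_cases h : u = e
    · subst h; simp
    · rw [pre_cons_of_ne h]; simp [h, ih]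

theorem pre_subset_pre {l : List α} {u v : α} (h : v ∈ pre l u) : pre l v ⊆ pre l u := by
  induction l with
  | nil => simp at h
  | cons e l ih =>
    by_cases hu : u = e
    · subst hu; simp at h
    · rw [pre_cons_of_ne hu] at h ⊢
      by_cases hv : v = e
      · subst hv; simp
      · rw [pre_cons_of_ne hv]
        exact Finset.insert_subset_insert _ (ih ((Finset.mem_insert.1 h).resolve_left hv))

theorem mem_pre_or {l : List α} {u v : α} (hu : u ∈ l) (hne : u ≠ v) :
    u ∈ pre l v ∨ v ∈ pre l u := by
  induction l with
  | nil => simp at hu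
  | cons e l ih =>
    by_cases h : u = e
    · subst h; left; rw [pre_cons_of_ne hne.symm]; simp
    · by_cases h' : v = e
      · subst h'; right; rw [pre_cons_of_ne h]; simp
      · rw [pre_cons_of_ne h, pre_cons_of_ne h']
        rcases ih (by simpa [h] using hu) with h1 | h1
        · left; simp [h1]
        · right; simp [h1]

theorem pre_filter {l : List α} {V : Finset α} {u : α} (hu : u ∈ V) :
    pre (l.filter (· ∈ V)) u = pre l u ∩ V := by
  induction l with
  | nil => simp
  | cons e l ih =>
    by_cases he : e ∈ V
    · rw [List.filter_cons_of_pos (by simpa using he)]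
      by_cases h : u = e
      · subst h; simp
      · rw [pre_cons_of_ne h, pre_cons_of_ne h, ih, Finset.insert_inter_of_mem he]
    · rw [List.filter_cons_of_neg (by simpa using he), ih]
      have h : u ≠ e := fun h => he (h ▸ hu)
      rw [pre_cons_of_ne h, Finset.insert_inter_of_notMem he]

/-- Telescoping sum of the marginal values along a list. -/
theorem sum_marg_pre (g : Finset α → ℝ) (D : Finset α) (l : List α) (hl : l.Nodup)
    (B : Finset α) :
    ∑ u ∈ l.toFinset ∩ D, marg g u (B ∪ pre l u ∩ D) = g (B ∪ l.toFinset ∩ D) - g B := by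
  induction l generalizing B with
  | nil => simp
  | cons e l ih =>
    obtain ⟨he, hl⟩ := List.nodup_cons.1 hl
    have hcongr : ∀ u ∈ l.toFinset ∩ D, u ≠ e := fun u hu h => he (by
      subst h; simpa using (Finset.mem_inter.1 hu).1)
    rw [List.toFinset_cons]
    by_cases hD : e ∈ D
    · rw [Finset.insert_inter_of_mem hD, Finset.sum_insert (by simp [he])]
      have h1 := ih hl (insert e B)
      have h2 : ∑ u ∈ l.toFinset ∩ D, marg g u (B ∪ pre (e :: l) u ∩ D)
          = ∑ u ∈ l.toFinset ∩ D, marg g u (insert e B ∪ pre l u ∩ D) := by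
        refine Finset.sum_congr rfl fun u hu => ?_
        rw [pre_cons_of_ne (hcongr u hu), Finset.insert_inter_of_mem hD, Finset.union_insert,
          Finset.insert_union]
      rw [h2, h1, pre_cons_self]
      simp [marg, Finset.union_insert, Finset.insert_union]
    · rw [Finset.insert_inter_of_notMem hD, ← ih hl B]
      refine Finset.sum_congr rfl fun u hu => ?_
      rw [pre_cons_of_ne (hcongr u hu), Finset.insert_inter_of_notMem hD]

theorem sum_marg_pre_empty (g : Finset α → ℝ) (D : Finset α) {l : List α} (hl : l.Nodup) :
    ∑ u ∈ l.toFinset ∩ D, marg g u (pre l u ∩ D) = g (l.toFinset ∩ D) - g ∅ := by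
  simpa using sum_marg_pre g D l hl ∅

/-- Abel summation: nonnegative partial sums and nonincreasing nonnegative weights give a
nonnegative weighted sum. -/
theorem abel_nonneg (w a : α → ℝ) (l : List α) (hl : l.Nodup) (hw : ∀ u ∈ l, 0 ≤ w u)
    (hmono : ∀ u ∈ l, ∀ v ∈ pre l u, w u ≤ w v)
    (ha : ∀ u ∈ l, 0 ≤ ∑ v ∈ insert u (pre l u), a v) :
    0 ≤ ∑ u ∈ l.toFinset, w u * a u := by
  -- The induction carries the partial sum `c` so far, valued at the latest weight `b`. Passing to
  -- the next weight `w e` only gives away `c * (b - w e) ≥ 0`.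
  suffices H : ∀ (c b : ℝ), 0 ≤ c → 0 ≤ b → (∀ u ∈ l, w u ≤ b) →
      (∀ u ∈ l, 0 ≤ c + ∑ v ∈ insert u (pre l u), a v) →
      0 ≤ c * b + ∑ u ∈ l.toFinset, w u * a u by
    have hb : ∃ b, 0 ≤ b ∧ ∀ u ∈ l, w u ≤ b := by
      refine ⟨∑ u ∈ l.toFinset, w u, Finset.sum_nonneg fun u hu => hw u (by simpa using hu),
        fun u hu => ?_⟩
      exact Finset.single_le_sum (f := w) (fun u hu => hw u (by simpa using hu)) (by simpa using hu)
    obtain ⟨b, hb0, hb⟩ := hb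
    simpa using H 0 b le_rfl hb0 hb (by simpa using ha)
  clear ha
  induction l with
  | nil => intro c b hc hb _ _; simpa using mul_nonneg hc hb
  | cons e l ih =>
    intro c b hc hb hwb ha
    obtain ⟨he, hl⟩ := List.nodup_cons.1 hl
    have hne : ∀ u ∈ l, u ≠ e := fun u hu h => he (h ▸ hu)
    have hc' : 0 ≤ c + a e := by simpa using ha e (by simp)
    have h := ih hl (fun u hu => hw u (by simp [hu]))
      (fun u hu v hv => hmono u (by simp [hu]) v (by
        rw [pre_cons_of_ne (hne u hu)]; simp [hv])) (c + a e) (w e) hc' (hw e (by simp))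
      (fun u hu => hmono u (by simp [hu]) e (by rw [pre_cons_of_ne (hne u hu)]; simp))
      (fun u hu => by
        have := ha u (by simp [hu])
        rw [pre_cons_of_ne (hne u hu), Finset.insert_comm, Finset.sum_insert] at this
        · linarith
        · simp only [Finset.mem_insert, not_or]
          exact ⟨(hne u hu).symm, fun h => he (by simpa using pre_subset _ _ h)⟩)
    rw [List.toFinset_cons, Finset.sum_insert (by simpa using he)]
    have hwe := hwb e (by simp)
    nlinarith

end Lists

/-! ### The greedy process -/

section Greedy

variable {α : Type*} [LinearOrder α] (f : Finset α → ℝ) (I : Finset α → Prop)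

/-- The elements of `U` that the greedy process may choose when it holds the set `M`. -/
def feas (U M : Finset α) : Finset α := U.filter fun e => I (insert e M) ∧ 0 < marg f e M

/-- `e` is the feasible element of largest marginal value (ties are broken by the order). -/
def IsPick (U M : Finset α) (e : α) : Prop :=
  e ∈ feas f I U M ∧ ∀ v ∈ feas f I U M, toLex (marg f v M, v) ≤ toLex (marg f e M, e)

theorem exists_isPick {U M : Finset α} (h : (feas f I U M).Nonempty) :
    ∃ e, IsPick f I U M e :=
  Finset.exists_max_image _ (fun e => toLex (marg f e M, e)) h

variable {f I} in
theorem IsPick.unique {U M : Finset α} {e e' : α} (h : IsPick f I U M e)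
    (h' : IsPick f I U M e') : e = e' := by
  have := le_antisymm (h.2 e' h'.1) (h'.2 e h.1)
  have h2 := congrArg (fun x => (ofLex x).2) this
  exact h2.symm

variable {f I} in
theorem IsPick.mem {U M : Finset α} {e : α} (h : IsPick f I U M e) : e ∈ U :=
  (Finset.mem_filter.1 h.1).1

variable {f I} in
theorem IsPick.marg_le {U M : Finset α} {e v : α} (h : IsPick f I U M e)
    (hv : v ∈ feas f I U M) : marg f v M ≤ marg f e M := by
  have := h.2 v hv
  rw [Prod.Lex.toLex_le_toLex] at this
  rcases this with h | h
  · exact h.le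
  · exact h.1.le

/-- The set held by the greedy process after `e` has been processed; only elements of the
sample `S` are kept. -/
def step (S : Finset α) (e : α) (M : Finset α) : Finset α := if e ∈ S then insert e M else M

/-- The list of the elements of `U` in the order in which the greedy process, which keeps only
elements of `S`, processes them. -/
def proc (S U M : Finset α) : List α :=
  if h : (feas f I U M).Nonempty then
    (exists_isPick f I h).choose ::
      proc S (U.erase (exists_isPick f I h).choose) (step S (exists_isPick f I h).choose M)
  else []
  termination_by U.card
  decreasing_by exact Finset.card_erase_lt_of_mem (exists_isPick f I h).choose_spec.mem

variable {f I}

theorem proc_nil {S U M : Finset α} (h : feas f I U M = ∅) : proc f I S U M = [] := by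
  rw [proc, dif_neg (by simp [h])]

theorem proc_cons {S U M : Finset α} {e : α} (h : IsPick f I U M e) :
    proc f I S U M = e :: proc f I S (U.erase e) (step S e M) := by
  have hne : (feas f I U M).Nonempty := ⟨e, h.1⟩
  have he := (exists_isPick f I hne).choose_spec.unique h
  rw [proc, dif_pos hne, he]

/-- Induction along the greedy process. -/
theorem proc_induction {P : Finset α → Finset α → Prop}
    (nil : ∀ U M, feas f I U M = ∅ → P U M) (S : Finset α)
    (cons : ∀ U M e, IsPick f I U M e → P (U.erase e) (step S e M) → P U M) (U M : Finset α) :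
    P U M := by
  induction hn : U.card using Nat.strong_induction_on generalizing U M with
  | _ n ih =>
    rcases (feas f I U M).eq_empty_or_nonempty with h | h
    · exact nil U M h
    · obtain ⟨e, he⟩ := exists_isPick f I h
      exact cons U M e he
        (ih _ (hn ▸ Finset.card_erase_lt_of_mem he.mem) (U.erase e) (step S e M) rfl)

theorem proc_subset (S U M : Finset α) : ∀ u ∈ proc f I S U M, u ∈ U := by
  refine proc_induction (f := f) (I := I) (P := fun U M => ∀ u ∈ proc f I S U M, u ∈ U)
    (fun U M h => by simp [proc_nil h]) S (fun U M e he ih => ?_) U M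
  rw [proc_cons he]
  intro u hu
  rcases List.mem_cons.1 hu with rfl | hu
  · exact he.mem
  · exact Finset.mem_of_mem_erase (ih u hu)

theorem proc_nodup (S U M : Finset α) : (proc f I S U M).Nodup := by
  refine proc_induction (f := f) (I := I) (P := fun U M => (proc f I S U M).Nodup)
    (fun U M h => by simp [proc_nil h]) S (fun U M e he ih => ?_) U M
  rw [proc_cons he, List.nodup_cons]
  exact ⟨fun h => Finset.notMem_erase e U (proc_subset _ _ _ _ h), ih⟩

theorem step_union_inter (S : Finset α) (e : α) (M P : Finset α) :
    step S e M ∪ P ∩ S = M ∪ insert e P ∩ S := by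
  unfold step
  split_ifs with h
  · rw [Finset.insert_inter_of_mem h, Finset.union_insert, Finset.insert_union]
  · rw [Finset.insert_inter_of_notMem h]

theorem subset_step (S : Finset α) (e : α) (M : Finset α) : M ⊆ step S e M := by
  unfold step; split_ifs
  · exact Finset.subset_insert _ _
  · exact subset_rfl

/-- Processed elements were feasible with respect to the kept elements preceding them. -/
theorem proc_feas (S U M : Finset α) : ∀ u ∈ proc f I S U M,
    u ∈ feas f I U (M ∪ pre (proc f I S U M) u ∩ S) := by
  refine proc_induction (f := f) (I := I) (P := fun U M => ∀ u ∈ proc f I S U M,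
    u ∈ feas f I U (M ∪ pre (proc f I S U M) u ∩ S))
    (fun U M h => by simp [proc_nil h]) S (fun U M e he ih => ?_) U M
  have hnd := proc_nodup (f := f) (I := I) S U M
  rw [proc_cons he] at hnd ⊢
  intro u hu
  rcases List.mem_cons.1 hu with rfl | hu
  · simpa using he.1
  · have hne : u ≠ e := fun h => (List.nodup_cons.1 hnd).1 (h ▸ hu)
    rw [pre_cons_of_ne hne, ← step_union_inter]
    have := ih u hu
    simp only [feas, Finset.mem_filter] at this ⊢
    exact ⟨Finset.mem_of_mem_erase this.1, this.2⟩

/-- Feasibility with respect to a larger set implies feasibility. -/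
theorem feas_anti (hf : IsSubmodular f) (hI : ∀ A B : Finset α, A ⊆ B → I B → I A)
    {U M M' : Finset α} (h : M ⊆ M') : feas f I U M' ⊆ feas f I U M := by
  intro u hu
  simp only [feas, Finset.mem_filter] at hu ⊢
  exact ⟨hu.1, hI _ _ (Finset.insert_subset_insert _ h) hu.2.1,
    hu.2.2.trans_le (marg_anti hf h (notMem_of_marg_pos hu.2.2))⟩

/-- The marginal values are nonincreasing along the greedy process. -/
theorem proc_mono (hf : IsSubmodular f) (hI : ∀ A B : Finset α, A ⊆ B → I B → I A)
    (S U M : Finset α) : ∀ u ∈ proc f I S U M, ∀ v ∈ pre (proc f I S U M) u,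
    marg f u (M ∪ pre (proc f I S U M) u ∩ S) ≤ marg f v (M ∪ pre (proc f I S U M) v ∩ S) := by
  refine proc_induction (f := f) (I := I) (P := fun U M => ∀ u ∈ proc f I S U M,
    ∀ v ∈ pre (proc f I S U M) u,
    marg f u (M ∪ pre (proc f I S U M) u ∩ S) ≤ marg f v (M ∪ pre (proc f I S U M) v ∩ S))
    (fun U M h => by simp [proc_nil h]) S (fun U M e he ih => ?_) U M
  have hnd := proc_nodup (f := f) (I := I) S U M
  have hfe := proc_feas (f := f) (I := I) S U M
  rw [proc_cons he] at hnd hfe ⊢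
  intro u hu v hv
  by_cases hue : u = e
  · subst hue; simp at hv
  -- The head was chosen when `u` was already feasible, because feasibility and marginal values only
  -- shrink as the kept set grows.
  by_cases hve : v = e
  · subst hve
    have h1 := hfe u hu
    have h2 := marg_anti hf (Finset.subset_union_left : M ⊆ M ∪ pre (v :: proc f I S (U.erase v)
      (step S v M)) u ∩ S) (notMem_of_marg_pos (Finset.mem_filter.1 h1).2.2)
    have h3 := he.marg_le (feas_anti hf hI Finset.subset_union_left h1)
    simpa using h2.trans h3
  · have hu' : u ∈ proc f I S (U.erase e) (step S e M) := by simpa [hue] using hu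
    rw [pre_cons_of_ne hue] at hv
    have := ih u hu' v ((Finset.mem_insert.1 hv).resolve_left hve)
    rwa [pre_cons_of_ne hue, pre_cons_of_ne hve, ← step_union_inter, ← step_union_inter]

/-- The process restricted to a set `V` which contains the sample. -/
theorem proc_filter (S V : Finset α) (hV : S ⊆ V) (U M : Finset α) :
    proc f I S (U ∩ V) M = (proc f I S U M).filter (· ∈ V) := by
  refine proc_induction (f := f) (I := I)
    (P := fun U M => proc f I S (U ∩ V) M = (proc f I S U M).filter (· ∈ V))
    (fun U M h => ?_) S (fun U M e he ih => ?_) U M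
  · rw [proc_nil h, proc_nil]; · rfl
    rw [← Finset.subset_empty, ← h]
    exact Finset.filter_subset_filter _ Finset.inter_subset_left
  · rw [proc_cons he]
    -- An element outside `V ⊇ S` is never kept, so skipping it does not change the state of the
    -- process.
    by_cases heV : e ∈ V
    · have : IsPick f I (U ∩ V) M e := by
        refine ⟨?_, fun v hv => he.2 v ?_⟩
        · have := he.1
          simp only [feas, Finset.mem_filter, Finset.mem_inter] at this ⊢
          tauto
        · exact Finset.filter_subset_filter _ Finset.inter_subset_left hv
      rw [proc_cons this, List.filter_cons_of_pos (by simpa using heV), ← ih]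
      rw [Finset.erase_inter]
    · rw [List.filter_cons_of_neg (by simpa using heV), ← ih, step,
        if_neg fun h => heV (hV h)]
      congr 1
      ext x
      simp only [Finset.mem_inter, Finset.mem_erase]
      constructor
      · rintro ⟨h1, h2⟩; exact ⟨⟨fun h => heV (h ▸ h2), h1⟩, h2⟩
      · rintro ⟨h1, h2⟩; exact ⟨h1.2, h2⟩

/-- Whether `u` belongs to the sample has no influence on the process until `u` is processed. -/
theorem proc_toggle {S S' : Finset α} {u : α} (h : ∀ v, v ≠ u → (v ∈ S ↔ v ∈ S'))
    (U M : Finset α) :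
    (u ∉ proc f I S U M ∧ proc f I S U M = proc f I S' U M) ∨
      ∃ l₁ l₂ l₂', u ∉ l₁ ∧ proc f I S U M = l₁ ++ u :: l₂ ∧
        proc f I S' U M = l₁ ++ u :: l₂' := by
  refine proc_induction (f := f) (I := I) (P := fun U M =>
    (u ∉ proc f I S U M ∧ proc f I S U M = proc f I S' U M) ∨
      ∃ l₁ l₂ l₂', u ∉ l₁ ∧ proc f I S U M = l₁ ++ u :: l₂ ∧
        proc f I S' U M = l₁ ++ u :: l₂')
    (fun U M h => by simp [proc_nil h]) S (fun U M e he ih => ?_) U M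
  rw [proc_cons he, proc_cons he]
  by_cases heu : e = u
  · subst heu
    exact Or.inr ⟨[], _, _, by simp, rfl, rfl⟩
  · have hs : step S' e M = step S e M := by simp [step, h e heu]
    rw [hs]
    rcases ih with ⟨h1, h2⟩ | ⟨l₁, l₂, l₂', h1, h2, h3⟩
    · left; rw [← h2]; exact ⟨by simp [h1, Ne.symm heu], rfl⟩
    · right; exact ⟨e :: l₁, l₂, l₂', by simp [h1, Ne.symm heu], by rw [h2]; rfl, by rw [h3]; rfl⟩

/-- The process depends only on the oracle answers for subsets of `U ∪ M`. -/
theorem proc_congr {f' : Finset α → ℝ} {I' : Finset α → Prop} {V : Finset α}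
    (hf : ∀ A ⊆ V, f' A = f A) (hI : ∀ A ⊆ V, (I' A ↔ I A)) (S U M : Finset α) :
    U ⊆ V → M ⊆ V → proc f' I' S U M = proc f I S U M := by
  refine proc_induction (f := f) (I := I)
    (P := fun U M => U ⊆ V → M ⊆ V → proc f' I' S U M = proc f I S U M)
    (fun U M h hU hM => ?_) S (fun U M e he ih hU hM => ?_) U M
  all_goals
    have hfeas : feas f' I' U M = feas f I U M := by
      refine Finset.filter_congr fun e he => ?_
      have : insert e M ⊆ V := Finset.insert_subset (hU he) hM
      rw [hI _ this, marg, marg, hf _ this, hf _ hM]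
  · rw [proc_nil h, proc_nil (hfeas.trans h)]
  · have hm : ∀ v ∈ feas f I U M, marg f' v M = marg f v M := fun v hv => by
      rw [marg, marg, hf _ (Finset.insert_subset (hU (Finset.mem_filter.1 hv).1) hM), hf _ hM]
    have : IsPick f' I' U M e := by
      refine ⟨hfeas ▸ he.1, fun v hv => ?_⟩
      rw [hfeas] at hv
      rw [hm v hv, hm e he.1]
      exact he.2 v hv
    rw [proc_cons he, proc_cons this, ih ((Finset.erase_subset _ _).trans hU)]
    unfold step; split_ifs
    · exact Finset.insert_subset (hU he.mem) hM
    · exact hM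

theorem pre_append_left {l₁ : List α} {v : α} (h : v ∈ l₁) (l₂ : List α) :
    pre (l₁ ++ l₂) v = pre l₁ v := by
  induction l₁ with
  | nil => simp at h
  | cons e l ih =>
    rw [List.cons_append]
    by_cases hv : v = e
    · subst hv; simp
    · rw [pre_cons_of_ne hv, pre_cons_of_ne hv, ih (by simpa [hv] using h)]

theorem pre_append_self {l₁ : List α} {u : α} (h : u ∉ l₁) (l₂ : List α) :
    pre (l₁ ++ u :: l₂) u = l₁.toFinset := by
  induction l₁ with
  | nil => simp
  | cons e l ih =>
    rw [List.mem_cons, not_or] at h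
    rw [List.cons_append, pre_cons_of_ne h.1, ih h.2, List.toFinset_cons]

/-- This and the next two lemmas say that all data attached to `u` up to its processing are
independent of the coin deciding whether `u` is sampled; every exchange argument rests on them. -/
theorem proc_toggle_mem {S S' : Finset α} {u : α} (h : ∀ v, v ≠ u → (v ∈ S ↔ v ∈ S'))
    (U M : Finset α) : u ∈ proc f I S U M ↔ u ∈ proc f I S' U M := by
  rcases proc_toggle (f := f) (I := I) h U M with ⟨h1, h2⟩ | ⟨l₁, l₂, l₂', h1, h2, h3⟩
  · rw [h2]
  · simp [h2, h3]

theorem proc_toggle_pre {S S' : Finset α} {u : α} (h : ∀ v, v ≠ u → (v ∈ S ↔ v ∈ S'))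
    (U M : Finset α) : pre (proc f I S U M) u = pre (proc f I S' U M) u := by
  rcases proc_toggle (f := f) (I := I) h U M with ⟨h1, h2⟩ | ⟨l₁, l₂, l₂', h1, h2, h3⟩
  · rw [h2]
  · rw [h2, h3, pre_append_self h1, pre_append_self h1]

theorem proc_toggle_pre_of_mem {S S' : Finset α} {u v : α}
    (h : ∀ v, v ≠ u → (v ∈ S ↔ v ∈ S')) (U M : Finset α) 
    (hv : v ∈ pre (proc f I S U M) u) :
    pre (proc f I S U M) v = pre (proc f I S' U M) v := by
  rcases proc_toggle (f := f) (I := I) h U M with ⟨h1, h2⟩ | ⟨l₁, l₂, l₂', h1, h2, h3⟩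
  · rw [h2]
  · rw [h2, pre_append_self h1] at hv
    have hv' : v ∈ l₁ := by simpa using hv
    rw [h2, h3, pre_append_left hv', pre_append_left hv']

/-- The greedy bound: the elements of an independent set that are never processed have total
marginal value at most the total marginal value of the kept elements. -/
theorem proc_greedy (hf : IsSubmodular f) {N : Matroid α}
    (hI : ∀ A : Finset α, I A ↔ N.Indep (A : Set α)) (S U M : Finset α) :
    ∀ O ⊆ U, I (M ∪ O) →
      ∑ e ∈ O.filter (· ∉ proc f I S U M), marg f e (M ∪ (proc f I S U M).toFinset ∩ S) ≤
        ∑ m ∈ (proc f I S U M).toFinset ∩ S, marg f m (M ∪ pre (proc f I S U M) m ∩ S) := by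
  have hmono : ∀ A B : Finset α, A ⊆ B → I B → I A := fun A B h hB => by
    rw [hI] at hB ⊢; exact hB.subset (by exact_mod_cast h)
  refine proc_induction (f := f) (I := I) (P := fun U M => ∀ O ⊆ U, I (M ∪ O) →
      ∑ e ∈ O.filter (· ∉ proc f I S U M), marg f e (M ∪ (proc f I S U M).toFinset ∩ S) ≤
        ∑ m ∈ (proc f I S U M).toFinset ∩ S, marg f m (M ∪ pre (proc f I S U M) m ∩ S))
    (fun U M h O hO hInd => ?_) S (fun U M e he ih O hO hInd => ?_) U M
  · rw [proc_nil h]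
    simp only [List.not_mem_nil, not_false_eq_true, Finset.filter_true, List.toFinset_nil,
      Finset.empty_inter, Finset.sum_empty, Finset.union_empty]
    refine Finset.sum_nonpos fun o ho => ?_
    by_contra hc
    have : o ∈ feas f I U M := by
      simp only [feas, Finset.mem_filter]
      refine ⟨hO ho, hmono _ _ ?_ hInd, not_le.1 hc⟩
      exact Finset.insert_subset (Finset.mem_union_right _ ho) Finset.subset_union_left
    rw [h] at this
    simp at this
  · have hnd := proc_nodup (f := f) (I := I) S U M
    rw [proc_cons he] at hnd ⊢
    set l := proc f I S (U.erase e) (step S e M) with hl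
    have hel : e ∉ l := (List.nodup_cons.1 hnd).1
    have hfe := Finset.mem_filter.1 he.1
    have hfin : M ∪ (e :: l).toFinset ∩ S = step S e M ∪ l.toFinset ∩ S := by
      rw [List.toFinset_cons, step_union_inter]
    by_cases heS : e ∈ S
    · have hstep : step S e M = insert e M := by simp [step, heS]
      have hrhs : ∑ m ∈ (e :: l).toFinset ∩ S, marg f m (M ∪ pre (e :: l) m ∩ S)
          = marg f e M + ∑ m ∈ l.toFinset ∩ S, marg f m (step S e M ∪ pre l m ∩ S) := by
        rw [List.toFinset_cons, Finset.insert_inter_of_mem heS,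
          Finset.sum_insert (by simp [hel])]
        congr 1
        · simp
        · refine Finset.sum_congr rfl fun m hm => ?_
          have hne : m ≠ e := fun h => hel (by simpa [h] using (Finset.mem_inter.1 hm).1)
          rw [pre_cons_of_ne hne, ← step_union_inter]
      rw [hrhs, hfin]
      -- exchange one element of `O`
      obtain ⟨O', hO', hInd', hcard⟩ : ∃ O' ⊆ O, I (insert e M ∪ O') ∧
          (∀ a ∈ O \ O', ∀ b ∈ O \ O', a = b) := by
        have hMe : N.Indep ((insert e M : Finset α) : Set α) := (hI _).1 hfe.2.1
        have hMO : N.Indep ((M ∪ O : Finset α) : Set α) := (hI _).1 hInd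
        by_cases hecl : e ∈ N.closure ((M ∪ O : Finset α) : Set α)
        · by_cases heO : e ∈ M ∪ O
          · refine ⟨O, subset_rfl, ?_, by simp⟩
            rwa [Finset.insert_union, Finset.insert_eq_of_mem heO]
          · have hdep : N.Dep (insert e ((M ∪ O : Finset α) : Set α)) :=
              (hMO.insert_dep_iff).2 ⟨hecl, by simpa using heO⟩
            have hC := hMO.fundCircuit_isCircuit hecl (by simpa using heO)
            -- The fundamental circuit of `e` cannot lie in `insert e M`, which is independent by
            -- feasibility of `e`; so it contains an element of `O \ M` that can be exchanged for
            -- `e`.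
            have : ∃ o ∈ O, o ∉ M ∧ o ∈ N.fundCircuit e ((M ∪ O : Finset α) : Set α) := by
              by_contra hno
              push Not at hno
              have hsub : N.fundCircuit e ((M ∪ O : Finset α) : Set α) ⊆
                  ((insert e M : Finset α) : Set α) := by
                intro x hx
                have := Matroid.fundCircuit_subset_insert N e ((M ∪ O : Finset α) : Set α) hx
                simp only [Finset.coe_union, Set.mem_insert_iff, Set.mem_union,
                  Finset.mem_coe, Finset.coe_insert] at this ⊢
                rcases this with h | h | h
                · exact Or.inl h
                · exact Or.inr h
                · by_cases hxM : x ∈ M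
                  · exact Or.inr hxM
                  · exact absurd hx (hno x h hxM)
              exact hC.dep.not_indep (hMe.subset hsub)
            obtain ⟨o, hoO, hoM, hoC⟩ := this
            refine ⟨O.erase o, Finset.erase_subset _ _, ?_, ?_⟩
            · rw [hI]
              have h1 := hMO.mem_fundCircuit_iff hecl (by simpa using heO) |>.1 hoC
              refine h1.subset ?_
              intro x hx
              simp only [Finset.coe_union, Finset.coe_insert, Finset.coe_erase, Set.mem_union,
                Set.mem_insert_iff, Finset.mem_coe, Set.mem_sdiff, Set.mem_singleton_iff] at hx ⊢
              have hoe : o ≠ e := fun h => heO (h ▸ Finset.mem_union_right _ hoO)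
              rcases hx with (rfl | hx) | ⟨hx, hx'⟩
              · exact ⟨Or.inl rfl, hoe.symm⟩
              · exact ⟨Or.inr (Or.inl hx), fun h => hoM (h ▸ hx)⟩
              · exact ⟨Or.inr (Or.inr hx), hx'⟩
            · intro a ha b hb
              simp only [Finset.mem_sdiff, Finset.mem_erase, not_and, not_imp_not] at ha hb
              rw [ha.2 ha.1, hb.2 hb.1]
        · refine ⟨O, subset_rfl, ?_, by simp⟩
          rw [hI, Finset.insert_union, Finset.coe_insert]
          rw [hMO.insert_indep_iff]
          left
          refine ⟨?_, hecl⟩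
          exact hMe.subset_ground (by simp)
      have h1 := ih (O'.erase e) (Finset.erase_subset_erase _ (hO'.trans hO))
        (hmono _ _ (by rw [hstep]; exact Finset.union_subset_union_right (Finset.erase_subset _ _))
          hInd')
      have hsub : O.filter (· ∉ e :: l) ⊆
          (O'.erase e).filter (· ∉ l) ∪ (O \ O').filter (· ∉ e :: l) := by
        intro x hx
        simp only [Finset.mem_filter, List.mem_cons, not_or, Finset.mem_union, Finset.mem_erase,
          Finset.mem_sdiff] at hx ⊢
        tauto
      have hdisj : Disjoint ((O'.erase e).filter (· ∉ l)) ((O \ O').filter (· ∉ e :: l)) := by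
        rw [Finset.disjoint_left]
        intro x hx hx'
        simp only [Finset.mem_filter, Finset.mem_erase, Finset.mem_sdiff] at hx hx'
        exact hx'.1.2 hx.1.2
      have heq : O.filter (· ∉ e :: l) =
          (O'.erase e).filter (· ∉ l) ∪ (O \ O').filter (· ∉ e :: l) := by
        refine subset_antisymm hsub fun x hx => ?_
        simp only [Finset.mem_filter, List.mem_cons, not_or, Finset.mem_union, Finset.mem_erase,
          Finset.mem_sdiff] at hx ⊢
        have := @hO' x
        tauto
      rw [heq, Finset.sum_union hdisj]
      -- The at most one discarded element, if its marginal value is positive, was feasible when `e`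
      -- was picked. Hence it is paid for by the marginal value of `e`, the new term on the right.
      have h2 : ∑ o ∈ (O \ O').filter (· ∉ e :: l), marg f o (step S e M ∪ l.toFinset ∩ S) ≤
          marg f e M := by
        refine (Finset.sum_le_card_nsmul _ _ (marg f e M) fun o ho => ?_).trans ?_
        · have hoO : o ∈ O := by simp only [Finset.mem_filter, Finset.mem_sdiff] at ho; exact ho.1.1
          by_contra hc
          have hpos := hfe.2.2.trans (not_le.1 hc)
          have hle := marg_anti hf ((subset_step S e M).trans Finset.subset_union_left)
            (notMem_of_marg_pos hpos)
          refine hc (hle.trans (he.marg_le ?_))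
          simp only [feas, Finset.mem_filter]
          exact ⟨hO hoO, hmono _ _ (Finset.insert_subset (Finset.mem_union_right _ hoO)
            Finset.subset_union_left) hInd, hpos.trans_le hle⟩
        · have hc : ((O \ O').filter (· ∉ e :: l)).card ≤ 1 :=
            (Finset.card_le_card (Finset.filter_subset _ _)).trans
              (Finset.card_le_one.2 hcard)
          rw [nsmul_eq_mul]
          have : (((O \ O').filter (· ∉ e :: l)).card : ℝ) ≤ 1 := by exact_mod_cast hc
          nlinarith [hfe.2.2]
      linarith
    -- A processed element that is not sampled leaves the state unchanged. It may be dropped from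
    -- `O`, since only elements that are never processed are counted.
    · have hstep : step S e M = M := by simp [step, heS]
      have h1 := ih (O.erase e) (Finset.erase_subset_erase _ hO)
        (hmono _ _ (by rw [hstep]; exact Finset.union_subset_union_right (Finset.erase_subset _ _))
          hInd)
      have heq : O.filter (· ∉ e :: l) = (O.erase e).filter (· ∉ l) := by
        ext x
        simp only [Finset.mem_filter, List.mem_cons, not_or, Finset.mem_erase]
        tauto
      rw [heq, hfin]
      refine h1.trans (le_of_eq ?_)
      rw [List.toFinset_cons, Finset.insert_inter_of_notMem heS]
      refine Finset.sum_congr rfl fun m hm => ?_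
      have hne : m ≠ e := fun h => hel (by simpa [h] using (Finset.mem_inter.1 hm).1)
      rw [pre_cons_of_ne hne, ← step_union_inter]

end Greedy

/-! ### Swapping the two halves of a random split -/

section Flip

variable {α : Type*} [DecidableEq α] [Fintype α]

theorem sum_symmDiff (F : Finset α) (g : Finset α → ℝ) :
    ∑ A : Finset α, g (symmDiff A F) = ∑ A : Finset α, g A :=
  Fintype.sum_bijective (fun A => symmDiff A F)
    (Function.Involutive.bijective fun A => by simp) _ _ (fun _ => rfl)

/-- A monotone function is less correlated with its flip when more coordinates are flipped. -/
theorem sum_mul_flip_le {h : Finset α → ℝ} (hh : Monotone h) {F F' : Finset α} (hF : F ⊆ F') :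
    ∑ A : Finset α, h A * h (symmDiff A F') ≤ ∑ A : Finset α, h A * h (symmDiff A F) := by
  obtain ⟨G, hG, rfl⟩ : ∃ G, Disjoint G F ∧ F ∪ G = F' :=
    ⟨F' \ F, Finset.sdiff_disjoint, Finset.union_sdiff_of_subset hF⟩
  clear hF
  induction G using Finset.induction_on with
  | empty => simp
  | insert x G hx ih =>
    rw [Finset.disjoint_insert_left] at hG
    refine le_trans ?_ (ih hG.2)
    set H := F ∪ G with hH
    have hxH : x ∉ H := by simp [hH, hG.1, hx]
    have hins : F ∪ insert x G = symmDiff H {x} := by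
      ext y; simp only [Finset.union_insert, Finset.mem_insert, Finset.mem_symmDiff,
        Finset.mem_singleton, ← hH]
      by_cases hy : y = x
      · subst hy; simp [hxH]
      · simp [hy]
    rw [hins]
    set g : Finset α → ℝ := fun A => h A * h (symmDiff A H) - h A * h (symmDiff A (symmDiff H {x}))
      with hg
    suffices hsum : 0 ≤ ∑ A : Finset α, g A by
      simp only [hg, Finset.sum_sub_distrib] at hsum
      linarith
    -- Pairing `A` with `symmDiff A {x}` turns the summand into a product of two increments of `h`
    -- in direction `x`, at `A` and at `symmDiff A H`. As `x ∉ H`, the element `x` lies in both of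
    -- these sets or in neither, so the increments have the same sign.
    have h2 : ∑ A : Finset α, (g A + g (symmDiff A {x})) = 2 * ∑ A : Finset α, g A := by
      rw [Finset.sum_add_distrib, sum_symmDiff {x} g]; ring
    have h3 : 0 ≤ ∑ A : Finset α, (g A + g (symmDiff A {x})) := by
      refine Finset.sum_nonneg fun A _ => ?_
      have e1 : symmDiff (symmDiff A {x}) H = symmDiff (symmDiff A H) {x} :=
        symmDiff_right_comm _ _ _
      have e2 : symmDiff (symmDiff A {x}) (symmDiff H {x}) = symmDiff A H := by
        rw [symmDiff_symmDiff_symmDiff_comm]; simp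
      have e3 : symmDiff A (symmDiff H {x}) = symmDiff (symmDiff A H) {x} := by
        rw [symmDiff_assoc]
      simp only [hg]
      rw [e1, e2, e3]
      have hprod : 0 ≤ (h A - h (symmDiff A {x})) * (h (symmDiff A H) -
          h (symmDiff (symmDiff A H) {x})) := by
        by_cases hxA : x ∈ A
        · have sub : ∀ B : Finset α, x ∈ B → symmDiff B {x} ≤ B := fun B hB y hy => by
            simp only [Finset.mem_symmDiff, Finset.mem_singleton] at hy
            rcases hy with hy | hy
            · exact hy.1
            · exact absurd (hy.1 ▸ hB) hy.2
          exact mul_nonneg (sub_nonneg.2 (hh (sub A hxA)))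
            (sub_nonneg.2 (hh (sub _ (by simp [Finset.mem_symmDiff, hxA, hxH]))))
        · have sub : ∀ B : Finset α, x ∉ B → B ≤ symmDiff B {x} := fun B hB y hy => by
            simp only [Finset.mem_symmDiff, Finset.mem_singleton]
            exact Or.inl ⟨hy, fun h => hB (h ▸ hy)⟩
          exact mul_nonneg_of_nonpos_of_nonpos (sub_nonpos.2 (hh (sub A hxA)))
            (sub_nonpos.2 (hh (sub _ (by simp [Finset.mem_symmDiff, hxA, hxH]))))
      nlinarith [hprod]
    linarith

/-- Among the scales `0, …, T` there is, on average, enough room between the scale at which an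
event occurs for a random set and the scale at which it occurs for the flipped set. -/
theorem sum_scales_ge (h : ℕ → Finset α → ℝ) (F : ℕ → Finset α) (T : ℕ)
    (h01 : ∀ t A, h t A = 0 ∨ h t A = 1) (hmono : ∀ t, Monotone (h t))
    (hle : ∀ t A, h t A ≤ h (t + 1) A) (hF : ∀ t, F t ⊆ F (t + 1)) (h0 : ∀ A, h 0 A = 0) :
    (Fintype.card (Finset α) : ℝ) ≤
      2 * (∑ t ∈ Finset.range T, ∑ A : Finset α, h (t + 1) A * (1 - h t (symmDiff A (F t))) +
        ∑ A : Finset α, (1 - h T (symmDiff A (F T)))) := by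
  -- The joint event of a set and its flip can be gained from scale `t` to `t + 1` only if one of
  -- the two sets triggers at `t + 1` while the other did not at `t`. The flip by `F t` interchanges
  -- these two cases, hence the factor 2.
  have hstep : ∀ t, ∑ A : Finset α, h (t + 1) A * h (t + 1) (symmDiff A (F (t + 1))) -
      ∑ A : Finset α, h t A * h t (symmDiff A (F t)) ≤
        2 * ∑ A : Finset α, h (t + 1) A * (1 - h t (symmDiff A (F t))) := by
    intro t
    have e : ∑ A : Finset α, h (t + 1) (symmDiff A (F t)) * (1 - h t A) =
        ∑ A : Finset α, h (t + 1) A * (1 - h t (symmDiff A (F t))) := by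
      rw [← sum_symmDiff (F t)]
      simp
    have h1 := sum_mul_flip_le (hmono (t + 1)) (hF t)
    have h2 : ∑ A : Finset α, h (t + 1) A * h (t + 1) (symmDiff A (F t)) -
        ∑ A : Finset α, h t A * h t (symmDiff A (F t)) ≤
        ∑ A : Finset α, h (t + 1) A * (1 - h t (symmDiff A (F t))) +
          ∑ A : Finset α, h (t + 1) (symmDiff A (F t)) * (1 - h t A) := by
      rw [← Finset.sum_sub_distrib, ← Finset.sum_add_distrib]
      refine Finset.sum_le_sum fun A _ => ?_
      have a1 := hle t A
      have a2 := hle t (symmDiff A (F t))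
      rcases h01 t A with b1 | b1 <;> rcases h01 (t + 1) A with b2 | b2 <;>
        rcases h01 t (symmDiff A (F t)) with b3 | b3 <;>
        rcases h01 (t + 1) (symmDiff A (F t)) with b4 | b4 <;>
        rw [b1, b2] at a1 <;> rw [b3, b4] at a2 <;> rw [b1, b2, b3, b4] <;> linarith
    rw [e] at h2
    linarith
  have htel : ∑ A : Finset α, h T A * h T (symmDiff A (F T)) ≤
      2 * ∑ t ∈ Finset.range T, ∑ A : Finset α, h (t + 1) A * (1 - h t (symmDiff A (F t))) := by
    rw [Finset.mul_sum]
    have := Finset.sum_le_sum fun t (_ : t ∈ Finset.range T) => hstep t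
    rw [Finset.sum_range_sub (fun t => ∑ A : Finset α, h t A * h t (symmDiff A (F t)))] at this
    simp only [h0, zero_mul, Finset.sum_const_zero, sub_zero] at this
    exact this
  -- For values in {0, 1}, `h + h' - 1 ≤ h * h'`. If the event is likely at scale `T`, the scales
  -- below pay; otherwise the final term does.
  have hlast : ∑ A : Finset α, (h T A + h T (symmDiff A (F T)) - 1) ≤
      ∑ A : Finset α, h T A * h T (symmDiff A (F T)) := by
    refine Finset.sum_le_sum fun A _ => ?_
    rcases h01 T A with b1 | b1 <;> rcases h01 T (symmDiff A (F T)) with b2 | b2 <;>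
      rw [b1, b2] <;> norm_num
  simp only [Finset.sum_sub_distrib, Finset.sum_add_distrib, sum_symmDiff (F T) (h T),
    Finset.sum_const, Finset.card_univ, nsmul_eq_mul, mul_one] at hlast ⊢
  linarith

/-- A coordinate that an event does not depend on splits it evenly. -/
theorem two_mul_sum_notMem (u : α) (φ : Finset α → ℝ) (hφ : ∀ A, φ (symmDiff A {u}) = φ A) :
    2 * ∑ A : Finset α, (if u ∉ A then φ A else 0) = ∑ A : Finset α, φ A := by
  have h1 : ∑ A : Finset α, (if u ∉ A then φ A else 0) =
      ∑ A : Finset α, (if u ∈ A then φ A else 0) := by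
    rw [← sum_symmDiff {u}]
    refine Finset.sum_congr rfl fun A _ => ?_
    have : u ∉ symmDiff A {u} ↔ u ∈ A := by simp [Finset.mem_symmDiff]
    simp only [this, hφ]
  rw [two_mul]
  nth_rewrite 2 [h1]
  rw [← Finset.sum_add_distrib]
  refine Finset.sum_congr rfl fun A _ => ?_
  by_cases hu : u ∈ A <;> simp [hu]

end Flip

/-! ### The acceptance rule -/

section Accept

variable {α : Type*} [LinearOrder α]

/-- The marginal value of `u` with respect to the sample elements that precede it in `l`. -/
def wt (f : Finset α → ℝ) (l : List α) (S : Finset α) (u : α) : ℝ := marg f u (pre l u ∩ S)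

/-- The weight class of `u`. -/
def cls (f : Finset α → ℝ) (l : List α) (S : Finset α) (u : α) : ℤ := Int.log 2 (wt f l S u)

/-- The number of scales used with the sample `S`. -/
def lev (I : Finset α → Prop) (S : Finset α) : ℕ :=
  Nat.clog 2 (Nat.clog 2 (16 * (rankOf I S + 1)))

/-- The elements of `Y` whose span an accepted element `u` has to avoid at scale `t`: those of
`D` in higher blocks and the others in the block of `u`. -/
def rivals (c : α → ℤ) (Y D : Finset α) (t : ℕ) (u : α) : Finset α :=
  Y.filter fun y => y ≠ u ∧
    ((y ∈ D ∧ c u / 2 ^ t < c y / 2 ^ t) ∨ (y ∉ D ∧ c y / 2 ^ t = c u / 2 ^ t))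

/-- The elements of `D` that certify that `u` does not interfere with lower blocks. -/
def certs (c : α → ℤ) (Y D : Finset α) (t : ℕ) (u : α) : Finset α :=
  Y.filter fun y => y ∈ D ∧ c u / 2 ^ (t + 1) ≤ c y / 2 ^ (t + 1)

/-- The acceptance rule of type `j` for the element `u`, when the elements of `V` have arrived
and `l` is the list of processed elements. -/
def Accept (f : Finset α → ℝ) (I : Finset α → Prop) (S Y D : Finset α) (T j : ℕ) (l : List α)
    (V : Finset α) (u : α) : Prop :=
  u ∈ l ∧
  ((j / 2 < T ∧ cls f l S u / 2 ^ (j / 2) % 2 = ((j % 2 : ℕ) : ℤ) ∧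
      Spans I (certs (cls f l S) (l.toFinset ∩ Y ∩ V) D (j / 2) u) u ∧
      ¬ Spans I (rivals (cls f l S) (l.toFinset ∩ Y ∩ V) D (j / 2) u) u) ∨
    (j / 2 = T ∧ (∃ v ∈ l.toFinset ∩ S, (∀ v' ∈ l.toFinset ∩ S, cls f l S v' ≤ cls f l S v) ∧
        cls f l S u / 2 ^ T + ((j % 2 : ℕ) : ℤ) = cls f l S v / 2 ^ T) ∧
      ¬ Spans I (rivals (cls f l S) (l.toFinset ∩ Y ∩ V) D T u) u) ∨
    (T < j / 2 ∧ pre l u ∩ S = ∅ ∧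
      ∀ v ∈ l.toFinset ∩ Y ∩ V, v ∉ D → v ≠ u → (pre l v ∩ S).Nonempty))

theorem rivals_mono {c : α → ℤ} {Y Y' D : Finset α} (h : Y ⊆ Y') (t : ℕ) (u : α) :
    rivals c Y D t u ⊆ rivals c Y' D t u := Finset.filter_subset_filter _ h

/-- Restricting the tests to arrived elements makes them only easier to pass: rivals disappear,
while the certificates lie in `Y ∩ D` and are all present. So acceptance may be estimated as if
everything had arrived. -/
theorem Accept.of_univ {f : Finset α → ℝ} {I : Finset α → Prop} [Fintype α] {S Y D : Finset α}
    {T j : ℕ} {l : List α} {V : Finset α} {u : α} (hV : Y ∩ D ⊆ V)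
    (h : Accept f I S Y D T j l Finset.univ u) : Accept f I S Y D T j l V u := by
  have hsub : l.toFinset ∩ Y ∩ V ⊆ l.toFinset ∩ Y ∩ Finset.univ :=
    Finset.inter_subset_inter_left (Finset.subset_univ _)
  have hr : ∀ t, ¬ Spans I (rivals (cls f l S) (l.toFinset ∩ Y ∩ Finset.univ) D t u) u →
      ¬ Spans I (rivals (cls f l S) (l.toFinset ∩ Y ∩ V) D t u) u :=
    fun t hn hs => hn (hs.mono (rivals_mono hsub t u))
  refine ⟨h.1, ?_⟩
  rcases h.2 with ⟨h1, h2, h3, h4⟩ | ⟨h1, h2, h3⟩ | ⟨h1, h2, h3⟩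
  · refine Or.inl ⟨h1, h2, ?_, hr _ h4⟩
    refine h3.mono fun y hy => ?_
    simp only [certs, Finset.mem_filter, Finset.mem_inter] at hy ⊢
    exact ⟨⟨hy.1.1, hV (Finset.mem_inter.2 ⟨hy.1.1.2, hy.2.1⟩)⟩, hy.2⟩
  · exact Or.inr (Or.inl ⟨h1, h2, hr _ h3⟩)
  · exact Or.inr (Or.inr ⟨h1, h2, fun v hv => h3 v (hsub hv)⟩)

variable [Fintype α]

/-- The elements that have arrived when `u` arrives. -/
def arrived (ord : α → ℕ) (u : α) : Finset α := Finset.univ.filter fun v => ord v ≤ ord u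

/-- The list of processed elements of the whole ground set. -/
def lst (f : Finset α → ℝ) (I : Finset α → Prop) (S : Finset α) : List α :=
  proc f I S Finset.univ ∅

/-- The set selected by the rule of type `j` for the arrival order `ord`. -/
def sel (f : Finset α → ℝ) (I : Finset α → Prop) (S Y D : Finset α) (ord : α → ℕ) (j : ℕ) :
    Finset α :=
  (Y \ D).filter fun u => Accept f I S Y D (lev I S) j (lst f I S) (arrived ord u) u

variable {f : Finset α → ℝ} {I : Finset α → Prop} {N : Matroid α}

theorem sel_indep (hE : N.E = Set.univ) (hI : ∀ A : Finset α, I A ↔ N.Indep (A : Set α))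
    (S Y D : Finset α) {ord : α → ℕ} (hord : Function.Injective ord)
    (hlast : ∀ u ∈ Y \ D, ∀ v ∉ Y \ D, ord v < ord u) (j : ℕ) :
    N.Indep (sel f I S Y D ord j : Set α) := by
  set l := lst f I S with hl
  set c := cls f l S with hc
  have hmem : ∀ u ∈ sel f I S Y D ord j, u ∈ Y ∧ u ∉ D ∧
      Accept f I S Y D (lev I S) j l (arrived ord u) u := fun u hu => by
    simp only [sel, Finset.mem_filter, Finset.mem_sdiff] at hu
    exact ⟨hu.1.1, hu.1.2, hu.2⟩
  have hg : ∀ X : Set α, X ⊆ N.E := fun X => by rw [hE]; exact Set.subset_univ _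
  rcases lt_trichotomy (j / 2) (lev I S) with hj | hj | hj
  · set t := j / 2 with ht
    refine indep_of_notMem_closure_lt hE (fun u => toLex (- (c u / 2 ^ t), ord u)) _ ?_ ?_
    · intro u _ v _ huv
      exact hord (congrArg (fun x => (ofLex x).2) huv)
    · intro u hu
      obtain ⟨huY, huD, hul, hacc⟩ := hmem u hu
      have hacc' : c u / 2 ^ t % 2 = ((j % 2 : ℕ) : ℤ) ∧
          ¬ Spans I (rivals c (l.toFinset ∩ Y ∩ arrived ord u) D t u) u := by
        rcases hacc with ⟨h1, h2, h3, h4⟩ | ⟨h1, _⟩ | ⟨h1, _⟩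
        · exact ⟨h2, h4⟩
        · omega
        · omega
      obtain ⟨hpar, hns⟩ := hacc'
      rw [spans_iff hE hI] at hns
      intro hcl
      refine hns (N.closure_subset_closure_of_subset_closure ?_ hcl)
      rintro v ⟨hv, hlt⟩
      obtain ⟨hvY, hvD, hvl, hvacc⟩ := hmem v hv
      have hvacc' : c v / 2 ^ t % 2 = ((j % 2 : ℕ) : ℤ) ∧
          Spans I (certs c (l.toFinset ∩ Y ∩ arrived ord v) D t v) v := by
        rcases hvacc with ⟨h1, h2, h3, h4⟩ | ⟨h1, _⟩ | ⟨h1, _⟩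
        · exact ⟨h2, h3⟩
        · omega
        · omega
      obtain ⟨hvpar, hvs⟩ := hvacc'
      rw [Prod.Lex.toLex_lt_toLex] at hlt
      simp only [neg_lt_neg_iff, neg_inj] at hlt
      rcases hlt with hlt | ⟨heq, hlt⟩
      -- `v` lies in a strictly higher block of the same parity, hence at least two blocks higher,
      -- and so in a strictly higher block of scale `t + 1`. Every certificate of `v` is therefore
      -- in a higher block than `u` and is a rival of `u`.
      · rw [spans_iff hE hI] at hvs
        have hsub : certs c (l.toFinset ∩ Y ∩ arrived ord v) D t v ⊆
            rivals c (l.toFinset ∩ Y ∩ arrived ord u) D t u := by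
          intro y hy
          simp only [certs, rivals, Finset.mem_filter, Finset.mem_inter] at hy ⊢
          refine ⟨⟨hy.1.1, ?_⟩, fun h => huD (h ▸ hy.2.1), Or.inl ⟨hy.2.1, ?_⟩⟩
          · simp only [arrived, Finset.mem_filter, Finset.mem_univ, true_and]
            exact (hlast u (by simp [huY, huD]) y (by simp [hy.2.1])).le
          have h1 := hy.2.2
          rw [pow_succ, ← Int.ediv_ediv_of_nonneg (by positivity),
            ← Int.ediv_ediv_of_nonneg (by positivity)] at h1
          omega
        exact N.closure_subset_closure (by exact_mod_cast hsub) hvs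
      · refine N.mem_closure_of_mem ?_ (hg _)
        have : v ∈ rivals c (l.toFinset ∩ Y ∩ arrived ord u) D t u := by
          simp only [rivals, Finset.mem_filter, Finset.mem_inter, arrived, Finset.mem_univ,
            true_and]
          exact ⟨⟨⟨by simpa using hvl, hvY⟩, hlt.le⟩, fun h => by subst h; omega,
            Or.inr ⟨hvD, heq⟩⟩
        exact_mod_cast this
  -- At scale `lev I S` all selected elements share one block, determined by the largest sampled
  -- class and the parity bit of `j`. Earlier selections are thus rivals themselves and no
  -- certificates are needed.
  · refine indep_of_notMem_closure_lt hE ord _ (hord.injOn) ?_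
    intro u hu
    obtain ⟨huY, huD, hul, hacc⟩ := hmem u hu
    have hacc' : (∃ v ∈ l.toFinset ∩ S, (∀ v' ∈ l.toFinset ∩ S, c v' ≤ c v) ∧
        c u / 2 ^ (lev I S) + ((j % 2 : ℕ) : ℤ) = c v / 2 ^ (lev I S)) ∧
        ¬ Spans I (rivals c (l.toFinset ∩ Y ∩ arrived ord u) D (lev I S) u) u := by
      rcases hacc with ⟨h1, _⟩ | ⟨h1, h2, h3⟩ | ⟨h1, _⟩
      · omega
      · exact ⟨h2, h3⟩
      · omega
    obtain ⟨⟨m, hm, hmax, hmu⟩, hns⟩ := hacc'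
    rw [spans_iff hE hI] at hns
    intro hcl
    refine hns (N.closure_subset_closure ?_ hcl)
    rintro v ⟨hv, hlt⟩
    obtain ⟨hvY, hvD, hvl, hvacc⟩ := hmem v hv
    have hvacc' : ∃ v' ∈ l.toFinset ∩ S, (∀ v'' ∈ l.toFinset ∩ S, c v'' ≤ c v') ∧
        c v / 2 ^ (lev I S) + ((j % 2 : ℕ) : ℤ) = c v' / 2 ^ (lev I S) := by
      rcases hvacc with ⟨h1, _⟩ | ⟨h1, h2, h3⟩ | ⟨h1, _⟩
      · omega
      · exact h2
      · omega
    obtain ⟨m', hm', hmax', hmv⟩ := hvacc'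
    have hmm : c m = c m' := le_antisymm (hmax' m hm) (hmax m' hm')
    have : v ∈ rivals c (l.toFinset ∩ Y ∩ arrived ord u) D (lev I S) u := by
      simp only [rivals, Finset.mem_filter, Finset.mem_inter, arrived, Finset.mem_univ,
        true_and]
      exact ⟨⟨⟨by simpa using hvl, hvY⟩, hlt.le⟩, fun h => by subst h; omega,
        Or.inr ⟨hvD, by rw [hmm] at hmu; omega⟩⟩
    exact_mod_cast this
  -- The last type selects at most one element, since the later of two would see the earlier one. A
  -- singleton preceding the sample is independent because it was feasible over the empty set.
  · have hacc : ∀ u ∈ sel f I S Y D ord j, pre l u ∩ S = ∅ ∧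
        ∀ v ∈ l.toFinset ∩ Y ∩ arrived ord u, v ∉ D → v ≠ u → (pre l v ∩ S).Nonempty := by
      intro u hu
      obtain ⟨huY, huD, hul, hacc⟩ := hmem u hu
      rcases hacc with ⟨h1, _⟩ | ⟨h1, _⟩ | ⟨h1, h2, h3⟩
      · omega
      · omega
      · exact ⟨h2, h3⟩
    have hno : ∀ u ∈ sel f I S Y D ord j, ∀ v ∈ sel f I S Y D ord j, ¬ ord v < ord u := by
      intro u hu v hv hlt
      obtain ⟨hvY, hvD, hvl, -⟩ := hmem v hv
      have := (hacc u hu).2 v (by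
        simp only [Finset.mem_inter, arrived, Finset.mem_filter, Finset.mem_univ, true_and]
        exact ⟨⟨by simpa using hvl, hvY⟩, hlt.le⟩) hvD (fun h => by subst h; omega)
      rw [(hacc v hv).1] at this
      simp at this
    rcases (sel f I S Y D ord j).eq_empty_or_nonempty with h | ⟨u, hu⟩
    · rw [h]; simp
    · have hsub : sel f I S Y D ord j ⊆ {u} := fun v hv => by
        rw [Finset.mem_singleton]
        exact hord (le_antisymm (not_lt.1 (hno v hv u hu)) (not_lt.1 (hno u hu v hv)))
      obtain ⟨-, -, hul, -⟩ := hmem u hu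
      have h1 := (Finset.mem_filter.1 (proc_feas (f := f) (I := I) S Finset.univ ∅ u hul)).2.1
      rw [hI] at h1
      refine h1.subset ?_
      intro v hv
      have : v ∈ ({u} : Finset α) := hsub (by exact_mod_cast hv)
      rw [Finset.mem_singleton] at this
      simp [this]

end Accept

/-! ### Acceptance probability of an unblocked element. -/

section Success

variable {α : Type*} [LinearOrder α] [Fintype α]

theorem sum_range_two_mul (g : ℕ → ℝ) (k : ℕ) :
    ∑ j ∈ Finset.range (2 * k), g j = ∑ t ∈ Finset.range k, (g (2 * t) + g (2 * t + 1)) := by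
  induction k with
  | zero => simp
  | succ k ih =>
    rw [show 2 * (k + 1) = 2 * k + 1 + 1 by ring, Finset.sum_range_succ, Finset.sum_range_succ, ih,
      Finset.sum_range_succ]
    ring

theorem ediv_two_pow_succ (x : ℤ) (t : ℕ) : x / 2 ^ (t + 1) = x / 2 ^ t / 2 := by
  rw [pow_succ, ← Int.ediv_ediv_of_nonneg (by positivity)]

/-- An element of `Y` that is not blocked by the elements of its own and higher classes is
accepted with constant total probability over all types, for a random split of `Y`. -/
theorem sum_accept_ge {f : Finset α → ℝ} {I : Finset α → Prop} {S Y : Finset α} {l : List α}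
    {T : ℕ} {u : α} (hu : u ∈ l)
    (hspan : ¬ Spans I ((l.toFinset ∩ Y).filter fun y => y ≠ u ∧ cls f l S u ≤ cls f l S y) u)
    (htop : pre l u ∩ S = ∅ → ∀ v ∈ l.toFinset ∩ Y, v ≠ u → (pre l v ∩ S).Nonempty)
    (hlow : ∀ v ∈ l.toFinset ∩ S, cls f l S v ≤ cls f l S u + 2 ^ T)
    (hhigh : (pre l u ∩ S).Nonempty → ∃ v ∈ l.toFinset ∩ S, cls f l S u ≤ cls f l S v) :
    (Fintype.card (Finset α) : ℝ) ≤ 4 * ∑ j ∈ Finset.range (2 * (T + 2)), ∑ D : Finset α,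
      if u ∉ D ∧ Accept f I S Y D T j l Finset.univ u then 1 else 0 := by
  set c := cls f l S with hc
  set g : ℕ → ℝ := fun j => ∑ D : Finset α,
      if u ∉ D ∧ Accept f I S Y D T j l Finset.univ u then (1 : ℝ) else 0 with hg
  have hg0 : ∀ j, 0 ≤ g j := fun j => Finset.sum_nonneg fun D _ => by split_ifs <;> norm_num
  -- The tests ignore whether `u ∈ D`, so requiring `u ∉ D` costs exactly a factor 2; together with
  -- the 2 of `sum_scales_ge` this gives 4.
  have hgle : ∀ (j : ℕ) (φ : Finset α → ℝ), (∀ D, φ (symmDiff D {u}) = φ D) →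
      (∀ D, u ∉ D → φ D ≤ if Accept f I S Y D T j l Finset.univ u then 1 else 0) →
      ∑ D : Finset α, φ D ≤ 2 * g j := by
    intro j φ h1 h2
    rw [← two_mul_sum_notMem u φ h1]
    refine mul_le_mul_of_nonneg_left (Finset.sum_le_sum fun D _ => ?_) (by norm_num)
    by_cases huD : u ∈ D
    · simp [huD]
    · simpa [huD] using h2 D huD
  rw [sum_range_two_mul g (T + 2)]
  rcases (pre l u ∩ S).eq_empty_or_nonempty with hpre | hpre
  · have h1 := hgle (2 * (T + 1)) (fun _ => 1) (fun _ => rfl) (fun D huD => by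
      rw [if_pos]
      refine ⟨hu, Or.inr (Or.inr ⟨by omega, hpre, fun v hv _ hvu => htop hpre v ?_ hvu⟩)⟩
      simpa using hv)
    simp only [Finset.sum_const, Finset.card_univ, nsmul_eq_mul, mul_one] at h1
    have h2 := Finset.single_le_sum (f := fun t => g (2 * t) + g (2 * t + 1))
      (fun t _ => add_nonneg (hg0 _) (hg0 _)) (Finset.mem_range.2 (show T + 1 < T + 2 by omega))
    have h3 := hg0 (2 * (T + 1) + 1)
    have h4 := hg0 (2 * (T + 1))
    linarith
  -- The rivals at scale `t` are `W t ∩ symmDiff D (F t)`: `D` above the block of `u` and the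
  -- complement of `D` inside it. The certificates are `W (t + 1) ∩ D`. Thus acceptance at scale
  -- `t`, for the right parity, follows from `h (t + 1) D = 1` and `h t (symmDiff D (F t)) = 0`,
  -- while `hspan` makes `h 0` vanish.
  · set W : ℕ → Finset α := fun t =>
      (l.toFinset ∩ Y).filter fun y => y ≠ u ∧ c u / 2 ^ t ≤ c y / 2 ^ t with hW
    set h : ℕ → Finset α → ℝ := fun t A => if Spans I (W t ∩ A) u then 1 else 0 with hh
    set F : ℕ → Finset α := fun t => Finset.univ.filter fun y => c y / 2 ^ t ≤ c u / 2 ^ t with hF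
    have hWtog : ∀ t A, W t ∩ symmDiff A {u} = W t ∩ A := by
      intro t A
      ext y
      simp only [hW, Finset.mem_inter, Finset.mem_filter, Finset.mem_symmDiff,
        Finset.mem_singleton]
      tauto
    have hWmono : ∀ t, W t ⊆ W (t + 1) := by
      intro t y hy
      simp only [hW, Finset.mem_filter, ediv_two_pow_succ] at hy ⊢
      exact ⟨hy.1, hy.2.1, Int.ediv_le_ediv (by norm_num) hy.2.2⟩
    have key := sum_scales_ge h F T (fun t A => by simp only [hh]; split_ifs <;> simp)
      (fun t A B hAB => by
        simp only [hh]
        by_cases hs : Spans I (W t ∩ A) u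
        · rw [if_pos hs, if_pos (hs.mono (Finset.inter_subset_inter_left hAB))]
        · rw [if_neg hs]; split_ifs <;> norm_num)
      (fun t A => by
        simp only [hh]
        by_cases hs : Spans I (W t ∩ A) u
        · rw [if_pos hs, if_pos (hs.mono (Finset.inter_subset_inter_right (hWmono t)))]
        · rw [if_neg hs]; split_ifs <;> norm_num)
      (fun t y hy => by
        simp only [hF, Finset.mem_filter, Finset.mem_univ, true_and, ediv_two_pow_succ] at hy ⊢
        exact Int.ediv_le_ediv (by norm_num) hy)
      (fun A => by
        have hn : ¬ Spans I (W 0 ∩ A) u := fun hs => hspan (hs.mono fun y hy => by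
          simpa [hW] using (Finset.mem_inter.1 hy).1)
        simp only [hh, if_neg hn])
    have h01 : ∀ t A, h t A = 0 ∨ h t A = 1 := fun t A => by
      simp only [hh]; split_ifs <;> simp
    have hrival : ∀ t D, h t (symmDiff D (F t)) = 0 →
        ¬ Spans I (rivals c (l.toFinset ∩ Y ∩ Finset.univ) D t u) u := by
      intro t D h0 hs
      simp only [hh] at h0
      rw [if_pos] at h0
      · norm_num at h0
      refine hs.mono fun y hy => ?_
      simp only [rivals, hW, hF, Finset.mem_inter, Finset.mem_filter, Finset.mem_univ, and_true,
        Finset.mem_symmDiff, true_and] at hy ⊢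
      rcases hy with ⟨h1, h2, ⟨h3, h4⟩ | ⟨h3, h4⟩⟩
      · exact ⟨⟨h1, h2, h4.le⟩, Or.inl ⟨h3, not_le.2 h4⟩⟩
      · exact ⟨⟨h1, h2, h4.ge⟩, Or.inr ⟨h4.le, h3⟩⟩
    have htog : ∀ t D, h t (symmDiff (symmDiff D {u}) (F t)) = h t (symmDiff D (F t)) := by
      intro t D
      rw [symmDiff_right_comm]
      simp only [hh, hWtog]
    have h1 : ∀ t ∈ Finset.range T,
        ∑ A : Finset α, h (t + 1) A * (1 - h t (symmDiff A (F t))) ≤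
          2 * (g (2 * t) + g (2 * t + 1)) := by
      intro t ht
      rw [Finset.mem_range] at ht
      obtain ⟨k, hk, hk2⟩ : ∃ k : ℕ, (k : ℤ) = c u / 2 ^ t % 2 ∧ k < 2 :=
        ⟨(c u / 2 ^ t % 2).toNat, by omega, by omega⟩
      set j := 2 * t + k with hj
      have hj2 : j / 2 = t := by omega
      have hjm : j % 2 = k := by omega
      have hle := hgle j (fun A => h (t + 1) A * (1 - h t (symmDiff A (F t)))) (fun D => by
        simp only [htog]; simp only [hh, hWtog]) (fun D huD => by
          by_cases hs : h (t + 1) D = 1 ∧ h t (symmDiff D (F t)) = 0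
          · rw [hs.1, hs.2, if_pos]
            · norm_num
            refine ⟨hu, Or.inl ⟨by omega, ?_, ?_, ?_⟩⟩
            · rw [hj2, hjm]; exact hk.symm
            · rw [hj2]
              have hs1 : Spans I (W (t + 1) ∩ D) u := by
                by_contra hn
                have := hs.1
                simp only [hh] at this
                rw [if_neg hn] at this
                norm_num at this
              refine hs1.mono fun y hy => ?_
              simp only [certs, hW, Finset.mem_inter, Finset.mem_filter, Finset.mem_univ,
                and_true] at hy ⊢
              exact ⟨hy.1.1, hy.2, hy.1.2.2⟩
            · rw [hj2]; exact hrival t D hs.2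
          · have : h (t + 1) D * (1 - h t (symmDiff D (F t))) = 0 := by
              rcases h01 (t + 1) D with a | a
              · rw [a, zero_mul]
              · rcases h01 t (symmDiff D (F t)) with b | b
                · exact absurd ⟨a, b⟩ hs
                · rw [b, sub_self, mul_zero]
            rw [this]
            split_ifs <;> norm_num)
      have hjj : g j ≤ g (2 * t) + g (2 * t + 1) := by
        have a1 := hg0 (2 * t)
        have a2 := hg0 (2 * t + 1)
        obtain rfl | rfl : k = 0 ∨ k = 1 := by omega
        · rw [hj, add_zero]; linarith
        · rw [hj]; linarith
      linarith
    have h2 : ∑ A : Finset α, (1 - h T (symmDiff A (F T))) ≤ 2 * (g (2 * T) + g (2 * T + 1)) := by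
      obtain ⟨m, hm, hmax⟩ := Finset.exists_max_image (l.toFinset ∩ S) c
        (hpre.mono (Finset.inter_subset_inter_right (pre_subset l u)))
      obtain ⟨v, hv, huv⟩ := hhigh hpre
      have hum : c u ≤ c m := huv.trans (hmax v hv)
      have hmu := hlow m hm
      -- The largest sampled class lies between `c u` and `c u + 2 ^ T`, so `u` is in the block of
      -- that class or in the next lower one; the bit `k` says which.
      obtain ⟨k, hk, hk2⟩ : ∃ k : ℕ, (k : ℤ) = c m / 2 ^ T - c u / 2 ^ T ∧ k < 2 := by
        have a1 : c u / 2 ^ T ≤ c m / 2 ^ T := Int.ediv_le_ediv (by positivity) hum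
        have a2 : c m / 2 ^ T ≤ (c u + 2 ^ T) / 2 ^ T := Int.ediv_le_ediv (by positivity) hmu
        rw [Int.add_ediv_of_dvd_right (dvd_refl _), Int.ediv_self (by positivity)] at a2
        exact ⟨(c m / 2 ^ T - c u / 2 ^ T).toNat, by omega, by omega⟩
      set j := 2 * T + k with hj
      have hj2 : j / 2 = T := by omega
      have hjm : j % 2 = k := by omega
      have hle := hgle j (fun A => 1 - h T (symmDiff A (F T))) (fun D => by
        simp only [htog]) (fun D huD => by
          by_cases hs : h T (symmDiff D (F T)) = 0
          · rw [hs, if_pos]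
            · norm_num
            refine ⟨hu, Or.inr (Or.inl ⟨hj2, ⟨m, hm, hmax, ?_⟩, hrival T D hs⟩)⟩
            rw [hjm, hk]
            exact add_sub_cancel _ _
          · rw [(h01 T (symmDiff D (F T))).resolve_left hs]
            split_ifs <;> norm_num)
      have hjj : g j ≤ g (2 * T) + g (2 * T + 1) := by
        have a1 := hg0 (2 * T)
        have a2 := hg0 (2 * T + 1)
        obtain rfl | rfl : k = 0 ∨ k = 1 := by omega
        · rw [hj, add_zero]; linarith
        · rw [hj]; linarith
      linarith
    have h3 := Finset.sum_le_sum h1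
    rw [← Finset.mul_sum] at h3
    rw [Finset.sum_range_succ, Finset.sum_range_succ]
    have h4 := hg0 (2 * (T + 1))
    have h5 := hg0 (2 * (T + 1) + 1)
    linarith

end Success

/-! ### Weights of processed elements and the losses caused by a disjoint set. -/

section Weights

variable {α : Type*} [LinearOrder α] [Fintype α]
variable {f : Finset α → ℝ} {I : Finset α → Prop} {N : Matroid α} {S : Finset α}

theorem lst_nodup : (lst f I S).Nodup := proc_nodup _ _ _

theorem wt_pos {u : α} (hu : u ∈ lst f I S) : 0 < wt f (lst f I S) S u := by
  have := (Finset.mem_filter.1 (proc_feas (f := f) (I := I) S Finset.univ ∅ u hu)).2.2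
  simpa [wt, lst] using this

theorem wt_le_of_mem_pre (hf : IsSubmodular f) (hI : ∀ A : Finset α, I A ↔ N.Indep (A : Set α))
    {u v : α} (hu : u ∈ lst f I S) (hv : v ∈ pre (lst f I S) u) :
    wt f (lst f I S) S u ≤ wt f (lst f I S) S v := by
  have := proc_mono (f := f) (I := I) hf (fun A B h hB => by
    rw [hI] at hB ⊢; exact hB.subset (by exact_mod_cast h)) S Finset.univ ∅ u hu v hv
  simpa [wt, lst] using this

theorem mem_lst_of_mem_pre {u v : α} (hv : v ∈ pre (lst f I S) u) : v ∈ lst f I S := by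
  simpa using pre_subset _ _ hv

theorem cls_le_of_mem_pre (hf : IsSubmodular f)
    (hI : ∀ A : Finset α, I A ↔ N.Indep (A : Set α))
    {u v : α} (hu : u ∈ lst f I S) (hv : v ∈ pre (lst f I S) u) :
    cls f (lst f I S) S u ≤ cls f (lst f I S) S v :=
  Int.log_mono_right (wt_pos hu) (wt_le_of_mem_pre hf hI hu hv)

theorem kept_indep (hI : ∀ A : Finset α, I A ↔ N.Indep (A : Set α)) :
    I ((lst f I S).toFinset ∩ S) := by
  have : ∀ U M, I M → I (M ∪ (proc f I S U M).toFinset ∩ S) := by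
    intro U M
    refine proc_induction (f := f) (I := I)
      (P := fun U M => I M → I (M ∪ (proc f I S U M).toFinset ∩ S))
      (fun U M h hM => by simpa [proc_nil h] using hM) S (fun U M e he ih hM => ?_) U M
    rw [proc_cons he, List.toFinset_cons, ← step_union_inter]
    refine ih ?_
    unfold step
    split_ifs
    · exact (Finset.mem_filter.1 he.1).2.1
    · exact hM
  simpa [lst] using this Finset.univ ∅ (by rw [hI]; simp)

theorem sum_wt_kept :
    ∑ m ∈ (lst f I S).toFinset ∩ S, wt f (lst f I S) S m =
      f ((lst f I S).toFinset ∩ S) - f ∅ :=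
  sum_marg_pre_empty f S lst_nodup

/-- Elements that keep half of their weight in the presence of `X` have additive value. -/
theorem sum_wt_le_value (hf : IsSubmodular f) (h0 : ∀ A, 0 ≤ f A) {l : List α} (hl : l.Nodup)
    {X B : Finset α} (hB : B ⊆ l.toFinset ∩ X)
    (hgood : ∀ u ∈ B, wt f l S u / 2 ≤ marg f u (pre l u ∩ (S ∪ X))) :
    ∑ u ∈ B, wt f l S u / 2 ≤ f B := by
  have h1 := sum_marg_pre_empty f B hl
  rw [Finset.inter_eq_right.2 (hB.trans Finset.inter_subset_left)] at h1
  have h2 : ∑ u ∈ B, wt f l S u / 2 ≤ ∑ u ∈ B, marg f u (pre l u ∩ B) := by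
    refine Finset.sum_le_sum fun u hu => (hgood u hu).trans (marg_anti hf ?_ ?_)
    · exact Finset.inter_subset_inter_left ((hB.trans Finset.inter_subset_right).trans
        Finset.subset_union_right)
    · exact fun h => notMem_pre_self l u (Finset.mem_inter.1 h).1
  have := h0 ∅
  linarith

/-- The total loss of the kept elements caused by `X`. -/
theorem sum_loss_kept_le (hf : IsSubmodular f) {X : Finset α} (hX : Disjoint S X) :
    ∑ m ∈ (lst f I S).toFinset ∩ S,
      (wt f (lst f I S) S m - marg f m (pre (lst f I S) m ∩ (S ∪ X))) ≤
    f ((lst f I S).toFinset ∩ S) - f ((lst f I S).toFinset ∩ S ∪ (lst f I S).toFinset ∩ X) +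
      ∑ x ∈ (lst f I S).toFinset ∩ X, wt f (lst f I S) S x := by
  set l := lst f I S with hl
  -- Marginal values along `S ∪ X` telescope to the value of the union. Bounding those of `X` by
  -- their weights isolates the contribution of the kept elements.
  have h1 := sum_marg_pre_empty f (S ∪ X) (lst_nodup (f := f) (I := I) (S := S))
  rw [← hl, Finset.inter_union_distrib_left, Finset.sum_union] at h1
  · have h2 : ∑ x ∈ l.toFinset ∩ X, marg f x (pre l x ∩ (S ∪ X)) ≤
        ∑ x ∈ l.toFinset ∩ X, wt f l S x := by
      refine Finset.sum_le_sum fun x _ => marg_anti hf ?_ ?_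
      · exact Finset.inter_subset_inter_left Finset.subset_union_left
      · exact fun h => notMem_pre_self l x (Finset.mem_inter.1 h).1
    have h3 := sum_wt_kept (f := f) (I := I) (S := S)
    rw [← hl] at h3
    rw [Finset.sum_sub_distrib]
    linarith
  · exact hX.mono Finset.inter_subset_right Finset.inter_subset_right

/-! ### Rank -/

/-- The rank function of `N` with real values. -/
def rkr (N : Matroid α) (A : Finset α) : ℝ := ((N.eRk (A : Set α)).toNat : ℝ)

theorem marg_rkr (hE : N.E = Set.univ) (u : α) (A : Finset α) :
    marg (rkr N) u A = if u ∈ N.closure (A : Set α) then 0 else 1 := by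
  have hfin : N.eRk (A : Set α) ≠ ⊤ := ne_top_of_le_ne_top (by simp)
    (N.eRk_le_encard (A : Set α))
  unfold marg rkr
  rw [Finset.coe_insert]
  split_ifs with h
  · rw [← N.eRk_insert_closure_eq, Set.insert_eq_of_mem h, N.eRk_closure_eq, sub_self]
  · rw [Matroid.eRk_insert_eq_add_one ⟨by rw [hE]; trivial, h⟩, ENat.toNat_add hfin (by simp)]
    simp

theorem rkr_submodular (hE : N.E = Set.univ) : IsSubmodular (rkr N) := by
  intro A B e hAB _
  have h1 := marg_rkr hE e A
  have h2 := marg_rkr hE e B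
  unfold marg at h1 h2
  rw [h1, h2]
  by_cases h : e ∈ N.closure (A : Set α)
  · rw [if_pos h, if_pos (N.closure_subset_closure (by exact_mod_cast hAB) h)]
  · rw [if_neg h]; split_ifs <;> norm_num

theorem rkr_mono {A B : Finset α} (h : A ⊆ B) : rkr N A ≤ rkr N B := by
  have hfin : N.eRk (B : Set α) ≠ ⊤ := ne_top_of_le_ne_top (by simp)
    (N.eRk_le_encard (B : Set α))
  unfold rkr
  exact_mod_cast ENat.toNat_le_toNat (N.eRk_mono (by exact_mod_cast h)) hfin

theorem rkr_of_indep {A : Finset α} (h : N.Indep (A : Set α)) : rkr N A = A.card := by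
  unfold rkr; rw [h.eRk_eq_encard]; simp

theorem rkr_empty : rkr N ∅ = 0 := by simp [rkr]

/-- The weight of the kept elements spanned by earlier elements is at most the weight of `X`. -/
theorem sum_spanned_kept_le (hf : IsSubmodular f) (hE : N.E = Set.univ)
    (hI : ∀ A : Finset α, I A ↔ N.Indep (A : Set α)) {X : Finset α} (hX : Disjoint S X) :
    ∑ m ∈ (lst f I S).toFinset ∩ S,
      (if m ∈ N.closure (pre (lst f I S) m ∩ (S ∪ X) : Finset α) then
        wt f (lst f I S) S m else 0) ≤
    ∑ x ∈ (lst f I S).toFinset ∩ X, wt f (lst f I S) S x := by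
  set l := lst f I S with hl
  have hnd : l.Nodup := lst_nodup
  set z : α → ℝ := fun v => if v ∈ N.closure (pre l v ∩ (S ∪ X) : Finset α) then 1 else 0 with hz
  -- In each prefix the rank of the `S ∪ X` part equals the number of its elements not spanned by
  -- predecessors, and it is at least the number of kept elements, which are independent. Hence at
  -- most as many kept elements are spanned as there are elements of `X`. Since weights do not
  -- increase along the list, Abel summation turns these counts into weights.
  have habel := abel_nonneg (fun v => wt f l S v)
    (fun v => (if v ∈ X then 1 else 0) - (if v ∈ S then z v else 0)) l hnd
    (fun u hu => (wt_pos hu).le) (fun u hu v hv => wt_le_of_mem_pre hf hI hu hv) ?_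
  · simp only [mul_sub, mul_ite, mul_one, mul_zero, Finset.sum_sub_distrib] at habel
    rw [← Finset.sum_filter, ← Finset.sum_filter, Finset.filter_mem_eq_inter,
      Finset.filter_mem_eq_inter] at habel
    simpa [hz] using habel
  · intro u hu
    set P := insert u (pre l u) with hP
    have hPl : P ⊆ l.toFinset := Finset.insert_subset (by simpa using hu) (pre_subset l u)
    have hpreP : ∀ v ∈ P, pre l v ⊆ P := by
      intro v hv
      rcases Finset.mem_insert.1 hv with rfl | hv
      · exact Finset.subset_insert _ _
      · exact (pre_subset_pre hv).trans (Finset.subset_insert _ _)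
    have htel := sum_marg_pre_empty (rkr N) (P ∩ (S ∪ X)) hnd
    rw [Finset.inter_eq_right.2 (Finset.inter_subset_left.trans hPl), rkr_empty, sub_zero] at htel
    have h1 : ∑ v ∈ P ∩ (S ∪ X), marg (rkr N) v (pre l v ∩ (P ∩ (S ∪ X))) =
        ∑ v ∈ P ∩ (S ∪ X), (1 - z v) := by
      refine Finset.sum_congr rfl fun v hv => ?_
      rw [← Finset.inter_assoc, Finset.inter_eq_left.2 (hpreP v (Finset.mem_inter.1 hv).1),
        marg_rkr hE]
      simp only [hz]
      split_ifs <;> norm_num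
    rw [h1, Finset.inter_union_distrib_left, Finset.sum_union
      (hX.mono Finset.inter_subset_right Finset.inter_subset_right)] at htel
    have hPS : N.Indep ((P ∩ S : Finset α) : Set α) := by
      have := (hI _).1 (kept_indep (f := f) (S := S) hI)
      refine this.subset ?_
      exact_mod_cast Finset.inter_subset_inter_right hPl
    have h2 : ((P ∩ S).card : ℝ) ≤ rkr N (P ∩ S ∪ P ∩ X) := by
      rw [← rkr_of_indep hPS]; exact rkr_mono Finset.subset_union_left
    have h3 : ∑ v ∈ P ∩ X, (1 - z v) ≤ ∑ v ∈ P ∩ X, (1 : ℝ) := by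
      refine Finset.sum_le_sum fun v _ => ?_
      simp only [hz]; split_ifs <;> norm_num
    rw [Finset.sum_sub_distrib, Finset.sum_const, nsmul_eq_mul, mul_one] at htel
    rw [Finset.sum_sub_distrib, ← Finset.sum_filter, ← Finset.sum_filter,
      Finset.filter_mem_eq_inter, Finset.filter_mem_eq_inter]
    linarith

/-- The elements of `X \ C` that are spanned by the elements of `X ∩ C` of their own and higher
classes weigh at most as much as the elements of `X` that are spanned by earlier elements
of `X`. -/
theorem sum_spanned_le (hf : IsSubmodular f) (hE : N.E = Set.univ)
    (hI : ∀ A : Finset α, I A ↔ N.Indep (A : Set α)) (X C : Finset α) :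
    ∑ u ∈ ((lst f I S).toFinset ∩ X) \ C,
      (if u ∈ N.closure (((lst f I S).toFinset ∩ X ∩ C).filter fun y =>
        cls f (lst f I S) S u ≤ cls f (lst f I S) S y : Finset α) then
        (2 : ℝ) ^ cls f (lst f I S) S u else 0) ≤
    ∑ x ∈ (lst f I S).toFinset ∩ X,
      (if x ∈ N.closure (pre (lst f I S) x ∩ X : Finset α) then
        (2 : ℝ) ^ cls f (lst f I S) S x else 0) := by
  set l := lst f I S with hl
  have hnd : l.Nodup := lst_nodup
  set c := cls f l S with hc
  set Q := l.toFinset ∩ X with hQ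
  -- Within a class the rounded weight is constant, so it suffices to compare numbers of elements
  -- class by class.
  have hfib : ∀ (A : Finset α) (_ : A ⊆ Q) (p : α → Prop),
      ∑ u ∈ A, (if p u then (2 : ℝ) ^ c u else 0) =
        ∑ j ∈ Q.image c, (2 : ℝ) ^ j * ∑ u ∈ A.filter (c · = j), if p u then 1 else 0 := by
    intro A hA p
    rw [← Finset.sum_fiberwise_of_maps_to (t := Q.image c) (g := c)
      (fun u hu => Finset.mem_image_of_mem _ (hA hu))]
    refine Finset.sum_congr rfl fun j _ => ?_
    rw [Finset.mul_sum]
    refine Finset.sum_congr rfl fun u hu => ?_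
    rw [(Finset.mem_filter.1 hu).2]
    simp
  rw [hfib _ Finset.sdiff_subset, hfib _ subset_rfl]
  refine Finset.sum_le_sum fun j _ => mul_le_mul_of_nonneg_left ?_ (by positivity)
  -- telescoping over the classes at least `j` and over the classes above `j`
  have htel : ∀ p : ℤ → Prop, (∀ a b, a ≤ b → p a → p b) →
      ∑ x ∈ Q.filter fun x => p (c x),
        (if x ∈ N.closure (pre l x ∩ X : Finset α) then (0 : ℝ) else 1) =
        rkr N (Q.filter fun x => p (c x)) := by
    intro p hp
    have h := sum_marg_pre_empty (rkr N) (Q.filter fun x => p (c x)) hnd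
    rw [Finset.inter_eq_right.2 ((Finset.filter_subset _ _).trans Finset.inter_subset_left),
      rkr_empty, sub_zero] at h
    rw [← h]
    refine Finset.sum_congr rfl fun x hx => ?_
    obtain ⟨hxQ, hxp⟩ := Finset.mem_filter.1 hx
    have hxl : x ∈ l := by simpa using (Finset.mem_inter.1 hxQ).1
    have hset : pre l x ∩ Q.filter (fun x => p (c x)) = pre l x ∩ X := by
      ext y
      simp only [hQ, Finset.mem_inter, Finset.mem_filter]
      constructor
      · rintro ⟨h1, h2, _⟩
        exact ⟨h1, h2.2⟩
      · rintro ⟨h1, h2⟩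
        exact ⟨h1, ⟨pre_subset l x h1, h2⟩, hp _ _ (cls_le_of_mem_pre hf hI hxl h1) hxp⟩
    rw [marg_rkr hE, hset]
  have h1 : ∑ x ∈ Q.filter (fun x => j ≤ c x),
      (if x ∈ N.closure (pre l x ∩ X : Finset α) then (0 : ℝ) else 1) =
      rkr N (Q.filter fun x => j ≤ c x) := by
    convert htel (fun a => j ≤ a) (fun a b hab ha => ha.trans hab)
  have h2 : ∑ x ∈ Q.filter (fun x => j < c x),
      (if x ∈ N.closure (pre l x ∩ X : Finset α) then (0 : ℝ) else 1) =
      rkr N (Q.filter fun x => j < c x) := by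
    convert htel (fun a => j < a) (fun a b hab ha => ha.trans_le hab)
  have hsplit : Q.filter (fun x => j ≤ c x) =
      Q.filter (fun x => j < c x) ∪ Q.filter (fun x => c x = j) := by
    rw [← Finset.filter_or]
    refine Finset.filter_congr fun x _ => ?_
    omega
  have hdisj : Disjoint (Q.filter (fun x => j < c x)) (Q.filter (fun x => c x = j)) := by
    rw [Finset.disjoint_filter]; intro x _ h; omega
  rw [hsplit, Finset.sum_union hdisj, h2] at h1
  set Xhi := Q.filter (fun x => j < c x) with hXhi
  set Xj := Q.filter (fun x => c x = j) with hXj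
  have hXj' : Xj = (Q ∩ C).filter (c · = j) ∪ (Q \ C).filter (c · = j) := by
    have : Q ∩ C ∪ Q \ C = Q := by
      ext x; rw [Finset.mem_union, Finset.mem_inter, Finset.mem_sdiff]; tauto
    rw [← Finset.filter_union, this]
  have hdisj' : Disjoint ((Q ∩ C).filter (c · = j)) ((Q \ C).filter (c · = j)) :=
    Finset.disjoint_filter_filter (by
      rw [Finset.disjoint_left]; intro x hx hx'
      exact (Finset.mem_sdiff.1 hx').2 (Finset.mem_inter.1 hx).2)
  set Yj := (Q ∩ C).filter (c · = j) with hYj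
  set Zj := (Q \ C).filter (c · = j) with hZj
  -- Adding class `j` to the higher classes raises the rank by the number of its elements not
  -- spanned by predecessors. The same increase is at most `Yj.card` plus the number of elements of
  -- `Zj` outside the span of the elements of `C`; comparing the two proves the count.
  have b1 := union_le_add_sum (rkr_submodular hE) Xhi Yj
  have b2 := union_le_add_sum (rkr_submodular hE) (Xhi ∪ Yj) Zj
  have b3 : ∑ e ∈ Yj \ Xhi, marg (rkr N) e Xhi ≤ Yj.card := by
    refine (Finset.sum_le_card_nsmul _ _ 1 fun e _ => ?_).trans ?_
    · rw [marg_rkr hE]; split_ifs <;> norm_num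
    · rw [nsmul_eq_mul, mul_one]; exact_mod_cast Finset.card_le_card Finset.sdiff_subset
  have b4 : ∑ e ∈ Zj \ (Xhi ∪ Yj), marg (rkr N) e (Xhi ∪ Yj) ≤ ∑ u ∈ Zj,
      (1 - if u ∈ N.closure ((Q ∩ C).filter fun y => c u ≤ c y : Finset α) then 1 else 0) := by
    refine (Finset.sum_le_sum fun e he => ?_).trans
      (Finset.sum_le_sum_of_subset_of_nonneg Finset.sdiff_subset fun e _ _ => ?_)
    · have hej : c e = j := by
        simp only [hZj, Finset.mem_sdiff, Finset.mem_filter] at he; exact he.1.2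
      rw [marg_rkr hE]
      by_cases hcl : e ∈ N.closure ((Q ∩ C).filter fun y => c e ≤ c y : Finset α)
      · rw [if_pos hcl, if_pos]
        · norm_num
        · refine N.closure_subset_closure ?_ hcl
          have : ((Q ∩ C).filter fun y => c e ≤ c y) ⊆ Xhi ∪ Yj := by
            intro y hy
            simp only [hXhi, hYj, Finset.mem_union, Finset.mem_filter, Finset.mem_inter] at hy ⊢
            rcases lt_or_eq_of_le (hej ▸ hy.2) with h | h
            · exact Or.inl ⟨hy.1.1, h⟩
            · exact Or.inr ⟨hy.1, h.symm⟩
          exact_mod_cast this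
      · rw [if_neg hcl]; split_ifs <;> norm_num
    · split_ifs <;> norm_num
  rw [Finset.union_assoc, ← hXj'] at b2
  have b5 : ((Xj.card : ℕ) : ℝ) = Yj.card + Zj.card := by
    rw [hXj', Finset.card_union_of_disjoint hdisj']; push_cast; rfl
  rw [Finset.sum_sub_distrib, Finset.sum_const, nsmul_eq_mul, mul_one] at b4
  have b6 : ∑ x ∈ Xj, (if x ∈ N.closure (pre l x ∩ X : Finset α) then (0 : ℝ) else 1) =
      Xj.card - ∑ x ∈ Xj, if x ∈ N.closure (pre l x ∩ X : Finset α) then 1 else 0 := by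
    rw [Finset.card_eq_sum_ones]
    push_cast
    rw [← Finset.sum_sub_distrib]
    refine Finset.sum_congr rfl fun x _ => ?_
    split_ifs <;> norm_num
  rw [b6] at h1
  linarith

end Weights

/-! ### Exchanging sampled and extra elements. -/

section Exchange

variable {α : Type*} [LinearOrder α] [Fintype α] {m : ℕ} [NeZero m]

/-- The elements outside the sample whose label is `0`. -/
def extra (S : Finset α) (b : α → Fin m) : Finset α :=
  Finset.univ.filter fun v => v ∉ S ∧ b v = 0

theorem mem_extra {S : Finset α} {b : α → Fin m} {v : α} : v ∈ extra S b ↔ v ∉ S ∧ b v = 0 := by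
  simp [extra]

theorem disjoint_extra (S : Finset α) (b : α → Fin m) : Disjoint S (extra S b) := by
  rw [Finset.disjoint_left]; intro v hv h; exact (mem_extra.1 h).1 hv

/-- Interchanging the labels `0` and `k` at `u` is a bijection of the labellings that `φ` does not
see, so all values of `b u` contribute equally. -/
theorem sum_label (u : α) (φ : (α → Fin m) → ℝ)
    (hφ : ∀ b k, φ (Function.update b u k) = φ b) :
    (m : ℝ) * ∑ b : α → Fin m, (if b u = 0 then φ b else 0) = ∑ b : α → Fin m, φ b := by
  have h1 : ∀ k : Fin m, ∑ b : α → Fin m, (if b u = k then φ b else 0) =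
      ∑ b : α → Fin m, (if b u = 0 then φ b else 0) := by
    intro k
    have hinv : Function.Involutive
        (fun b : α → Fin m => Function.update b u (Equiv.swap 0 k (b u))) := by
      intro b
      ext v
      by_cases hv : v = u
      · subst hv; simp
      · simp [hv]
    refine Fintype.sum_bijective _ hinv.bijective _ _ fun b => ?_
    simp only [Function.update_self, hφ]
    have : Equiv.swap 0 k (b u) = 0 ↔ b u = k := by
      rw [Equiv.swap_apply_eq_iff, Equiv.swap_apply_left]
    simp only [this]
  have h2 : ∑ k : Fin m, ∑ b : α → Fin m, (if b u = k then φ b else 0) =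
      ∑ b : α → Fin m, φ b := by
    rw [Finset.sum_comm]
    simp
  rw [← h2, Finset.sum_congr rfl fun k _ => h1 k]
  simp

/-- Toggling `u` in `S` is a bijection that preserves `φ S u` and interchanges the two membership
conditions. -/
theorem sum_notMem_eq_sum_mem (φ : Finset α → α → ℝ)
    (hφ : ∀ S u, φ (symmDiff S {u}) u = φ S u) :
    ∑ S : Finset α, ∑ u ∈ Finset.univ.filter (· ∉ S), φ S u =
      ∑ S : Finset α, ∑ u ∈ S, φ S u := by
  have h1 : ∀ S : Finset α, ∑ u ∈ S, φ S u = ∑ u, if u ∈ S then φ S u else 0 := fun S => by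
    rw [← Finset.sum_filter]; simp
  simp only [h1, Finset.sum_filter]
  rw [Finset.sum_comm]
  conv_rhs => rw [Finset.sum_comm]
  refine Finset.sum_congr rfl fun u _ => ?_
  rw [← sum_symmDiff {u} fun S => if u ∉ S then φ S u else 0]
  refine Finset.sum_congr rfl fun S _ => ?_
  rw [hφ]
  have : u ∉ symmDiff S {u} ↔ u ∈ S := by simp [Finset.mem_symmDiff]
  simp only [this]

/-- Exchanging the roles of sampled elements and elements of `extra S b`. -/
theorem sum_extra_eq (φ : Finset α → (α → Fin m) → α → ℝ)
    (hS : ∀ S b u, φ (symmDiff S {u}) b u = φ S b u)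
    (hb : ∀ S b u k, φ S (Function.update b u k) u = φ S b u) :
    (m : ℝ) * ∑ S : Finset α, ∑ b : α → Fin m, ∑ u ∈ extra S b, φ S b u =
      ∑ S : Finset α, ∑ b : α → Fin m, ∑ u ∈ S, φ S b u := by
  have h1 : (m : ℝ) * ∑ S : Finset α, ∑ b : α → Fin m, ∑ u ∈ extra S b, φ S b u =
      ∑ S : Finset α, ∑ u ∈ Finset.univ.filter (· ∉ S), ∑ b : α → Fin m, φ S b u := by
    rw [Finset.mul_sum]
    refine Finset.sum_congr rfl fun S _ => ?_
    have : ∀ b : α → Fin m, ∑ u ∈ extra S b, φ S b u =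
        ∑ u ∈ Finset.univ.filter (· ∉ S), if b u = 0 then φ S b u else 0 := fun b => by
      rw [← Finset.sum_filter, Finset.filter_filter]; rfl
    simp only [this]
    rw [Finset.sum_comm, Finset.mul_sum]
    exact Finset.sum_congr rfl fun u _ => sum_label u (fun b => φ S b u) fun b k => hb S b u k
  rw [h1, sum_notMem_eq_sum_mem (fun S u => ∑ b : α → Fin m, φ S b u)
    (fun S u => Finset.sum_congr rfl fun b _ => hS S b u)]
  exact Finset.sum_congr rfl fun S _ => Finset.sum_comm

end Exchange

/-! ### Average weights of the extra elements and of the bad ones among them. -/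

section Averages

variable {α : Type*} [LinearOrder α] [Fintype α] {m : ℕ} [NeZero m]
variable {f : Finset α → ℝ} {I : Finset α → Prop} {N : Matroid α}

theorem toggle_iff (S : Finset α) (u : α) : ∀ v, v ≠ u → (v ∈ symmDiff S {u} ↔ v ∈ S) := by
  intro v hv; simp [Finset.mem_symmDiff, hv]

theorem mem_lst_toggle (S : Finset α) (u : α) :
    u ∈ lst f I (symmDiff S {u}) ↔ u ∈ lst f I S := proc_toggle_mem (toggle_iff S u) _ _

theorem pre_toggle (S : Finset α) (u : α) :
    pre (lst f I (symmDiff S {u})) u = pre (lst f I S) u := proc_toggle_pre (toggle_iff S u) _ _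

theorem inter_toggle {P S : Finset α} {u : α} (hP : u ∉ P) : P ∩ symmDiff S {u} = P ∩ S := by
  ext v
  simp only [Finset.mem_inter]
  by_cases hv : v = u
  · subst hv; simp [hP]
  · rw [toggle_iff S u v hv]

theorem inter_extra_toggle {P S : Finset α} {u : α} {b : α → Fin m} (hP : u ∉ P) :
    P ∩ extra (symmDiff S {u}) b = P ∩ extra S b := by
  ext v
  simp only [Finset.mem_inter, mem_extra]
  by_cases hv : v = u
  · subst hv; simp [hP]
  · rw [toggle_iff S u v hv]

theorem inter_extra_update {P S : Finset α} {u : α} {b : α → Fin m} {k : Fin m} (hP : u ∉ P) :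
    P ∩ extra S (Function.update b u k) = P ∩ extra S b := by
  ext v
  simp only [Finset.mem_inter, mem_extra]
  by_cases hv : v = u
  · subst hv; simp [hP]
  · simp [hv]

theorem wt_toggle (S : Finset α) (u : α) :
    wt f (lst f I (symmDiff S {u})) (symmDiff S {u}) u = wt f (lst f I S) S u := by
  rw [wt, wt, pre_toggle, inter_toggle (notMem_pre_self _ _)]

theorem wt_toggle_of_mem {S : Finset α} {u v : α} (hv : v ∈ pre (lst f I S) u) :
    wt f (lst f I (symmDiff S {u})) (symmDiff S {u}) v = wt f (lst f I S) S v := by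
  have h1 : pre (lst f I S) v = pre (lst f I (symmDiff S {u})) v :=
    proc_toggle_pre_of_mem (fun w hw => (toggle_iff S u w hw).symm) _ _ hv
  rw [wt, wt, ← h1, inter_toggle fun h => notMem_pre_self _ _ (pre_subset_pre hv h)]

theorem cls_toggle (S : Finset α) (u : α) :
    cls f (lst f I (symmDiff S {u})) (symmDiff S {u}) u = cls f (lst f I S) S u := by
  rw [cls, cls, wt_toggle]

theorem cls_toggle_of_mem {S : Finset α} {u v : α} (hv : v ∈ pre (lst f I S) u) :
    cls f (lst f I (symmDiff S {u})) (symmDiff S {u}) v = cls f (lst f I S) S v := by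
  rw [cls, cls, wt_toggle_of_mem hv]

/-- The exchange principle for processed elements. -/
theorem sum_lst_extra_eq (ψ : Finset α → (α → Fin m) → α → ℝ)
    (hS : ∀ S b u, u ∈ lst f I S → ψ (symmDiff S {u}) b u = ψ S b u)
    (hb : ∀ S b u k, u ∈ lst f I S → ψ S (Function.update b u k) u = ψ S b u) :
    (m : ℝ) * ∑ S : Finset α, ∑ b : α → Fin m, ∑ u ∈ (lst f I S).toFinset ∩ extra S b, ψ S b u =
      ∑ S : Finset α, ∑ b : α → Fin m, ∑ u ∈ (lst f I S).toFinset ∩ S, ψ S b u := by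
  have h := sum_extra_eq (m := m) (fun S b u => if u ∈ (lst f I S).toFinset then ψ S b u else 0)
    (fun S b u => by
      simp only [List.mem_toFinset, mem_lst_toggle]
      split_ifs with h
      · exact hS S b u h
      · rfl)
    (fun S b u k => by
      simp only [List.mem_toFinset]
      split_ifs with h
      · exact hb S b u k h
      · rfl)
  simp only [← Finset.sum_filter, Finset.filter_mem_eq_inter] at h
  simpa only [Finset.inter_comm] using h

/-- The total weight of the kept elements, over all samples and labels. -/
def totalWt (f : Finset α → ℝ) (I : Finset α → Prop) (m : ℕ) : ℝ :=
  ∑ S : Finset α, ∑ _b : α → Fin m, ∑ u ∈ (lst f I S).toFinset ∩ S, wt f (lst f I S) S u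

/-- The benchmark for the estimates below: `extra S b` carries a `1 / m` fraction of the kept
weight, whereas the bad parts turn out to be of order `1 / m ^ 2` or to have the small constant `1 /
16`. -/
theorem sum_wt_extra :
    (m : ℝ) * ∑ S : Finset α, ∑ b : α → Fin m, ∑ u ∈ (lst f I S).toFinset ∩ extra S b,
      wt f (lst f I S) S u = totalWt f I m :=
  sum_lst_extra_eq (fun S _ u => wt f (lst f I S) S u) (fun S _ u _ => wt_toggle S u)
    (fun _ _ _ _ _ => rfl)

/-- The `m` cyclic shifts of a labelling yield pairwise disjoint extra sets, to which
`sum_union_disjoint_ge` applies. -/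
theorem sum_value_extra_ge (hf : IsSubmodular f) (h0 : ∀ A, 0 ≤ f A) (S A P : Finset α) :
    ((m : ℝ) - 1) * ∑ _b : α → Fin m, f A ≤
      (m : ℝ) * ∑ b : α → Fin m, f (A ∪ P ∩ extra S b) := by
  have hshift : ∀ k : Fin m, ∑ b : α → Fin m, f (A ∪ P ∩ extra S (fun v => b v + k)) =
      ∑ b : α → Fin m, f (A ∪ P ∩ extra S b) := fun k =>
    Fintype.sum_bijective (fun (b : α → Fin m) v => b v + k)
      (Equiv.addRight (fun _ : α => k)).bijective _ _ (fun _ => rfl)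
  have h1 : (m : ℝ) * ∑ b : α → Fin m, f (A ∪ P ∩ extra S b) =
      ∑ b : α → Fin m, ∑ k : Fin m, f (A ∪ P ∩ extra S (fun v => b v + k)) := by
    rw [Finset.sum_comm, Finset.sum_congr rfl fun k _ => hshift k]
    simp
  rw [h1, Finset.mul_sum]
  refine Finset.sum_le_sum fun b _ => ?_
  have h2 := sum_union_disjoint_ge hf h0 Finset.univ A
    (fun k : Fin m => P ∩ extra S (fun v => b v + k)) (fun i _ j _ hij => by
      rw [Finset.disjoint_left]
      intro v hv hv'
      simp only [Finset.mem_inter, mem_extra] at hv hv'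
      exact hij (add_left_cancel (hv.2.2.trans hv'.2.2.symm)))
  simpa using h2

/-- The weight of the elements that lose more than half of their value. -/
theorem sum_lossy_le (hf : IsSubmodular f) (h0 : ∀ A, 0 ≤ f A)
    (hW : ∑ _S : Finset α, ∑ _b : α → Fin m, f ∅ ≤ totalWt f I m) :
    (m : ℝ) ^ 2 * ∑ S : Finset α, ∑ b : α → Fin m, ∑ u ∈ (lst f I S).toFinset ∩ extra S b,
      (if marg f u (pre (lst f I S) u ∩ (S ∪ extra S b)) < wt f (lst f I S) S u / 2 then
        wt f (lst f I S) S u else 0) ≤ 6 * totalWt f I m := by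
  have hm : (0 : ℝ) < m := by exact_mod_cast Nat.pos_of_ne_zero (NeZero.ne m)
  set loss : Finset α → (α → Fin m) → α → ℝ := fun S b u =>
    wt f (lst f I S) S u - marg f u (pre (lst f I S) u ∩ (S ∪ extra S b)) with hloss
  have hex := sum_lst_extra_eq (f := f) (I := I) loss
    (fun S b u _ => by
      simp only [hloss]
      rw [wt_toggle, pre_toggle, Finset.inter_union_distrib_left, Finset.inter_union_distrib_left,
        inter_toggle (notMem_pre_self _ _), inter_extra_toggle (notMem_pre_self _ _)])
    (fun S b u k _ => by
      simp only [hloss]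
      rw [Finset.inter_union_distrib_left, Finset.inter_union_distrib_left,
        inter_extra_update (notMem_pre_self _ _)])
  have h1 : ∑ S : Finset α, ∑ b : α → Fin m, ∑ u ∈ (lst f I S).toFinset ∩ S, loss S b u ≤
      ∑ S : Finset α, ∑ b : α → Fin m, (f ((lst f I S).toFinset ∩ S) -
        f ((lst f I S).toFinset ∩ S ∪ (lst f I S).toFinset ∩ extra S b) +
        ∑ x ∈ (lst f I S).toFinset ∩ extra S b, wt f (lst f I S) S x) :=
    Finset.sum_le_sum fun S _ => Finset.sum_le_sum fun b _ =>
      sum_loss_kept_le hf (disjoint_extra S b)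
  have h2 : (m : ℝ) * ∑ S : Finset α, ∑ b : α → Fin m, (f ((lst f I S).toFinset ∩ S) -
        f ((lst f I S).toFinset ∩ S ∪ (lst f I S).toFinset ∩ extra S b)) ≤
      ∑ S : Finset α, ∑ _b : α → Fin m, f ((lst f I S).toFinset ∩ S) := by
    rw [Finset.mul_sum]
    refine Finset.sum_le_sum fun S _ => ?_
    have := sum_value_extra_ge (m := m) hf h0 S ((lst f I S).toFinset ∩ S) (lst f I S).toFinset
    rw [Finset.sum_sub_distrib]
    linarith
  have h3 : ∑ S : Finset α, ∑ _b : α → Fin m, f ((lst f I S).toFinset ∩ S) =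
      totalWt f I m + ∑ _S : Finset α, ∑ _b : α → Fin m, f ∅ := by
    rw [totalWt, ← Finset.sum_add_distrib]
    refine Finset.sum_congr rfl fun S _ => ?_
    rw [← Finset.sum_add_distrib]
    refine Finset.sum_congr rfl fun b _ => ?_
    rw [sum_wt_kept]; ring
  have h4 := sum_wt_extra (f := f) (I := I) (m := m)
  have h5 : ∑ S : Finset α, ∑ b : α → Fin m, ∑ u ∈ (lst f I S).toFinset ∩ extra S b,
      (if marg f u (pre (lst f I S) u ∩ (S ∪ extra S b)) < wt f (lst f I S) S u / 2 then
        wt f (lst f I S) S u else 0) ≤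
      ∑ S : Finset α, ∑ b : α → Fin m, ∑ u ∈ (lst f I S).toFinset ∩ extra S b,
        2 * loss S b u := by
    refine Finset.sum_le_sum fun S _ => Finset.sum_le_sum fun b _ => Finset.sum_le_sum fun u _ => ?_
    simp only [hloss]
    split_ifs with h
    · linarith
    · have : marg f u (pre (lst f I S) u ∩ (S ∪ extra S b)) ≤ wt f (lst f I S) S u :=
        marg_anti hf (Finset.inter_subset_inter_left Finset.subset_union_left)
          (fun h => notMem_pre_self _ u (Finset.mem_inter.1 h).1)
      linarith
  simp only [← Finset.mul_sum] at h5
  simp only [Finset.sum_add_distrib] at h1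
  set X1 := ∑ S : Finset α, ∑ b : α → Fin m, ∑ u ∈ (lst f I S).toFinset ∩ extra S b, loss S b u
  -- The drop in value of the kept set costs at most a `1 / m` fraction of its value, which sums to
  -- at most twice the total weight by `hW`; the weight of the extra elements adds one more.
  -- Elements that lose over half of their weight weigh less than twice their loss, whence the final
  -- 6.
  have h6 : (m : ℝ) * (m * X1) ≤ 3 * totalWt f I m := by
    rw [hex]
    have := mul_le_mul_of_nonneg_left h1 hm.le
    rw [mul_add, h4] at this
    linarith
  have h7 := mul_le_mul_of_nonneg_left h5 (sq_nonneg (m : ℝ))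
  nlinarith

theorem zpow_cls_le {S : Finset α} {u : α} (hu : u ∈ lst f I S) :
    (2 : ℝ) ^ cls f (lst f I S) S u ≤ wt f (lst f I S) S u := by
  have := Int.zpow_log_le_self (b := 2) (by norm_num) (wt_pos hu)
  exact_mod_cast this

theorem wt_lt_zpow_cls (S : Finset α) (u : α) :
    wt f (lst f I S) S u < (2 : ℝ) ^ (cls f (lst f I S) S u + 1) := by
  have := Int.lt_zpow_succ_log_self (b := 2) (by norm_num) (wt f (lst f I S) S u)
  exact_mod_cast this

/-- The weight of the elements of `extra S b ∩ C` that are spanned by other such elements of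
their own and higher classes. -/
theorem sum_blocked_le (hf : IsSubmodular f) (hE : N.E = Set.univ)
    (hI : ∀ A : Finset α, I A ↔ N.Indep (A : Set α)) :
    (m : ℝ) ^ 2 * ∑ S : Finset α, ∑ b : α → Fin m, ∑ C : Finset α,
      ∑ u ∈ (lst f I S).toFinset ∩ extra S b ∩ C,
      (if u ∈ N.closure (((lst f I S).toFinset ∩ extra S b ∩ C).filter fun y => y ≠ u ∧
        cls f (lst f I S) S u ≤ cls f (lst f I S) S y : Finset α) then
        wt f (lst f I S) S u else 0) ≤
      Fintype.card (Finset α) * (2 * totalWt f I m) := by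
  set z : Finset α → (α → Fin m) → α → ℝ := fun S b u =>
    if u ∈ N.closure (pre (lst f I S) u ∩ (S ∪ extra S b) : Finset α) then
      wt f (lst f I S) S u else 0 with hz
  have hm : (0 : ℝ) < m := by exact_mod_cast Nat.pos_of_ne_zero (NeZero.ne m)
  have hex := sum_lst_extra_eq (f := f) (I := I) z
    (fun S b u _ => by
      simp only [hz]
      rw [wt_toggle, pre_toggle, Finset.inter_union_distrib_left, Finset.inter_union_distrib_left,
        inter_toggle (notMem_pre_self _ _), inter_extra_toggle (notMem_pre_self _ _)])
    (fun S b u k _ => by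
      simp only [hz]
      rw [Finset.inter_union_distrib_left, Finset.inter_union_distrib_left,
        inter_extra_update (notMem_pre_self _ _)])
  have h1 : ∑ S : Finset α, ∑ b : α → Fin m, ∑ u ∈ (lst f I S).toFinset ∩ S, z S b u ≤
      ∑ S : Finset α, ∑ b : α → Fin m, ∑ x ∈ (lst f I S).toFinset ∩ extra S b,
        wt f (lst f I S) S x :=
    Finset.sum_le_sum fun S _ => Finset.sum_le_sum fun b _ =>
      sum_spanned_kept_le hf hE hI (disjoint_extra S b)
  have h2 : ∀ (S : Finset α) (b : α → Fin m), ∑ C : Finset α,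
      ∑ u ∈ (lst f I S).toFinset ∩ extra S b ∩ C,
      (if u ∈ N.closure (((lst f I S).toFinset ∩ extra S b ∩ C).filter fun y => y ≠ u ∧
        cls f (lst f I S) S u ≤ cls f (lst f I S) S y : Finset α) then
        wt f (lst f I S) S u else 0) ≤ Fintype.card (Finset α) *
      (2 * ∑ u ∈ (lst f I S).toFinset ∩ extra S b, z S b u) := by
    intro S b
    set l := lst f I S with hl
    set Q := l.toFinset ∩ extra S b with hQ
    set c := cls f l S with hc
    -- Whether the other elements of `C` span `u` does not depend on `u ∈ C`, so `u ∈ C` may be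
    -- traded for `u ∉ C`, the situation counted in `sum_spanned_le`.
    have e1 : ∑ C : Finset α, ∑ u ∈ Q ∩ C,
        (if u ∈ N.closure ((Q ∩ C).filter fun y => y ≠ u ∧ c u ≤ c y : Finset α) then
          wt f l S u else 0) =
        ∑ C : Finset α, ∑ u ∈ Q \ C,
        (if u ∈ N.closure ((Q ∩ C).filter fun y => c u ≤ c y : Finset α) then
          wt f l S u else 0) := by
      have := sum_notMem_eq_sum_mem (α := α) (fun C u => if u ∈ Q then
        (if u ∈ N.closure ((Q ∩ C).filter fun y => y ≠ u ∧ c u ≤ c y : Finset α) then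
          wt f l S u else 0) else 0) (fun C u => by
            have : (Q ∩ symmDiff C {u}).filter (fun y => y ≠ u ∧ c u ≤ c y) =
                (Q ∩ C).filter (fun y => y ≠ u ∧ c u ≤ c y) := by
              ext y
              simp only [Finset.mem_filter, Finset.mem_inter, Finset.mem_symmDiff,
                Finset.mem_singleton]
              tauto
            simp only [this])
      rw [Finset.sum_congr rfl fun C _ => Finset.sum_ite_mem _ _ _,
        Finset.sum_congr rfl fun C _ => Finset.sum_ite_mem _ _ _] at this
      simp only [Finset.inter_comm Q] at this ⊢
      rw [← this]
      refine Finset.sum_congr rfl fun C _ => ?_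
      have hs : Finset.univ.filter (· ∉ C) ∩ Q = Q \ C := by
        ext y; simp [and_comm]
      rw [hs]
      refine Finset.sum_congr rfl fun u hu => ?_
      have hu' := (Finset.mem_sdiff.1 hu).2
      have : (C ∩ Q).filter (fun y => y ≠ u ∧ c u ≤ c y) =
          (C ∩ Q).filter (fun y => c u ≤ c y) := by
        refine Finset.filter_congr fun y hy => ?_
        have : y ≠ u := fun h => hu' (h ▸ (Finset.mem_inter.1 hy).1)
        simp [this]
      rw [this]
    rw [e1, ← nsmul_eq_mul, ← Finset.card_univ, ← Finset.sum_const]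
    refine Finset.sum_le_sum fun C _ => ?_
    have e2 := sum_spanned_le (S := S) hf hE hI (extra S b) C
    rw [← hl, ← hQ, ← hc] at e2
    have e3 : ∑ u ∈ Q \ C, (if u ∈ N.closure ((Q ∩ C).filter fun y => c u ≤ c y : Finset α) then
          wt f l S u else 0) ≤ ∑ u ∈ Q \ C, 2 *
        (if u ∈ N.closure ((Q ∩ C).filter fun y => c u ≤ c y : Finset α) then
          (2 : ℝ) ^ c u else 0) := by
      refine Finset.sum_le_sum fun u hu => ?_
      have := (wt_lt_zpow_cls (f := f) (I := I) S u).le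
      rw [← hl, ← hc, zpow_add_one₀ (by norm_num)] at this
      split_ifs
      · linarith
      · norm_num
    rw [← Finset.mul_sum] at e3
    refine e3.trans (mul_le_mul_of_nonneg_left (e2.trans ?_) (by norm_num))
    refine Finset.sum_le_sum fun u hu => ?_
    have hul : u ∈ l := by simpa using (Finset.mem_inter.1 hu).1
    simp only [hz]
    split_ifs with a1 a2 a2
    · exact zpow_cls_le hul
    · exact absurd (N.closure_subset_closure (by
        exact_mod_cast Finset.inter_subset_inter_left Finset.subset_union_right) a1) a2
    · exact (wt_pos hul).le
    · exact le_rfl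
  have h3 := Finset.sum_le_sum fun S (_ : S ∈ Finset.univ) => Finset.sum_le_sum
    fun b (_ : b ∈ Finset.univ) => h2 S b
  simp only [← Finset.mul_sum] at h3
  have h4 := sum_wt_extra (f := f) (I := I) (m := m)
  set X1 := ∑ S : Finset α, ∑ b : α → Fin m, ∑ u ∈ (lst f I S).toFinset ∩ extra S b, z S b u
  have h6 : (m : ℝ) ^ 2 * X1 ≤ totalWt f I m := by
    have := mul_le_mul_of_nonneg_left (hex.le.trans h1) hm.le
    rw [h4] at this
    nlinarith
  have h7 := mul_le_mul_of_nonneg_left h3 (sq_nonneg (m : ℝ))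
  have hn : (0 : ℝ) ≤ Fintype.card (Finset α) := by positivity
  have h8 := mul_le_mul_of_nonneg_left h6 hn
  linarith

/-- The weight of the elements of very low classes. -/
theorem sum_low_le (hI : ∀ A : Finset α, I A ↔ N.Indep (A : Set α)) :
    16 * (m : ℝ) * ∑ S : Finset α, ∑ b : α → Fin m, ∑ u ∈ (lst f I S).toFinset ∩ extra S b,
      (if ∃ v ∈ pre (lst f I S) u ∩ S, cls f (lst f I S) S u + 2 ^ lev I (S \ {u}) <
          cls f (lst f I S) S v then wt f (lst f I S) S u else 0) ≤ totalWt f I m := by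
  -- The level of `S \ {u}`, rather than that of `S`, makes the condition invariant under toggling
  -- `u`. The two agree for the unsampled elements to which the bound is applied.
  have hex := sum_lst_extra_eq (f := f) (I := I) (m := m) (fun S b u =>
      if ∃ v ∈ pre (lst f I S) u ∩ S, cls f (lst f I S) S u + 2 ^ lev I (S \ {u}) <
          cls f (lst f I S) S v then wt f (lst f I S) S u else 0)
    (fun S b u _ => by
      have h1 : symmDiff S {u} \ {u} = S \ {u} := by
        ext y; simp only [Finset.mem_sdiff, Finset.mem_symmDiff, Finset.mem_singleton]; tauto
      rw [wt_toggle, cls_toggle, pre_toggle, inter_toggle (notMem_pre_self _ _), h1]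
      congr 1
      refine propext (exists_congr fun v => and_congr_right fun hv => ?_)
      rw [cls_toggle_of_mem (Finset.mem_inter.1 hv).1])
    (fun _ _ _ _ _ => rfl)
  rw [mul_assoc, hex, totalWt, Finset.mul_sum]
  refine Finset.sum_le_sum fun S _ => ?_
  rw [Finset.mul_sum]
  refine Finset.sum_le_sum fun b _ => ?_
  set l := lst f I S with hl
  set c := cls f l S with hc
  set M := l.toFinset ∩ S with hM
  have hwt : ∀ u ∈ M, 0 < wt f l S u := fun u hu =>
    wt_pos (by simpa using (Finset.mem_inter.1 hu).1)
  rcases M.eq_empty_or_nonempty with hM0 | hM0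
  · rw [hM0]; simp
  obtain ⟨v₀, hv₀, hmax⟩ := Finset.exists_max_image M c hM0
  have hcard : (0 : ℝ) < M.card := by exact_mod_cast hM0.card_pos
  -- `lev` is chosen so that `2 ^ (2 ^ lev)` is at least 16 times the rank plus one, hence at least
  -- `16 * M.card` even with `u` removed from the sample. Each very low element thus weighs at most
  -- `1 / (16 * M.card)` of a top one, and all of them together at most 1/16.
  have hterm : ∀ u ∈ M, (if ∃ v ∈ pre l u ∩ S, c u + 2 ^ lev I (S \ {u}) < c v then
      wt f l S u else 0) ≤ wt f l S v₀ / (16 * M.card) := by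
    intro u hu
    split_ifs with h
    · obtain ⟨v, hv, hlt⟩ := h
      have hvM : v ∈ M := Finset.mem_inter.2 ⟨pre_subset l u (Finset.mem_inter.1 hv).1,
        (Finset.mem_inter.1 hv).2⟩
      have h1 : c u + 1 + 2 ^ lev I (S \ {u}) ≤ c v₀ := by have := hmax v hvM; linarith
      have h2 : (M.card : ℝ) ≤ rankOf I (S \ {u}) + 1 := by
        have hind : I (M.erase u) := by
          rw [hI]
          refine ((hI _).1 (kept_indep (f := f) (S := S) hI)).subset ?_
          exact_mod_cast (Finset.erase_subset u M)
        have := card_le_rankOf hind (A := S \ {u}) (fun y hy => by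
          rw [Finset.mem_erase] at hy
          exact Finset.mem_sdiff.2 ⟨(Finset.mem_inter.1 hy.2).2, by simpa using hy.1⟩)
        rw [Finset.card_erase_of_mem hu] at this
        have : M.card ≤ rankOf I (S \ {u}) + 1 := by omega
        exact_mod_cast this
      have h3 : (16 * (rankOf I (S \ {u}) + 1) : ℝ) ≤ (2 : ℝ) ^ (2 ^ lev I (S \ {u}) : ℕ) := by
        have a1 : 16 * (rankOf I (S \ {u}) + 1) ≤
            2 ^ Nat.clog 2 (16 * (rankOf I (S \ {u}) + 1)) := Nat.le_pow_clog (by norm_num) _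
        have a2 : Nat.clog 2 (16 * (rankOf I (S \ {u}) + 1)) ≤ 2 ^ lev I (S \ {u}) :=
          Nat.le_pow_clog (by norm_num) _
        have a3 := a1.trans (Nat.pow_le_pow_right (by norm_num : 0 < 2) a2)
        exact_mod_cast a3
      have h4 := (wt_lt_zpow_cls (f := f) (I := I) S u).le
      have h5 := zpow_cls_le (f := f) (I := I) (S := S) (u := v₀)
        (by simpa using (Finset.mem_inter.1 hv₀).1)
      rw [← hl, ← hc] at h4 h5
      have h6 : (2 : ℝ) ^ (c u + 1) * (2 : ℝ) ^ (2 ^ lev I (S \ {u}) : ℕ) ≤ 2 ^ c v₀ := by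
        rw [← zpow_natCast, ← zpow_add₀ (by norm_num)]
        refine zpow_le_zpow_right₀ (by norm_num) ?_
        push_cast; exact h1
      rw [le_div_iff₀ (by positivity)]
      have h7 : (16 * M.card : ℝ) ≤ (2 : ℝ) ^ (2 ^ lev I (S \ {u}) : ℕ) := by linarith
      calc wt f l S u * (16 * M.card)
          ≤ (2 : ℝ) ^ (c u + 1) * (2 : ℝ) ^ (2 ^ lev I (S \ {u}) : ℕ) :=
            mul_le_mul h4 h7 (by positivity) (by positivity)
        _ ≤ wt f l S v₀ := h6.trans h5
    · exact div_nonneg (hwt v₀ hv₀).le (by positivity)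
  have hsum := Finset.sum_le_card_nsmul M _ _ hterm
  rw [nsmul_eq_mul] at hsum
  have h8 : (M.card : ℝ) * (wt f l S v₀ / (16 * M.card)) = wt f l S v₀ / 16 := by
    field_simp
  rw [h8] at hsum
  have h9 := Finset.single_le_sum (f := fun u => wt f l S u) (fun u hu => (hwt u hu).le) hv₀
  linarith

/-- The weight of the elements that precede the sample but are not unique with this property. -/
theorem sum_crowded_le (hf : IsSubmodular f) (hI : ∀ A : Finset α, I A ↔ N.Indep (A : Set α)) :
    (m : ℝ) ^ 2 * ∑ S : Finset α, ∑ b : α → Fin m, ∑ u ∈ (lst f I S).toFinset ∩ extra S b,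
      (if pre (lst f I S) u ∩ S = ∅ ∧ ∃ y ∈ (lst f I S).toFinset ∩ extra S b, y ≠ u ∧
          pre (lst f I S) y ∩ S = ∅ then wt f (lst f I S) S u else 0) ≤ 2 * totalWt f I m := by
  have hm : (0 : ℝ) < m := by exact_mod_cast Nat.pos_of_ne_zero (NeZero.ne m)
  -- If no sampled element precedes `y`, the extra elements before `y` are charged to `y`. Only the
  -- first kept element has this property, so the kept elements are charged at most the extra weight
  -- once. In a crowded pair, either `u` precedes `y` and is charged to `y`, or `y` precedes `u` and
  -- weighs at least as much; hence the factor 2.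
  set ψ : Finset α → (α → Fin m) → α → ℝ := fun S b y =>
    if pre (lst f I S) y ∩ S = ∅ then
      ∑ x ∈ pre (lst f I S) y ∩ extra S b, wt f (lst f I S) S x else 0 with hψ
  have hex := sum_lst_extra_eq (f := f) (I := I) ψ
    (fun S b u _ => by
      simp only [hψ]
      rw [pre_toggle, inter_toggle (notMem_pre_self _ _), inter_extra_toggle (notMem_pre_self _ _)]
      congr 1
      exact Finset.sum_congr rfl fun x hx => wt_toggle_of_mem (Finset.mem_inter.1 hx).1)
    (fun S b u k _ => by
      simp only [hψ]
      rw [inter_extra_update (notMem_pre_self _ _)])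
  have hpos : ∀ (S : Finset α) (u : α), u ∈ lst f I S → 0 ≤ wt f (lst f I S) S u :=
    fun S u hu => (wt_pos hu).le
  have hψ0 : ∀ S b y, 0 ≤ ψ S b y := fun S b y => by
    simp only [hψ]
    split_ifs
    · exact Finset.sum_nonneg fun x hx => hpos S x (mem_lst_of_mem_pre (Finset.mem_inter.1 hx).1)
    · exact le_rfl
  have h1 : ∑ S : Finset α, ∑ b : α → Fin m, ∑ u ∈ (lst f I S).toFinset ∩ S, ψ S b u ≤
      ∑ S : Finset α, ∑ b : α → Fin m, ∑ x ∈ (lst f I S).toFinset ∩ extra S b,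
        wt f (lst f I S) S x := by
    refine Finset.sum_le_sum fun S _ => Finset.sum_le_sum fun b _ => ?_
    have hR : 0 ≤ ∑ x ∈ (lst f I S).toFinset ∩ extra S b, wt f (lst f I S) S x :=
      Finset.sum_nonneg fun x hx => hpos S x (by simpa using (Finset.mem_inter.1 hx).1)
    by_cases hex : ∃ y ∈ (lst f I S).toFinset ∩ S, pre (lst f I S) y ∩ S = ∅
    · obtain ⟨y, hy, hy0⟩ := hex
      rw [Finset.sum_eq_single_of_mem y hy]
      · simp only [hψ]
        rw [if_pos hy0]
        exact Finset.sum_le_sum_of_subset_of_nonneg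
          (Finset.inter_subset_inter_right (pre_subset _ _))
          fun x hx _ => hpos S x (by simpa using (Finset.mem_inter.1 hx).1)
      · intro y' hy' hne
        simp only [hψ]
        rw [if_neg]
        intro h
        rcases mem_pre_or (by simpa using (Finset.mem_inter.1 hy').1) hne with h1 | h1
        · exact Finset.notMem_empty y' (hy0 ▸ Finset.mem_inter.2 ⟨h1, (Finset.mem_inter.1 hy').2⟩)
        · exact Finset.notMem_empty y (h ▸ Finset.mem_inter.2 ⟨h1, (Finset.mem_inter.1 hy).2⟩)
    · push Not at hex
      rw [Finset.sum_eq_zero]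
      · exact hR
      · intro y hy
        simp only [hψ]
        rw [if_neg (hex y hy).ne_empty]
  have h2 : ∀ (S : Finset α) (b : α → Fin m), ∑ u ∈ (lst f I S).toFinset ∩ extra S b,
      (if pre (lst f I S) u ∩ S = ∅ ∧ ∃ y ∈ (lst f I S).toFinset ∩ extra S b, y ≠ u ∧
          pre (lst f I S) y ∩ S = ∅ then wt f (lst f I S) S u else 0) ≤
      2 * ∑ u ∈ (lst f I S).toFinset ∩ extra S b, ψ S b u := by
    intro S b
    set l := lst f I S with hl
    set Q := l.toFinset ∩ extra S b with hQ
    have hQl : ∀ u ∈ Q, u ∈ l := fun u hu => by simpa using (Finset.mem_inter.1 hu).1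
    have hψ' : ∀ y ∈ Q, ψ S b y = ∑ x ∈ Q, if pre l y ∩ S = ∅ ∧ x ∈ pre l y then wt f l S x
        else 0 := by
      intro y hy
      simp only [hψ]
      rw [← hl]
      by_cases h : pre l y ∩ S = ∅
      · simp only [h, true_and, if_true]
        rw [← Finset.sum_filter]
        refine Finset.sum_congr ?_ fun _ _ => rfl
        ext x
        simp only [hQ, Finset.mem_inter, Finset.mem_filter]
        exact ⟨fun hx => ⟨⟨pre_subset l y hx.1, hx.2⟩, hx.1⟩, fun hx => ⟨hx.2, hx.1.2⟩⟩
      · simp [h]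
    have e1 : ∑ u ∈ Q, ψ S b u = ∑ u ∈ Q, ∑ y ∈ Q,
        if pre l y ∩ S = ∅ ∧ u ∈ pre l y then wt f l S u else 0 := by
      rw [Finset.sum_comm]
      exact Finset.sum_congr rfl hψ'
    rw [two_mul]
    nth_rewrite 2 [e1]
    rw [← Finset.sum_add_distrib]
    refine Finset.sum_le_sum fun u hu => ?_
    have hin0 : ∀ y ∈ Q, 0 ≤ if pre l y ∩ S = ∅ ∧ u ∈ pre l y then wt f l S u else 0 :=
      fun y _ => by split_ifs; exacts [hpos S u (hQl u hu), le_rfl]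
    split_ifs with h
    · obtain ⟨hu0, y, hy, hyu, hy0⟩ := h
      rcases mem_pre_or (hQl y hy) hyu with h | h
      · have a1 : wt f l S u ≤ wt f l S y := wt_le_of_mem_pre hf hI (hQl u hu) h
        have a2 : wt f l S y ≤ ψ S b u := by
          simp only [hψ]
          rw [if_pos hu0]
          exact Finset.single_le_sum (f := fun x => wt f l S x)
            (fun x hx => hpos S x (mem_lst_of_mem_pre (Finset.mem_inter.1 hx).1))
            (Finset.mem_inter.2 ⟨h, (Finset.mem_inter.1 hy).2⟩)
        have a3 := Finset.sum_nonneg hin0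
        linarith
      · have a1 := Finset.single_le_sum hin0 hy
        rw [if_pos ⟨hy0, h⟩] at a1
        have := hψ0 S b u
        linarith
    · exact add_nonneg (hψ0 S b u) (Finset.sum_nonneg hin0)
  have h3 := Finset.sum_le_sum fun S (_ : S ∈ Finset.univ) => Finset.sum_le_sum
    fun b (_ : b ∈ Finset.univ) => h2 S b
  simp only [← Finset.mul_sum] at h3
  have h4 := sum_wt_extra (f := f) (I := I) (m := m)
  set X1 := ∑ S : Finset α, ∑ b : α → Fin m, ∑ u ∈ (lst f I S).toFinset ∩ extra S b, ψ S b u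
  have h6 : (m : ℝ) ^ 2 * X1 ≤ totalWt f I m := by
    have := mul_le_mul_of_nonneg_left (hex.le.trans h1) hm.le
    rw [h4] at this
    nlinarith
  have h7 := mul_le_mul_of_nonneg_left h3 (sq_nonneg (m : ℝ))
  linarith

/-- The optimum is bounded by the weight of the kept elements. -/
theorem card_mul_opt_le (hf : IsSubmodular f) (h0 : ∀ A, 0 ≤ f A)
    (hI : ∀ A : Finset α, I A ↔ N.Indep (A : Set α)) {O : Finset α} (hO : I O) :
    (Fintype.card (Finset α) : ℝ) * f O ≤ 2 * (Fintype.card (Finset α) * f ∅) +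
      6 * ∑ S : Finset α, ∑ u ∈ (lst f I S).toFinset ∩ S, wt f (lst f I S) S u := by
  set M : Finset α → Finset α := fun S => (lst f I S).toFinset ∩ S with hM
  -- The kept sets of complementary samples are disjoint, so the two extensions of `O` intersect in
  -- `O`, and on average at least half of `f O` survives without monotonicity.
  have h1 : (Fintype.card (Finset α) : ℝ) * f O ≤ 2 * ∑ S : Finset α, f (O ∪ M S) := by
    have hc : ∑ S : Finset α, f (O ∪ M Sᶜ) = ∑ S : Finset α, f (O ∪ M S) :=
      Fintype.sum_bijective (fun S : Finset α => Sᶜ) compl_bijective _ _ (fun _ => rfl)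
    rw [two_mul]
    nth_rewrite 2 [← hc]
    rw [← Finset.sum_add_distrib, ← nsmul_eq_mul, ← Finset.card_univ, ← Finset.sum_const]
    refine Finset.sum_le_sum fun S _ => ?_
    have a1 := union_add_inter_le hf (O ∪ M S) (O ∪ M Sᶜ)
    have a2 : (O ∪ M S) ∩ (O ∪ M Sᶜ) = O := by
      rw [← Finset.union_inter_distrib_left]
      have : M S ∩ M Sᶜ = ∅ := by
        ext x; simp only [hM, Finset.mem_inter, Finset.mem_compl, Finset.notMem_empty]; tauto
      rw [this, Finset.union_empty]
    rw [a2] at a1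
    have := h0 (O ∪ M S ∪ (O ∪ M Sᶜ))
    linarith
  have h2 : ∑ S : Finset α, ∑ u ∈ (lst f I S).toFinset \ S, wt f (lst f I S) S u =
      ∑ S : Finset α, ∑ u ∈ M S, wt f (lst f I S) S u := by
    have := sum_notMem_eq_sum_mem (α := α) (fun S u => if u ∈ (lst f I S).toFinset then
      wt f (lst f I S) S u else 0) (fun S u => by
        simp only [List.mem_toFinset, mem_lst_toggle, wt_toggle])
    rw [Finset.sum_congr rfl fun S _ => Finset.sum_ite_mem _ _ _,
        Finset.sum_congr rfl fun S _ => Finset.sum_ite_mem _ _ _] at this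
    simp only [hM]
    simp only [Finset.inter_comm _ (lst f I _).toFinset] at this
    rw [← this]
    refine Finset.sum_congr rfl fun S _ => Finset.sum_congr ?_ fun _ _ => rfl
    ext x; simp
  have h3 : ∀ S : Finset α, f (O ∪ M S) ≤ f ∅ + 2 * ∑ u ∈ M S, wt f (lst f I S) S u +
      ∑ u ∈ (lst f I S).toFinset \ S, wt f (lst f I S) S u := by
    intro S
    have a1 := union_le_add_sum hf (M S) O
    rw [Finset.union_comm] at a1
    have a2 := sum_wt_kept (f := f) (I := I) (S := S)
    have a3 := proc_greedy hf hI S Finset.univ ∅ O (Finset.subset_univ _) (by simpa using hO)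
    simp only [Finset.empty_union] at a3
    -- Unprocessed elements of `O` are left to the greedy bound. Processed unsampled ones cost at
    -- most their weight, which on average over `S` equals the kept weight by `h2`.
    have a4 : ∑ e ∈ O \ M S, marg f e (M S) ≤
        ∑ e ∈ O.filter (· ∉ lst f I S), marg f e (M S) +
          ∑ u ∈ (lst f I S).toFinset \ S, wt f (lst f I S) S u := by
      have hsplit : O \ M S = (O.filter (· ∉ lst f I S)) ∪
          (((lst f I S).toFinset \ S).filter (· ∈ O)) := by
        ext x
        simp only [hM, Finset.mem_sdiff, Finset.mem_inter, List.mem_toFinset, Finset.mem_union,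
          Finset.mem_filter]
        tauto
      rw [hsplit, Finset.sum_union]
      · refine add_le_add le_rfl ((Finset.sum_le_sum fun e he => ?_).trans
          (Finset.sum_le_sum_of_subset_of_nonneg (Finset.filter_subset _ _) fun e he _ => ?_))
        · refine marg_anti hf (Finset.inter_subset_inter_right (pre_subset _ _)) fun h => ?_
          exact (Finset.mem_sdiff.1 (Finset.mem_filter.1 he).1).2 (Finset.mem_inter.1 h).2
        · exact (wt_pos (by simpa using (Finset.mem_sdiff.1 he).1)).le
      · rw [Finset.disjoint_left]
        intro x hx hx'
        simp only [Finset.mem_filter, Finset.mem_sdiff, List.mem_toFinset] at hx hx'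
        exact hx.2 hx'.1.1
    have a5 : ∑ e ∈ O.filter (· ∉ lst f I S), marg f e (M S) ≤
        ∑ u ∈ M S, wt f (lst f I S) S u := a3
    have a6 : ∑ u ∈ M S, wt f (lst f I S) S u = f (M S) - f ∅ := a2
    linarith
  have h4 := Finset.sum_le_sum fun S (_ : S ∈ Finset.univ) => h3 S
  rw [Finset.sum_add_distrib, Finset.sum_add_distrib, h2, ← Finset.mul_sum, Finset.sum_const,
    Finset.card_univ, nsmul_eq_mul] at h4
  linarith

end Averages

/-! ### The value of the selected set -/

section Value

variable {α : Type*} [LinearOrder α] [Fintype α]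
variable {f : Finset α → ℝ} {I : Finset α → Prop} {N : Matroid α}

theorem two_mul_sum_inter (φ : α → ℝ) (Q : Finset α) :
    2 * ∑ C : Finset α, ∑ u ∈ Q ∩ C, φ u = Fintype.card (Finset α) * ∑ u ∈ Q, φ u := by
  have h1 : ∑ C : Finset α, ∑ u ∈ Q ∩ Cᶜ, φ u = ∑ C : Finset α, ∑ u ∈ Q ∩ C, φ u :=
    Fintype.sum_bijective _ (compl_involutive (α := Finset α)).bijective _ _ fun _ => rfl
  rw [two_mul]
  nth_rewrite 1 [← h1]
  rw [← Finset.sum_add_distrib, Finset.sum_congr rfl (g := fun _ => ∑ u ∈ Q, φ u)]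
  · simp
  · intro C _
    rw [← Finset.sum_union]
    · congr 1
      ext x
      simp only [Finset.mem_union, Finset.mem_inter, Finset.mem_compl]
      tauto
    · rw [Finset.disjoint_left]
      intro x hx hx'
      simp only [Finset.mem_inter, Finset.mem_compl] at hx hx'
      exact hx.2 hx'.2

/-- The elements of `X ∩ C` that are selected with constant probability and whose marginal value
does not suffer from the other elements of `X`. -/
def good (f : Finset α → ℝ) (I : Finset α → Prop) (N : Matroid α) (S X C : Finset α) :
    Finset α :=
  ((lst f I S).toFinset ∩ X ∩ C).filter fun u =>
    wt f (lst f I S) S u / 2 ≤ marg f u (pre (lst f I S) u ∩ (S ∪ X)) ∧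
    u ∉ N.closure (((lst f I S).toFinset ∩ X ∩ C).filter fun y => y ≠ u ∧
        cls f (lst f I S) S u ≤ cls f (lst f I S) S y : Finset α) ∧
    (¬ ∃ v ∈ pre (lst f I S) u ∩ S, cls f (lst f I S) S u + 2 ^ lev I (S \ {u}) <
          cls f (lst f I S) S v) ∧
    ¬ (pre (lst f I S) u ∩ S = ∅ ∧ ∃ y ∈ (lst f I S).toFinset ∩ X, y ≠ u ∧
          pre (lst f I S) y ∩ S = ∅)

/-- In units of the total weight, the extra elements in `C` carry `1 / (2 m)`; lossy, blocked and
crowded ones take at most `(6 + 2 + 2) / m ^ 2`, and low ones `1 / (16 m)`. For `m ≥ 80` at least `5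
/ (16 m)` remains. -/
theorem sum_good_ge {m : ℕ} [NeZero m] (hm : 80 ≤ m) (hf : IsSubmodular f) (h0 : ∀ A, 0 ≤ f A)
    (hE : N.E = Set.univ) (hI : ∀ A : Finset α, I A ↔ N.Indep (A : Set α))
    (hW : ∑ _S : Finset α, ∑ _b : α → Fin m, f ∅ ≤ totalWt f I m) :
    (Fintype.card (Finset α) : ℝ) * totalWt f I m ≤
      4 * m * ∑ S : Finset α, ∑ b : α → Fin m, ∑ C : Finset α,
        ∑ u ∈ good f I N S (extra S b) C, wt f (lst f I S) S u := by
  set i1 : Finset α → (α → Fin m) → α → ℝ := fun S b u =>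
    if marg f u (pre (lst f I S) u ∩ (S ∪ extra S b)) < wt f (lst f I S) S u / 2 then
        wt f (lst f I S) S u else 0 with hi1
  set i2 : Finset α → (α → Fin m) → Finset α → α → ℝ := fun S b C u =>
    if u ∈ N.closure (((lst f I S).toFinset ∩ extra S b ∩ C).filter fun y => y ≠ u ∧
        cls f (lst f I S) S u ≤ cls f (lst f I S) S y : Finset α) then
        wt f (lst f I S) S u else 0 with hi2
  set i3 : Finset α → (α → Fin m) → α → ℝ := fun S b u =>
    if ∃ v ∈ pre (lst f I S) u ∩ S, cls f (lst f I S) S u + 2 ^ lev I (S \ {u}) <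
          cls f (lst f I S) S v then wt f (lst f I S) S u else 0 with hi3
  set i4 : Finset α → (α → Fin m) → α → ℝ := fun S b u =>
    if pre (lst f I S) u ∩ S = ∅ ∧ ∃ y ∈ (lst f I S).toFinset ∩ extra S b, y ≠ u ∧
          pre (lst f I S) y ∩ S = ∅ then wt f (lst f I S) S u else 0 with hi4
  have hpos : ∀ S, ∀ u ∈ (lst f I S).toFinset, 0 ≤ wt f (lst f I S) S u := fun S u hu =>
    (wt_pos (List.mem_toFinset.1 hu)).le
  have h1 := sum_lossy_le (m := m) hf h0 hW (I := I)
  have h2 := sum_blocked_le (m := m) hf hE hI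
  have h3 := sum_low_le (m := m) (f := f) hI
  have h4 := sum_crowded_le (m := m) hf hI
  have h5 := sum_wt_extra (m := m) (f := f) (I := I)
  have key : ∀ S (b : α → Fin m) (C : Finset α),
      ∑ u ∈ (lst f I S).toFinset ∩ extra S b ∩ C, wt f (lst f I S) S u ≤
      ∑ u ∈ good f I N S (extra S b) C, wt f (lst f I S) S u +
        (∑ u ∈ (lst f I S).toFinset ∩ extra S b, i1 S b u +
        ∑ u ∈ (lst f I S).toFinset ∩ extra S b ∩ C, i2 S b C u +
        ∑ u ∈ (lst f I S).toFinset ∩ extra S b, i3 S b u +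
        ∑ u ∈ (lst f I S).toFinset ∩ extra S b, i4 S b u) := by
    intro S b C
    have hle : ∀ φ : α → ℝ, (∀ u ∈ (lst f I S).toFinset, 0 ≤ φ u) →
        ∑ u ∈ (lst f I S).toFinset ∩ extra S b ∩ C, φ u ≤
        ∑ u ∈ (lst f I S).toFinset ∩ extra S b, φ u := fun φ hφ =>
      Finset.sum_le_sum_of_subset_of_nonneg Finset.inter_subset_left
        fun u hu _ => hφ u (Finset.mem_inter.1 hu).1
    have n1 : ∀ u ∈ (lst f I S).toFinset, 0 ≤ i1 S b u := fun u hu => by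
      simp only [hi1]; split_ifs; exacts [hpos S u hu, le_rfl]
    have n2 : ∀ u ∈ (lst f I S).toFinset, 0 ≤ i2 S b C u := fun u hu => by
      simp only [hi2]; split_ifs; exacts [hpos S u hu, le_rfl]
    have n3 : ∀ u ∈ (lst f I S).toFinset, 0 ≤ i3 S b u := fun u hu => by
      simp only [hi3]; split_ifs; exacts [hpos S u hu, le_rfl]
    have n4 : ∀ u ∈ (lst f I S).toFinset, 0 ≤ i4 S b u := fun u hu => by
      simp only [hi4]; split_ifs; exacts [hpos S u hu, le_rfl]
    have k1 := hle _ n1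
    have k3 := hle _ n3
    have k4 := hle _ n4
    have : ∑ u ∈ (lst f I S).toFinset ∩ extra S b ∩ C, wt f (lst f I S) S u ≤
        ∑ u ∈ good f I N S (extra S b) C, wt f (lst f I S) S u +
        ∑ u ∈ (lst f I S).toFinset ∩ extra S b ∩ C,
          (i1 S b u + i2 S b C u + i3 S b u + i4 S b u) := by
      rw [good, Finset.sum_filter, ← Finset.sum_add_distrib]
      refine Finset.sum_le_sum fun u hu => ?_
      have hul := (Finset.mem_inter.1 (Finset.mem_inter.1 hu).1).1
      have a1 := n1 u hul
      have a2 := n2 u hul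
      have a3 := n3 u hul
      have a4 := n4 u hul
      split_ifs with hg
      · linarith
      · by_cases c1 : marg f u (pre (lst f I S) u ∩ (S ∪ extra S b)) < wt f (lst f I S) S u / 2
        · have : i1 S b u = wt f (lst f I S) S u := if_pos c1
          linarith
        by_cases c2 : u ∈ N.closure (((lst f I S).toFinset ∩ extra S b ∩ C).filter fun y =>
            y ≠ u ∧ cls f (lst f I S) S u ≤ cls f (lst f I S) S y : Finset α)
        · have : i2 S b C u = wt f (lst f I S) S u := if_pos c2
          linarith
        by_cases c3 : ∃ v ∈ pre (lst f I S) u ∩ S,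
            cls f (lst f I S) S u + 2 ^ lev I (S \ {u}) < cls f (lst f I S) S v
        · have : i3 S b u = wt f (lst f I S) S u := if_pos c3
          linarith
        by_cases c4 : pre (lst f I S) u ∩ S = ∅ ∧ ∃ y ∈ (lst f I S).toFinset ∩ extra S b,
            y ≠ u ∧ pre (lst f I S) y ∩ S = ∅
        · have : i4 S b u = wt f (lst f I S) S u := if_pos c4
          linarith
        exact absurd ⟨not_lt.1 c1, c2, c3, c4⟩ hg
    simp only [Finset.sum_add_distrib] at this
    linarith
  have hsum := Finset.sum_le_sum fun S (_ : S ∈ Finset.univ) => Finset.sum_le_sum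
    fun b (_ : b ∈ Finset.univ) => Finset.sum_le_sum
      fun C (_ : C ∈ Finset.univ) => key S b C
  have hhalf : ∀ S (b : α → Fin m), ∑ C : Finset α, ∑ u ∈ (lst f I S).toFinset ∩ extra S b ∩ C,
      wt f (lst f I S) S u = Fintype.card (Finset α) / 2 *
        ∑ u ∈ (lst f I S).toFinset ∩ extra S b, wt f (lst f I S) S u := fun S b => by
    have := two_mul_sum_inter (wt f (lst f I S) S) ((lst f I S).toFinset ∩ extra S b)
    linarith
  simp only [hhalf, Finset.sum_add_distrib, Finset.sum_const, Finset.card_univ, nsmul_eq_mul,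
    ← Finset.mul_sum] at hsum
  set c : ℝ := (Fintype.card (Finset α) : ℝ)
  set A := ∑ S : Finset α, ∑ b : α → Fin m, ∑ u ∈ (lst f I S).toFinset ∩ extra S b,
    wt f (lst f I S) S u
  set G := ∑ S : Finset α, ∑ b : α → Fin m, ∑ C : Finset α,
        ∑ u ∈ good f I N S (extra S b) C, wt f (lst f I S) S u
  set L1 := ∑ S : Finset α, ∑ b : α → Fin m, ∑ u ∈ (lst f I S).toFinset ∩ extra S b, i1 S b u
  set L2 := ∑ S : Finset α, ∑ b : α → Fin m, ∑ C : Finset α,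
    ∑ u ∈ (lst f I S).toFinset ∩ extra S b ∩ C, i2 S b C u
  set L3 := ∑ S : Finset α, ∑ b : α → Fin m, ∑ u ∈ (lst f I S).toFinset ∩ extra S b, i3 S b u
  set L4 := ∑ S : Finset α, ∑ b : α → Fin m, ∑ u ∈ (lst f I S).toFinset ∩ extra S b, i4 S b u
  set W := totalWt f I m
  have hc : 0 ≤ c := Nat.cast_nonneg _
  have hM : (80 : ℝ) ≤ m := by exact_mod_cast hm
  have hWpos : 0 ≤ W := le_trans (Finset.sum_nonneg fun _ _ => Finset.sum_nonneg
    fun _ _ => h0 ∅) hW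
  have hcW : 0 ≤ c * W := mul_nonneg hc hWpos
  have e1 : c / 2 * A * (m : ℝ) ^ 2 ≤ (G + (c * L1 + L2 + c * L3 + c * L4)) * (m : ℝ) ^ 2 :=
    mul_le_mul_of_nonneg_right hsum (by positivity)
  have e2 : c / 2 * A * (m : ℝ) ^ 2 = m * (c * W) / 2 := by rw [← h5]; ring
  have e3 := mul_le_mul_of_nonneg_left h1 hc
  have e4 := mul_le_mul_of_nonneg_left h4 hc
  have e5 := mul_le_mul_of_nonneg_left h3 (mul_nonneg hc (by positivity : (0 : ℝ) ≤ m / 16))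
  have e6 : 80 * (c * W) ≤ m * (c * W) := mul_le_mul_of_nonneg_right hM hcW
  have e7 : m * (c * W) ≤ m * (4 * m * G) := by nlinarith
  exact le_of_mul_le_mul_left e7 (by linarith)

/-- The rule of a random type selects every good element with constant probability. -/
theorem sum_accept_good_ge (hf : IsSubmodular f)
    (hE : N.E = Set.univ) (hI : ∀ A : Finset α, I A ↔ N.Indep (A : Set α)) {S X C : Finset α}
    (hX : Disjoint S X) {u : α} (hu : u ∈ good f I N S X C) :
    (Fintype.card (Finset α) : ℝ) ≤ 4 * ∑ j ∈ Finset.range (2 * (lev I S + 2)), ∑ D : Finset α,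
      if u ∉ D ∧ Accept f I S (X ∩ C) D (lev I S) j (lst f I S) Finset.univ u then 1 else 0 := by
  obtain ⟨hu1, -, hspan, hlow, hcrowd⟩ := Finset.mem_filter.1 hu
  simp only [Finset.mem_inter, List.mem_toFinset] at hu1
  have huS : u ∉ S := fun h => Finset.disjoint_left.1 hX h hu1.1.2
  have hSu : S \ {u} = S := by
    rw [Finset.sdiff_singleton_eq_erase, Finset.erase_eq_of_notMem huS]
  rw [hSu] at hlow
  push Not at hlow
  refine sum_accept_ge hu1.1.1 ?_ ?_ ?_ ?_
  · rwa [← Finset.inter_assoc, spans_iff hE hI]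
  · intro h v hv hne
    rw [Finset.nonempty_iff_ne_empty]
    intro hv0
    rw [← Finset.inter_assoc] at hv
    exact hcrowd ⟨h, v, (Finset.mem_inter.1 hv).1, hne, hv0⟩
  · intro v hv
    rw [Finset.mem_inter, List.mem_toFinset] at hv
    have hne : v ≠ u := fun h => huS (h ▸ hv.2)
    rcases mem_pre_or hv.1 hne with h | h
    · exact hlow v (Finset.mem_inter.2 ⟨h, hv.2⟩)
    · have := cls_le_of_mem_pre hf hI hv.1 h
      have h2 : (0 : ℤ) ≤ 2 ^ lev I S := by positivity
      linarith
  · rintro ⟨v, hv⟩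
    rw [Finset.mem_inter] at hv
    exact ⟨v, by simp [mem_lst_of_mem_pre hv.1, hv.2], cls_le_of_mem_pre hf hI hu1.1.1 hv.1⟩

/-- The factor 32 is 4 for the total acceptance probability, 2 for keeping only half of each weight,
and 4 for passing by random thinning from the selected set to its good accepted part, needed because
the other selected elements may lower `f`. -/
theorem sum_value_sel_ge (hf : IsSubmodular f) (h0 : ∀ A, 0 ≤ f A)
    (hE : N.E = Set.univ) (hI : ∀ A : Finset α, I A ↔ N.Indep (A : Set α)) {S X C : Finset α}
    (hX : Disjoint S X) (ord : Finset α → α → ℕ)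
    (hlast : ∀ D, ∀ u ∈ (X ∩ C) \ D, ∀ v ∉ (X ∩ C) \ D, ord D v < ord D u) :
    (Fintype.card (Finset α) : ℝ) ^ 2 * ∑ u ∈ good f I N S X C, wt f (lst f I S) S u ≤
      32 * ∑ D : Finset α, ∑ Th : Finset α, ∑ j ∈ Finset.range (2 * (lev I S + 2)),
        f (sel f I S (X ∩ C) D (ord D) j ∩ Th) := by
  set c : ℝ := (Fintype.card (Finset α) : ℝ) with hc
  set G := good f I N S X C with hG
  set w := wt f (lst f I S) S with hw
  set k := 2 * (lev I S + 2) with hk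
  have hGl : G ⊆ (lst f I S).toFinset ∩ (X ∩ C) := by
    rw [← Finset.inter_assoc]; exact Finset.filter_subset _ _
  have h1 : ∀ D j, c * ∑ u ∈ G, (if u ∉ D ∧ Accept f I S (X ∩ C) D (lev I S) j (lst f I S)
      Finset.univ u then w u else 0) ≤
      8 * ∑ Th : Finset α, f (sel f I S (X ∩ C) D (ord D) j ∩ Th) := by
    intro D j
    rw [← Finset.sum_filter]
    set B := G.filter fun u => u ∉ D ∧ Accept f I S (X ∩ C) D (lev I S) j (lst f I S)
      Finset.univ u with hB
    have hBsel : B ⊆ sel f I S (X ∩ C) D (ord D) j := by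
      intro u hu
      obtain ⟨huG, huD, hacc⟩ := Finset.mem_filter.1 hu
      have huY := (Finset.mem_inter.1 (hGl huG)).2
      have huR : u ∈ (X ∩ C) \ D := Finset.mem_sdiff.2 ⟨huY, huD⟩
      refine Finset.mem_filter.2 ⟨huR, hacc.of_univ fun v hv => ?_⟩
      simp only [arrived, Finset.mem_filter, Finset.mem_univ, true_and]
      refine (hlast D u huR v fun h => ?_).le
      exact (Finset.mem_sdiff.1 h).2 (Finset.mem_inter.1 hv).2
    have h2 : ∑ u ∈ B, w u / 2 ≤ f B := by
      refine sum_wt_le_value (X := X) hf h0 lst_nodup ?_ ?_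
      · refine ((Finset.filter_subset _ _).trans hGl).trans ?_
        exact Finset.inter_subset_inter_left Finset.inter_subset_left
      · intro u hu
        exact (Finset.mem_filter.1 (Finset.mem_filter.1 hu).1).2.1
    have h3 := sum_inter_ge hf h0 hBsel
    rw [← Finset.sum_div] at h2
    have h4 := mul_le_mul_of_nonneg_left h2 (Nat.cast_nonneg (Fintype.card (Finset α)) : 0 ≤ c)
    linarith
  have h2 : c * ∑ u ∈ G, w u ≤ 4 * ∑ D : Finset α, ∑ j ∈ Finset.range k, ∑ u ∈ G,
      (if u ∉ D ∧ Accept f I S (X ∩ C) D (lev I S) j (lst f I S)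
      Finset.univ u then w u else 0) := by
    have e : ∑ D : Finset α, ∑ j ∈ Finset.range k, ∑ u ∈ G,
      (if u ∉ D ∧ Accept f I S (X ∩ C) D (lev I S) j (lst f I S)
      Finset.univ u then w u else 0) = ∑ u ∈ G, w u * ∑ j ∈ Finset.range k, ∑ D : Finset α,
      (if u ∉ D ∧ Accept f I S (X ∩ C) D (lev I S) j (lst f I S)
      Finset.univ u then 1 else 0) := by
      rw [Finset.sum_comm]
      simp only [Finset.mul_sum, mul_ite, mul_one, mul_zero]
      rw [Finset.sum_comm (s := G)]
      refine Finset.sum_congr rfl fun j _ => Finset.sum_comm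
    rw [e, Finset.mul_sum, Finset.mul_sum]
    refine Finset.sum_le_sum fun u hu => ?_
    have hul : u ∈ lst f I S := List.mem_toFinset.1 (Finset.mem_inter.1 (hGl hu)).1
    have a1 := mul_le_mul_of_nonneg_left (sum_accept_good_ge hf hE hI hX hu) (wt_pos hul).le
    simp only [hw]
    linarith
  have h3 := Finset.sum_le_sum fun D (_ : D ∈ Finset.univ) => Finset.sum_le_sum
    fun j (_ : j ∈ Finset.range k) => h1 D j
  simp only [← Finset.mul_sum] at h3
  have h4 := mul_le_mul_of_nonneg_left h2 (Nat.cast_nonneg (Fintype.card (Finset α)) : 0 ≤ c)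
  have h5 : ∑ D : Finset α, ∑ Th : Finset α, ∑ j ∈ Finset.range k,
        f (sel f I S (X ∩ C) D (ord D) j ∩ Th) = ∑ D : Finset α, ∑ j ∈ Finset.range k,
        ∑ Th : Finset α, f (sel f I S (X ∩ C) D (ord D) j ∩ Th) :=
    Finset.sum_congr rfl fun D _ => Finset.sum_comm
  rw [h5]
  nlinarith [h3, h4]

/-- The selected set of a random type, thinned out at random, has large value on average. -/
theorem opt_le_average {m : ℕ} [NeZero m] (hm : m = 80) (hf : IsSubmodular f)
    (h0 : ∀ A, 0 ≤ f A) (hE : N.E = Set.univ)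
    (hI : ∀ A : Finset α, I A ↔ N.Indep (A : Set α))
    (ord : Finset α → (α → Fin m) → Finset α → Finset α → α → ℕ)
    (hlast : ∀ S b C D, ∀ u ∈ (extra S b ∩ C) \ D, ∀ v ∉ (extra S b ∩ C) \ D,
      ord S b C D v < ord S b C D u)
    {K : ℝ} (hK : ∀ S, ((2 * (lev I S + 2) : ℕ) : ℝ) ≤ K) {O : Finset α} (hO : I O) :
    (Fintype.card (Finset α) : ℝ) ^ 4 * Fintype.card (α → Fin m) * f O ≤
      81920 * K * ∑ S : Finset α, ∑ b : α → Fin m, ∑ C : Finset α, ∑ D : Finset α,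
        ∑ Th : Finset α, (∑ j ∈ Finset.range (2 * (lev I S + 2)),
          f (sel f I S (extra S b ∩ C) D (ord S b C D) j ∩ Th)) /
            ((2 * (lev I S + 2) : ℕ) : ℝ) := by
  set c : ℝ := (Fintype.card (Finset α) : ℝ) with hc
  set cb : ℝ := (Fintype.card (α → Fin m) : ℝ) with hcb
  set V := ∑ S : Finset α, ∑ b : α → Fin m, ∑ C : Finset α, ∑ D : Finset α,
        ∑ Th : Finset α, (∑ j ∈ Finset.range (2 * (lev I S + 2)),
          f (sel f I S (extra S b ∩ C) D (ord S b C D) j ∩ Th)) /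
            ((2 * (lev I S + 2) : ℕ) : ℝ) with hV
  have hc0 : 0 ≤ c := Nat.cast_nonneg _
  have hcb0 : 0 ≤ cb := Nat.cast_nonneg _
  have hk0 : ∀ S, (0 : ℝ) < ((2 * (lev I S + 2) : ℕ) : ℝ) := fun S => by positivity
  have hK1 : 1 ≤ K := by
    refine le_trans ?_ (hK ∅)
    exact_mod_cast (by omega : 1 ≤ 2 * (lev I ∅ + 2))
  have hV0 : 0 ≤ V := Finset.sum_nonneg fun S _ => Finset.sum_nonneg fun b _ =>
    Finset.sum_nonneg fun C _ => Finset.sum_nonneg fun D _ => Finset.sum_nonneg fun Th _ =>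
      div_nonneg (Finset.sum_nonneg fun j _ => h0 _) (hk0 S).le
  have hopt := card_mul_opt_le hf h0 hI hO
  have hopt' : c * cb * f O ≤ 2 * (c * cb * f ∅) + 6 * totalWt f I m := by
    have h1 := mul_le_mul_of_nonneg_left hopt hcb0
    have h2 : totalWt f I m = cb * ∑ S : Finset α, ∑ u ∈ (lst f I S).toFinset ∩ S,
        wt f (lst f I S) S u := by
      simp only [totalWt, Finset.sum_const, Finset.card_univ, nsmul_eq_mul, ← Finset.mul_sum]
      rfl
    rw [h2]
    linarith
  have hsum0 : ∑ _S : Finset α, ∑ _b : α → Fin m, f ∅ = c * cb * f ∅ := by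
    simp only [Finset.sum_const, Finset.card_univ, nsmul_eq_mul]
    rw [hc, hcb]; ring
  -- If the weights dominate `f ∅`, the constant is 81920 = 8 · (4 · 80) · 32. Otherwise `f O ≤ 8 *
  -- f ∅`, and thinning any selected set already retains a quarter of `f ∅`.
  rcases le_total (∑ _S : Finset α, ∑ _b : α → Fin m, f ∅) (totalWt f I m) with hW | hW
  · have h1 := sum_good_ge (by omega : 80 ≤ m) hf h0 hE hI hW
    have h2 : c ^ 2 * ∑ S : Finset α, ∑ b : α → Fin m, ∑ C : Finset α,
        ∑ u ∈ good f I N S (extra S b) C, wt f (lst f I S) S u ≤ 32 * (K * V) := by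
      rw [hV]
      simp only [Finset.mul_sum]
      refine Finset.sum_le_sum fun S _ => Finset.sum_le_sum fun b _ =>
        Finset.sum_le_sum fun C _ => ?_
      have a1 := sum_value_sel_ge hf h0 hE hI (C := C) (disjoint_extra S b) (ord S b C)
        (hlast S b C)
      rw [← Finset.mul_sum]
      refine a1.trans ?_
      rw [Finset.mul_sum]
      refine Finset.sum_le_sum fun D _ => ?_
      rw [Finset.mul_sum]
      refine Finset.sum_le_sum fun Th _ => ?_
      refine mul_le_mul_of_nonneg_left ?_ (by norm_num)
      rw [mul_div_assoc', le_div_iff₀ (hk0 S), mul_comm]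
      exact mul_le_mul_of_nonneg_right (hK S) (Finset.sum_nonneg fun j _ => h0 _)
    have hm' : (m : ℝ) = 80 := by exact_mod_cast hm
    rw [hm'] at h1
    rw [hsum0] at hW
    have a1 : c * cb * f O ≤ 8 * totalWt f I m := by linarith
    have a2 := mul_le_mul_of_nonneg_left a1 (by positivity : 0 ≤ c ^ 3)
    have a3 := mul_le_mul_of_nonneg_left h1 (by positivity : 0 ≤ c ^ 2)
    linarith
  · rw [hsum0] at hW
    have a1 : c * cb * f O ≤ 8 * (c * cb * f ∅) := by linarith
    have a2 : c ^ 4 * cb * f ∅ ≤ 4 * V := by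
      have : ∀ S (b : α → Fin m) (C D : Finset α), c * f ∅ ≤ 4 * ∑ Th : Finset α,
          (∑ j ∈ Finset.range (2 * (lev I S + 2)),
          f (sel f I S (extra S b ∩ C) D (ord S b C D) j ∩ Th)) /
            ((2 * (lev I S + 2) : ℕ) : ℝ) := by
        intro S b C D
        rw [← Finset.sum_div, Finset.sum_comm, mul_div_assoc', le_div_iff₀ (hk0 S)]
        have := Finset.sum_le_sum fun j (_ : j ∈ Finset.range (2 * (lev I S + 2))) =>
          sum_inter_ge hf h0 (Finset.empty_subset (sel f I S (extra S b ∩ C) D (ord S b C D) j))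
        rw [Finset.sum_const, Finset.card_range, nsmul_eq_mul, ← Finset.mul_sum] at this
        simp only [hc]
        linarith
      have := Finset.sum_le_sum fun S (_ : S ∈ Finset.univ) => Finset.sum_le_sum
        fun b (_ : b ∈ Finset.univ) => Finset.sum_le_sum fun C (_ : C ∈ Finset.univ) =>
          Finset.sum_le_sum fun D (_ : D ∈ Finset.univ) => this S b C D
      simp only [← Finset.mul_sum] at this
      simp only [Finset.sum_const, Finset.card_univ, nsmul_eq_mul] at this
      refine le_trans (le_of_eq ?_) this
      rw [hc, hcb]; ring
    have a3 := mul_le_mul_of_nonneg_left a1 (by positivity : 0 ≤ c ^ 3)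
    have a4 : 0 ≤ (K - 1) * V := mul_nonneg (by linarith) hV0
    nlinarith

end Value

/-! ### The decision only depends on the elements that have arrived -/

section Locality

variable {α : Type*} [LinearOrder α] {f f' : Finset α → ℝ} {I I' : Finset α → Prop}
  {V : Finset α}

theorem spans_congr (hI : ∀ A ⊆ V, (I' A ↔ I A)) {A : Finset α} (hA : A ⊆ V) {u : α}
    (hu : u ∈ V) : Spans I' A u ↔ Spans I A u := by
  unfold Spans
  refine or_congr Iff.rfl (exists_congr fun J => ?_)
  refine and_congr_right fun hJ => ?_
  rw [hI J (hJ.trans hA), hI _ (Finset.insert_subset hu (hJ.trans hA))]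

theorem rankOf_congr (hI : ∀ A ⊆ V, (I' A ↔ I A)) {A : Finset α} (hA : A ⊆ V) :
    rankOf I' A = rankOf I A :=
  le_antisymm
    (rankOf_le fun J hJ h => card_le_rankOf ((hI J (hJ.trans hA)).1 h) hJ)
    (rankOf_le fun J hJ h => card_le_rankOf ((hI J (hJ.trans hA)).2 h) hJ)

theorem lev_congr (hI : ∀ A ⊆ V, (I' A ↔ I A)) {A : Finset α} (hA : A ⊆ V) :
    lev I' A = lev I A := by rw [lev, lev, rankOf_congr hI hA]

variable [Fintype α]

/-- Since `S ⊆ V`, running the process on `V` yields the restriction of the full list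
(`proc_filter`), with the same kept predecessors and hence the same classes. Apart from these, the
rule queries only subsets of `V`. -/
theorem accept_congr (hf : ∀ A ⊆ V, f' A = f A) (hI : ∀ A ⊆ V, (I' A ↔ I A))
    {S Y D : Finset α} (hS : S ⊆ V) (T j : ℕ) {u : α} (hu : u ∈ V) :
    Accept f' I' S Y D T j (proc f' I' S V ∅) V u ↔
      Accept f I S Y D T j (lst f I S) V u := by
  have hl : proc f' I' S V ∅ = (lst f I S).filter (· ∈ V) := by
    rw [proc_congr hf hI S V ∅ (Finset.Subset.refl _) (Finset.empty_subset _), lst,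
      ← proc_filter S V hS, Finset.univ_inter]
  rw [hl]
  set l := lst f I S
  set l' := l.filter (· ∈ V) with hl'
  have hpre : ∀ v ∈ V, pre l' v ∩ S = pre l v ∩ S := fun v hv => by
    rw [hl', pre_filter hv, Finset.inter_assoc, Finset.inter_eq_right.2 hS]
  have hcls : ∀ v ∈ V, cls f' l' S v = cls f l S v := fun v hv => by
    have hsub : pre l v ∩ S ⊆ V := Finset.inter_subset_right.trans hS
    rw [cls, cls, wt, wt, hpre v hv, marg, marg, hf _ hsub,
      hf _ (Finset.insert_subset hv hsub)]
  have hlS : l'.toFinset ∩ S = l.toFinset ∩ S := by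
    ext x
    simp only [hl', Finset.mem_inter, List.mem_toFinset, List.mem_filter, decide_eq_true_eq]
    exact ⟨fun h => ⟨h.1.1, h.2⟩, fun h => ⟨⟨h.1, hS h.2⟩, h.2⟩⟩
  have hlY : l'.toFinset ∩ Y ∩ V = l.toFinset ∩ Y ∩ V := by
    ext x
    simp only [hl', Finset.mem_inter, List.mem_toFinset, List.mem_filter, decide_eq_true_eq]
    tauto
  have hul : u ∈ l' ↔ u ∈ l := by simp [hl', hu]
  have hriv : ∀ t, rivals (cls f' l' S) (l.toFinset ∩ Y ∩ V) D t u =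
      rivals (cls f l S) (l.toFinset ∩ Y ∩ V) D t u := fun t => by
    refine Finset.filter_congr fun y hy => ?_
    rw [hcls u hu, hcls y (Finset.mem_inter.1 hy).2]
  have hcert : ∀ t, certs (cls f' l' S) (l.toFinset ∩ Y ∩ V) D t u =
      certs (cls f l S) (l.toFinset ∩ Y ∩ V) D t u := fun t => by
    refine Finset.filter_congr fun y hy => ?_
    rw [hcls u hu, hcls y (Finset.mem_inter.1 hy).2]
  have hsr : ∀ t, Spans I' (rivals (cls f l S) (l.toFinset ∩ Y ∩ V) D t u) u ↔
      Spans I (rivals (cls f l S) (l.toFinset ∩ Y ∩ V) D t u) u := fun t =>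
    spans_congr hI ((Finset.filter_subset _ _).trans Finset.inter_subset_right) hu
  have hsc : ∀ t, Spans I' (certs (cls f l S) (l.toFinset ∩ Y ∩ V) D t u) u ↔
      Spans I (certs (cls f l S) (l.toFinset ∩ Y ∩ V) D t u) u := fun t =>
    spans_congr hI ((Finset.filter_subset _ _).trans Finset.inter_subset_right) hu
  unfold Accept
  rw [hlS, hlY, hul, hpre u hu]
  simp only [hriv, hcert, hsr, hsc, hcls u hu]
  have hmax : (∃ v ∈ l.toFinset ∩ S, (∀ v' ∈ l.toFinset ∩ S, cls f' l' S v' ≤ cls f' l' S v) ∧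
        cls f l S u / 2 ^ T + ((j % 2 : ℕ) : ℤ) = cls f' l' S v / 2 ^ T) ↔
      (∃ v ∈ l.toFinset ∩ S, (∀ v' ∈ l.toFinset ∩ S, cls f l S v' ≤ cls f l S v) ∧
        cls f l S u / 2 ^ T + ((j % 2 : ℕ) : ℤ) = cls f l S v / 2 ^ T) := by
    refine exists_congr fun v => and_congr_right fun hv => ?_
    rw [hcls v (hS (Finset.mem_inter.1 hv).2)]
    refine and_congr_left fun _ => forall₂_congr fun v' hv' => ?_
    rw [hcls v' (hS (Finset.mem_inter.1 hv').2)]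
  have hfew : (∀ v ∈ l.toFinset ∩ Y ∩ V, v ∉ D → v ≠ u → (pre l' v ∩ S).Nonempty) ↔
      (∀ v ∈ l.toFinset ∩ Y ∩ V, v ∉ D → v ≠ u → (pre l v ∩ S).Nonempty) := by
    refine forall₂_congr fun v hv => ?_
    rw [hpre v (Finset.mem_inter.1 hv).2]
  rw [hmax, hfew]

end Locality

/-! ### The algorithm -/

section Algorithm

variable {n : ℕ}

/-- An order of arrival in which the elements of `R` come last. -/
def lastOrder (R : Finset (Fin n)) : Equiv.Perm (Fin n) :=
  Tuple.sort fun v => if v ∈ R then 1 else 0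

/-- The time at which `v` arrives in the order `lastOrder R`. -/
def time (R : Finset (Fin n)) (v : Fin n) : ℕ := ((lastOrder R).symm v : ℕ)

theorem time_injective (R : Finset (Fin n)) : Function.Injective (time R) := fun _ _ h =>
  (lastOrder R).symm.injective (Fin.ext h)

theorem time_lt {R : Finset (Fin n)} {u v : Fin n} (hu : u ∈ R) (hv : v ∉ R) :
    time R v < time R u := by
  by_contra h
  have h1 : (lastOrder R).symm u ≤ (lastOrder R).symm v := not_lt.1 h
  have h2 := Tuple.monotone_sort (fun v => if v ∈ R then 1 else 0) h1
  simp only [Function.comp_apply] at h2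
  rw [← lastOrder, Equiv.apply_symm_apply, Equiv.apply_symm_apply, if_pos hu, if_neg hv] at h2
  omega

/-- The arrival positions, up to `i`, of the elements of `A`. -/
def visible (π : Equiv.Perm (Fin n)) (i : Fin n) (A : Finset (Fin n)) : ArrivedSet n i :=
  ⟨(Finset.Iic i).filter fun x => π x ∈ A, Finset.filter_subset _ _⟩

/-- A number divisible by the number of types of acceptance rules. -/
@[irreducible] def typeRange (n : ℕ) : ℕ := (2 * (Nat.clog 2 (Nat.clog 2 (16 * (n + 1))) + 2)).factorial

instance : NeZero (typeRange n) := ⟨by rw [typeRange]; exact Nat.factorial_ne_zero _⟩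

/-- The random choices: the sample, the labels of the other elements, the elements that are
considered, those of them that are only used as references, the thinning set, and the type. -/
abbrev Choices (n : ℕ) : Type :=
  Finset (Fin n) × (Fin n → Fin 80) × Finset (Fin n) × Finset (Fin n) × Finset (Fin n) ×
    Fin (typeRange n)

/-- The algorithm: elements are renamed so that the elements which may be selected come last, and
are then accepted according to a rule of a random type. -/
def algorithm (n : ℕ) : OnlineAlgorithm n where
  Seed := Choices n
  law := PMF.uniformOfFintype (Choices n)
  accept := fun ⟨S, b, C, D, Th, h⟩ i val ind =>
    let R := (extra S b ∩ C) \ D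
    let π := lastOrder R
    let f' : Finset (Fin n) → ℝ := fun A => val (visible π i A)
    let I' : Finset (Fin n) → Prop := fun A => ind (visible π i A)
    let V := arrived (time R) (π i)
    decide (π i ∈ R ∧ π i ∈ Th ∧ Accept f' I' S (extra S b ∩ C) D (lev I' S)
      (h % (2 * (lev I' S + 2))) (proc f' I' S V ∅) V (π i))

variable {E : Type*} [DecidableEq E]

/-- The set function on positions. -/
def pullFun (f : Finset E → ℝ) (σ : Fin n ≃ E) (A : Finset (Fin n)) : ℝ := f (A.map σ.toEmbedding)

/-- Independence of sets of positions. -/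
def pullIndep (M : Matroid E) (σ : Fin n ≃ E) (A : Finset (Fin n)) : Prop :=
  M.Indep (A.map σ.toEmbedding : Finset E)

theorem pullFun_submodular {f : Finset E → ℝ} (hf : IsSubmodular f) (σ : Fin n ≃ E) :
    IsSubmodular (pullFun f σ) := by
  intro A B e hAB he
  simp only [pullFun, Finset.map_insert]
  exact hf _ _ _ (Finset.map_subset_map.2 hAB) (by simpa using he)

theorem pullIndep_iff (M : Matroid E) (σ : Fin n ≃ E) (A : Finset (Fin n)) :
    pullIndep M σ A ↔ (M.comap σ).Indep (A : Set (Fin n)) := by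
  rw [pullIndep, Matroid.comap_indep_iff, Finset.coe_map]
  exact (and_iff_left σ.injective.injOn).symm

/-- The element at position `x` bears the name `lastOrder R x`. Names that have arrived correspond
to positions up to `i`, so the truncation in `visible` removes nothing. -/
theorem map_visible (σ : Fin n ≃ E) {R A : Finset (Fin n)} {i : Fin n}
    (hA : A ⊆ arrived (time R) (lastOrder R i)) :
    (visible (lastOrder R) i A).1.map σ.toEmbedding =
      A.map ((lastOrder R).symm.trans σ).toEmbedding := by
  ext e
  simp only [visible, Finset.mem_map, Finset.mem_filter, Finset.mem_Iic,
    Equiv.coe_toEmbedding, Equiv.trans_apply]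
  constructor
  · rintro ⟨x, ⟨-, hx⟩, rfl⟩
    exact ⟨lastOrder R x, hx, by simp⟩
  · rintro ⟨v, hv, rfl⟩
    refine ⟨(lastOrder R).symm v, ⟨?_, by simpa using hv⟩, rfl⟩
    have := hA hv
    simpa [arrived, time] using this

/-- For a fixed seed the online run coincides with the offline selection for the naming `τ`: when a
candidate from `R` is decided, the whole sample and all references have arrived. -/
theorem output_algorithm (M : Matroid E) (f : Finset E → ℝ) (σ : Fin n ≃ E)
    (S : Finset (Fin n)) (b : Fin n → Fin 80) (C D Th : Finset (Fin n)) (h : Fin (typeRange n))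
    {τ : Fin n ≃ E} (hτ : τ = (lastOrder ((extra S b ∩ C) \ D)).symm.trans σ) :
    (algorithm n).output M f σ (S, b, C, D, Th, h) =
      (sel (pullFun f τ) (pullIndep M τ) S (extra S b ∩ C) D (time ((extra S b ∩ C) \ D))
        (h % (2 * (lev (pullIndep M τ) S + 2))) ∩ Th).map τ.toEmbedding := by
  set R := (extra S b ∩ C) \ D with hR
  have hacc : ∀ i, (algorithm n).accepts M f σ (S, b, C, D, Th, h) i = true ↔
      lastOrder R i ∈ sel (pullFun f τ) (pullIndep M τ) S (extra S b ∩ C) D (time R)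
        (h % (2 * (lev (pullIndep M τ) S + 2))) ∩ Th := by
    intro i
    set V := arrived (time R) (lastOrder R i) with hV
    simp only [OnlineAlgorithm.accepts, algorithm, decide_eq_true_eq, sel, Finset.mem_inter,
      Finset.mem_filter]
    rw [← hR, ← hV, and_assoc]
    refine and_congr_right fun hi => ?_
    rw [and_comm]
    refine and_congr_left fun _ => ?_
    have hS : S ⊆ V := fun v hv => by
      simp only [hV, arrived, Finset.mem_filter, Finset.mem_univ, true_and]
      refine (time_lt hi fun hvR => ?_).le
      exact Finset.disjoint_left.1 (disjoint_extra S b) hv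
        (Finset.mem_inter.1 (Finset.mem_sdiff.1 hvR).1).1
    have hu : lastOrder R i ∈ V := by simp [hV, arrived]
    have hf' : ∀ A ⊆ V, f ((visible (lastOrder R) i A).1.map σ.toEmbedding) =
        pullFun f τ A := fun A hA => by rw [map_visible σ hA, pullFun, hτ]
    have hI' : ∀ A ⊆ V, (M.Indep ((visible (lastOrder R) i A).1.map σ.toEmbedding : Finset E) ↔
        pullIndep M τ A) := fun A hA => by rw [map_visible σ hA, pullIndep, hτ]
    rw [lev_congr hI' hS]
    exact accept_congr hf' hI' hS _ _ hu
  ext e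
  simp only [OnlineAlgorithm.output, Finset.mem_map, Finset.mem_filter, Finset.mem_univ, true_and,
    hacc]
  constructor
  · rintro ⟨i, hi, rfl⟩
    exact ⟨lastOrder R i, hi, by simp [hτ]⟩
  · rintro ⟨v, hv, rfl⟩
    exact ⟨(lastOrder R).symm v, by simpa using hv, by simp [hτ]⟩

theorem output_indep {M : Matroid E} (hM : M.E = Set.univ) (f : Finset E → ℝ) (σ : Fin n ≃ E)
    (s : Choices n) : M.Indep ((algorithm n).output M f σ s : Set E) := by
  obtain ⟨S, b, C, D, Th, h⟩ := s
  rw [output_algorithm M f σ S b C D Th h rfl]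
  set τ := (lastOrder ((extra S b ∩ C) \ D)).symm.trans σ
  have h1 := sel_indep (f := pullFun f τ) (N := M.comap τ) (by simp [hM]) (pullIndep_iff M τ)
    S (extra S b ∩ C) D (time_injective ((extra S b ∩ C) \ D))
    (fun u hu v hv => time_lt hu hv) (h % (2 * (lev (pullIndep M τ) S + 2)))
  refine (pullIndep_iff M τ _).2 (h1.subset ?_)
  exact_mod_cast Finset.inter_subset_left

/-! ### The number of rule types and the expected value. -/

theorem sum_range_mod (g : ℕ → ℝ) (k q : ℕ) :
    ∑ j ∈ Finset.range (k * q), g (j % k) = q * ∑ j ∈ Finset.range k, g j := by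
  induction q with
  | zero => simp
  | succ q ih =>
    rw [Nat.mul_succ, Finset.sum_range_add, ih]
    have : ∀ j ∈ Finset.range k, g ((k * q + j) % k) = g j := fun j hj => by
      rw [Nat.mul_add_mod, Nat.mod_eq_of_lt (Finset.mem_range.1 hj)]
    rw [Finset.sum_congr rfl this]
    push_cast
    ring

/-- The number `k` of types is known only after the sample has been seen. As the factorial is
divisible by every possible `k`, the residue of a uniform `h` is exactly uniform. -/
theorem sum_typeRange (g : ℕ → ℝ) {k : ℕ} (hk : 0 < k) (hkn : k ∣ typeRange n) :
    ∑ h : Fin (typeRange n), g (h % k) =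
      typeRange n * ((∑ j ∈ Finset.range k, g j) / k) := by
  obtain ⟨q, hq⟩ := hkn
  rw [Fin.sum_univ_eq_sum_range (fun j => g (j % k)), hq, sum_range_mod]
  have : (k : ℝ) ≠ 0 := by positivity
  push_cast
  field_simp

theorem rules_dvd_typeRange (I : Finset (Fin n) → Prop) (S : Finset (Fin n)) :
    2 * (lev I S + 2) ∣ typeRange n := by
  rw [typeRange]
  refine Nat.dvd_factorial (by omega) ?_
  have h1 : rankOf I S ≤ n := rankOf_le fun J _ _ => by simpa using J.card_le_univ
  have h2 : lev I S ≤ Nat.clog 2 (Nat.clog 2 (16 * (n + 1))) :=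
    Nat.clog_mono_right 2 (Nat.clog_mono_right 2 (by omega))
  omega

/-- With `t = s + 3`, the hypotheses give `2 ^ (2 ^ (s + 2)) < 16 * (r + 1)`. Half of the exponent
absorbs the factor 16, as `2 ^ (s + 1) ≥ 8`, leaving `2 ^ (2 ^ (s + 1)) ≤ r`; two logarithms with
`log 2 ≥ 1 / 2` finish. -/
theorem le_loglog {t y r : ℕ} (ht : 5 ≤ t) (h1 : 2 ^ (t - 1) < y)
    (h2 : 2 ^ (y - 1) < 16 * (r + 1)) : (t : ℝ) ≤ 3 + 2 * Real.log (Real.log r) := by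
  obtain ⟨s, hs⟩ : ∃ s, t = s + 3 := ⟨t - 3, by omega⟩
  have hs' : t - 1 = s + 2 := by omega
  rw [hs'] at h1
  have h3 : 2 ^ (2 ^ (s + 2)) < 16 * (r + 1) :=
    lt_of_le_of_lt (Nat.pow_le_pow_right Nat.zero_lt_two (Nat.le_sub_one_of_lt h1)) h2
  have h4 : 2 ^ 3 ≤ 2 ^ (s + 1) := Nat.pow_le_pow_right Nat.zero_lt_two (by omega)
  have h5 : 2 ^ (s + 2) = 2 ^ (s + 1) + 2 ^ (s + 1) := by ring
  have h6 : 2 ^ 5 * 2 ^ (2 ^ (s + 1)) ≤ 2 ^ (2 ^ (s + 2)) := by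
    rw [← pow_add, h5]
    exact Nat.pow_le_pow_right Nat.zero_lt_two
      (Nat.add_le_add_right (le_trans (by norm_num) h4) _)
  have h7 : 1 ≤ 2 ^ (2 ^ (s + 1)) := Nat.one_le_two_pow
  have h8 : 2 ^ (2 ^ (s + 1)) ≤ r := by
    generalize 2 ^ (2 ^ (s + 1)) = p at h6 h7
    generalize 2 ^ (2 ^ (s + 2)) = q at h6 h3
    clear h1 h2 h4 h5
    omega
  have h9 : (2 : ℝ) ^ (2 ^ (s + 1)) ≤ r := by
    have := (Nat.cast_le (α := ℝ)).2 h8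
    rwa [Nat.cast_pow, Nat.cast_ofNat] at this
  have hl2 : (1 / 2 : ℝ) ≤ Real.log 2 := by
    have := Real.log_two_gt_d9
    linarith
  have h10 : (2 : ℝ) ^ s ≤ Real.log r := by
    have := Real.log_le_log (pow_pos two_pos _) h9
    rw [Real.log_pow, Nat.cast_pow, Nat.cast_ofNat, pow_succ] at this
    have h0 : (0 : ℝ) < 2 ^ s := by positivity
    nlinarith
  have h11 : (s : ℝ) / 2 ≤ Real.log (Real.log r) := by
    have := Real.log_le_log (by positivity) h10
    rw [Real.log_pow] at this
    have h0 : (0 : ℝ) ≤ s := Nat.cast_nonneg _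
    nlinarith
  have h12 : (t : ℝ) = s + 3 := by rw [hs]; push_cast; ring
  linarith

theorem lev_le_loglog (r : ℕ) :
    ((2 * (Nat.clog 2 (Nat.clog 2 (16 * (r + 1))) + 2) : ℕ) : ℝ) ≤
      14 * max 1 (Real.log (Real.log r)) := by
  have hmax := le_max_left 1 (Real.log (Real.log r))
  have hmax' := le_max_right 1 (Real.log (Real.log r))
  have hclog : ∀ x, 1 < x → 2 ^ (Nat.clog 2 x - 1) < x := fun x hx =>
    Nat.pow_pred_clog_lt_self Nat.one_lt_two hx
  have h2 := hclog (16 * (r + 1)) (by omega)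
  generalize Nat.clog 2 (16 * (r + 1)) = y at h2 ⊢
  have h1 := hclog y
  have h3 : y ≤ 1 → Nat.clog 2 y = 0 := fun h => Nat.clog_of_right_le_one h 2
  generalize Nat.clog 2 y = t at h1 h3 ⊢
  -- Then `2 * (t + 2)` is at most 10 + 4 = 14 times the maximum.
  have h : (t : ℝ) ≤ 5 * max 1 (Real.log (Real.log r)) := by
    rcases lt_or_ge t 5 with h5 | h5
    · have : (t : ℝ) ≤ 4 := by exact_mod_cast Nat.le_of_lt_succ h5
      linarith
    · have := le_loglog h5 (h1 (by by_contra h; have := h3 (by omega); omega)) h2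
      linarith
  push_cast
  linarith

theorem rules_le [Finite E] (M : Matroid E) (τ : Fin n ≃ E) (S : Finset (Fin n)) :
    ((2 * (lev (pullIndep M τ) S + 2) : ℕ) : ℝ) ≤
      14 * max 1 (Real.log (Real.log (M.eRank.toNat : ℝ))) := by
  refine le_trans ?_ (lev_le_loglog M.eRank.toNat)
  have h1 : rankOf (pullIndep M τ) S ≤ M.eRank.toNat := rankOf_le fun J _ hJ => by
    have h := Matroid.Indep.encard_le_eRank hJ
    have hfin : M.eRank ≠ ⊤ := by
      obtain ⟨B, hB⟩ := M.exists_isBase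
      rw [← hB.encard_eq_eRank]
      exact (Set.toFinite B).encard_lt_top.ne
    have := ENat.toNat_le_toNat h hfin
    rw [Set.encard_coe_eq_coe_finsetCard, ENat.toNat_natCast, Finset.card_map] at this
    exact this
  have h2 : lev (pullIndep M τ) S ≤ Nat.clog 2 (Nat.clog 2 (16 * (M.eRank.toNat + 1))) :=
    Nat.clog_mono_right 2 (Nat.clog_mono_right 2 (by omega))
  exact_mod_cast (by omega : 2 * (lev (pullIndep M τ) S + 2) ≤
    2 * (Nat.clog 2 (Nat.clog 2 (16 * (M.eRank.toNat + 1))) + 2))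

/-- For a fixed seed, the renaming of the elements does not change the distribution of their
order. -/
theorem sum_output_eq [Fintype E] (M : Matroid E) (f : Finset E → ℝ)
    (S : Finset (Fin n)) (b : Fin n → Fin 80) (C D Th : Finset (Fin n))
    (h : Fin (typeRange n)) :
    ∑ σ : Fin n ≃ E, f ((algorithm n).output M f σ (S, b, C, D, Th, h)) =
      ∑ τ : Fin n ≃ E, pullFun f τ (sel (pullFun f τ) (pullIndep M τ) S (extra S b ∩ C) D
        (time ((extra S b ∩ C) \ D)) (h % (2 * (lev (pullIndep M τ) S + 2))) ∩ Th) := by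
  set π := lastOrder ((extra S b ∩ C) \ D) with hπ
  let e : (Fin n ≃ E) ≃ (Fin n ≃ E) :=
    { toFun := fun σ => π.symm.trans σ
      invFun := fun τ => π.trans τ
      left_inv := fun σ => by ext x; simp
      right_inv := fun τ => by ext x; simp }
  refine Fintype.sum_equiv e _ _ fun σ => ?_
  rw [output_algorithm M f σ S b C D Th h (τ := e σ) rfl]
  rfl

theorem sum_choices_ge [Fintype E] {M : Matroid E} {f : Finset E → ℝ} (hM : M.E = Set.univ)
    (h0 : ∀ A, 0 ≤ f A) (hf : IsSubmodular f) (τ : Fin n ≃ E) {O : Finset E}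
    (hO : M.Indep (O : Set E)) :
    (Fintype.card (Choices n) : ℝ) * f O ≤
      81920 * (14 * max 1 (Real.log (Real.log (M.eRank.toNat : ℝ)))) *
        ∑ S : Finset (Fin n), ∑ b : Fin n → Fin 80, ∑ C : Finset (Fin n), ∑ D : Finset (Fin n),
          ∑ Th : Finset (Fin n), ∑ h : Fin (typeRange n),
            pullFun f τ (sel (pullFun f τ) (pullIndep M τ) S (extra S b ∩ C) D
        (time ((extra S b ∩ C) \ D)) (h % (2 * (lev (pullIndep M τ) S + 2))) ∩ Th) := by
  have hτ : (O.map τ.symm.toEmbedding).map τ.toEmbedding = O := by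
    ext x; simp
  have h1 := opt_le_average (m := 80) rfl (pullFun_submodular hf τ) (fun A => h0 _)
    (N := M.comap τ) (by simp [hM]) (pullIndep_iff M τ)
    (fun S b C D => time ((extra S b ∩ C) \ D)) (fun S b C D u hu v hv => time_lt hu hv)
    (rules_le M τ) (O := O.map τ.symm.toEmbedding) (by rwa [pullIndep, hτ])
  have h2 : pullFun f τ (O.map τ.symm.toEmbedding) = f O := by rw [pullFun, hτ]
  rw [h2] at h1
  have h3 : ∀ S (b : Fin n → Fin 80) (C D Th : Finset (Fin n)),
      ∑ h : Fin (typeRange n), pullFun f τ (sel (pullFun f τ) (pullIndep M τ) S (extra S b ∩ C) D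
        (time ((extra S b ∩ C) \ D)) (h % (2 * (lev (pullIndep M τ) S + 2))) ∩ Th) =
      typeRange n * ((∑ j ∈ Finset.range (2 * (lev (pullIndep M τ) S + 2)),
        pullFun f τ (sel (pullFun f τ) (pullIndep M τ) S (extra S b ∩ C) D
          (time ((extra S b ∩ C) \ D)) j ∩ Th)) /
            ((2 * (lev (pullIndep M τ) S + 2) : ℕ) : ℝ)) := fun S b C D Th =>
    sum_typeRange (fun j => pullFun f τ (sel (pullFun f τ) (pullIndep M τ) S (extra S b ∩ C) D
        (time ((extra S b ∩ C) \ D)) j ∩ Th)) (by omega) (rules_dvd_typeRange _ S)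
  simp only [h3, ← Finset.mul_sum]
  have h4 : (Fintype.card (Choices n) : ℝ) = (Fintype.card (Finset (Fin n)) : ℝ) ^ 4 *
      Fintype.card (Fin n → Fin 80) * typeRange n := by
    simp only [Choices, Fintype.card_prod, Fintype.card_fin (typeRange n)]
    push_cast
    ring
  rw [h4]
  have h5 := mul_le_mul_of_nonneg_left h1 (Nat.cast_nonneg (typeRange n) : (0 : ℝ) ≤ typeRange n)
  linarith

/-- `sum_choices_ge` holds for each naming separately. The random order enters only through
`sum_output_eq`: for every seed, renaming by `lastOrder` permutes the arrival orders. -/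
theorem le_expectedValue [Fintype E] {M : Matroid E} {f : Finset E → ℝ} (hn : n = Fintype.card E)
    (hM : M.E = Set.univ) (h0 : ∀ A, 0 ≤ f A) (hf : IsSubmodular f) {O : Finset E}
    (hO : M.Indep (O : Set E)) :
    f O ≤ 81920 * (14 * max 1 (Real.log (Real.log (M.eRank.toNat : ℝ)))) *
      (algorithm n).expectedValue M f := by
  have hlaw : ∀ s : Choices n, (((algorithm n).law s).toReal) =
      (Fintype.card (Choices n) : ℝ)⁻¹ := fun s => by
    change ((PMF.uniformOfFintype (Choices n)) s).toReal = _
    rw [PMF.uniformOfFintype_apply, ENNReal.toReal_inv, ENNReal.toReal_natCast]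
  have hσ : Nonempty (Fin n ≃ E) := ⟨(Fintype.equivFinOfCardEq hn.symm).symm⟩
  have hcσ : (0 : ℝ) < Fintype.card (Fin n ≃ E) := by exact_mod_cast Fintype.card_pos
  have hcs : (0 : ℝ) < Fintype.card (Choices n) := by exact_mod_cast Fintype.card_pos
  have hval : (algorithm n).expectedValue M f = (∑ τ : Fin n ≃ E,
      ∑ S : Finset (Fin n), ∑ b : Fin n → Fin 80, ∑ C : Finset (Fin n), ∑ D : Finset (Fin n),
          ∑ Th : Finset (Fin n), ∑ h : Fin (typeRange n),
            pullFun f τ (sel (pullFun f τ) (pullIndep M τ) S (extra S b ∩ C) D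
        (time ((extra S b ∩ C) \ D)) (h % (2 * (lev (pullIndep M τ) S + 2))) ∩ Th)) /
      (Fintype.card (Choices n) * Fintype.card (Fin n ≃ E)) := by
    have e1 : ∑ σ : Fin n ≃ E, ∑ s : Choices n, ((algorithm n).law s).toReal *
        f ((algorithm n).output M f σ s) = (Fintype.card (Choices n) : ℝ)⁻¹ *
        ∑ s : Choices n, ∑ σ : Fin n ≃ E, f ((algorithm n).output M f σ s) := by
      rw [Finset.sum_comm, Finset.mul_sum]
      refine Finset.sum_congr rfl fun s _ => ?_
      rw [Finset.mul_sum]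
      exact Finset.sum_congr rfl fun σ _ => by rw [hlaw]
    have e2 : (algorithm n).expectedValue M f = (∑ σ : Fin n ≃ E, ∑ s : Choices n,
        ((algorithm n).law s).toReal * f ((algorithm n).output M f σ s)) /
          (Fintype.card (Fin n ≃ E) : ℝ) := rfl
    rw [e2, e1]
    simp only [Fintype.sum_prod_type, sum_output_eq]
    rw [inv_mul_eq_div, div_div]
    congr 1
    rw [Finset.sum_comm (s := Finset.univ (α := Fin n ≃ E))]
    refine Finset.sum_congr rfl fun S _ => ?_
    rw [Finset.sum_comm (s := Finset.univ (α := Fin n ≃ E))]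
    refine Finset.sum_congr rfl fun b _ => ?_
    rw [Finset.sum_comm (s := Finset.univ (α := Fin n ≃ E))]
    refine Finset.sum_congr rfl fun C _ => ?_
    rw [Finset.sum_comm (s := Finset.univ (α := Fin n ≃ E))]
    refine Finset.sum_congr rfl fun D _ => ?_
    rw [Finset.sum_comm (s := Finset.univ (α := Fin n ≃ E))]
    refine Finset.sum_congr rfl fun Th _ => ?_
    rw [Finset.sum_comm (s := Finset.univ (α := Fin n ≃ E))]
  have hsum := Finset.sum_le_sum fun τ (_ : τ ∈ Finset.univ (α := Fin n ≃ E)) =>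
    sum_choices_ge hM h0 hf τ hO
  rw [Finset.sum_const, Finset.card_univ, nsmul_eq_mul, ← Finset.mul_sum] at hsum
  rw [hval, mul_div_assoc', le_div_iff₀ (mul_pos hcs hcσ)]
  linarith

end Algorithm

end

end SubmodularSecretary

theorem mainTheorem3 :
    ∃ (C : ℝ) (A : (n : ℕ) → OnlineAlgorithm n), 0 < C ∧
      ∀ (E : Type*) [Fintype E] [DecidableEq E] (M : Matroid E) (f : Finset E → ℝ),
        M.E = Set.univ → (∀ S, 0 ≤ f S) → IsSubmodular f →
          (A (Fintype.card E)).IsCompetitiveOn M f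
            (C * max 1 (Real.log (Real.log (M.eRank.toNat : ℝ)))) := by
  refine ⟨81920 * 14, SubmodularSecretary.algorithm, by norm_num, ?_⟩
  intro E _ _ M f hM h0 hf
  refine ⟨fun σ s => SubmodularSecretary.output_indep hM f σ s, fun S hS => ?_⟩
  have := SubmodularSecretary.le_expectedValue rfl hM h0 hf hS
  rwa [mul_assoc 81920 14]
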